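/- **Conventions.** Let $\pi$ be an irreducible permutation given by two lines, each containing each of $N$ symbols exactly once (irreducible: for no $0<k<N$ do the first $k$ entries of the two lines form the same set). Given lengths $|X_\alpha|>0$ of the symbols, put $\vec v_\alpha=|X_\alpha|+\sqrt{-1}\,\bigl(b(\alpha)-t(\alpha)\bigr)\in\mathbb C$, where $t(\alpha)$ and $b(\alpha)$ are the positions of $\alpha$ in the top and in the bottom line. The broken lines starting at $0$ with consecutive sides $\vec v_\alpha$, taken in the order of the top line and in the order of the bottom line, bound a polygon from above and from below. Identifying, for every $\alpha$, the two sides corresponding to $\vec v_\alpha$ by a parallel translation gives a closed surface (the suspension) with a complex structure and a holomorphic 1-form $\omega$ induced by $dz$ on the polygon. Its horizontal diagonal is $X=\bigl[0,\sum_\alpha|X_\alpha|\bigr]$. We say that $\pi$ *represents the stratum* $\mathcal H(d_1,\dots,d_n)$ if, for every choice of the lengths, the suspension is a compact connected Riemann surface on which $\omega$ has exactly $n$ distinct zeros $z_1,\dots,z_n$, of degrees $d_1,\dots,d_n$ respectively, enumerated so that $z_1$ is the left endpoint and $z_n$ the right endpoint of $X$. A permutation is *cylindrical* if the first symbol of one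 of its lines is the last symbol of the other line. **Proposition.** Let $n\ge 1$ and let $d_1,\dots,d_n$ be strictly positive integers with $d_1+\dots+d_n=2g-2$ (so $g\ge2$). Consider the permutation $$ \begin{pmatrix} 0&1&2&3&4&5&6&7&8&\dots&4g-7&4g-6&4g-5&4g-4&&\\ &&4&3&2&5&8&7&6&\dots&4g-7&4g-4&4g-5&4g-6&1&0 \end{pmatrix}, $$ whose top line is $0,1,2,\dots,4g-4$ and whose bottom line consists of the blocks $4k,4k-1,4k-2$ for $k=1,\dots,g-1$ in this order, with the symbol $4k+1$ inserted between the $k$-th and the $(k+1)$-st block for $1\le k\le g-2$, followed by $1,0$ (for $g=2$ the bottom line is $4,3,2,1,0$). In both lines erase, for every $i=1,\dots,n$, the $d_i-1$ odd symbols $$2(d_1+\dots+d_{i-1})+3,\ 2(d_1+\dots+d_{i-1})+5,\ \dots,\ 2(d_1+\dots+d_i)-1$$ (no symbols if $d_i=1$). Then the resulting permutation is cylindrical and represents the stratum $\mathcal H(d_1,\dots,d_n)$. -/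

import Mathlib

open scoped Manifold ContDiff

noncomputable section

/-! ### Riemann surfaces with a holomorphic 1-form, zeros, strata -/

/-- A holomorphic 1-form on a one-dimensional complex manifold `M`: in every chart `e` of the atlas
it is `coeff e (w) dw` with `coeff e` holomorphic on the image of the chart, and these local
expressions transform into each other under the changes of charts.
(The value of `coeff` on maps which are not charts of the atlas plays no role.) -/
structure HolomorphicOneForm (M : Type*) [TopologicalSpace M] [ChartedSpace ℂ M] where
  coeff : OpenPartialHomeomorph M ℂ → ℂ → ℂ
  analytic : ∀ e ∈ atlas ℂ M, AnalyticOnNhd ℂ (coeff e) e.target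
  compat : ∀ e ∈ atlas ℂ M, ∀ e' ∈ atlas ℂ M, ∀ x ∈ e.source ∩ e'.source,
    coeff e (e x) = coeff e' (e' x) * deriv (fun w => e' (e.symm w)) (e x)

namespace HolomorphicOneForm

variable {M : Type*} [TopologicalSpace M] [ChartedSpace ℂ M]

/-- The order of vanishing of a holomorphic 1-form at a point. -/
def order (η : HolomorphicOneForm M) (x : M) : ℕ∞ :=
  analyticOrderAt (η.coeff (chartAt ℂ x)) (chartAt ℂ x x)

/-- `(M, η)` belongs to the stratum `H(d₁, …, dₙ)`, and `z₁, …, zₙ` is an enumeration of the zeros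
of `η` such that `zᵢ` has degree `dᵢ`: `M` is a compact connected Riemann surface, and the `zᵢ` are
pairwise distinct, have degrees `dᵢ`, and there are no further zeros. -/
structure MemStratum {k : ℕ} [IsManifold 𝓘(ℂ) ω M]
    (η : HolomorphicOneForm M) (d : Fin k → ℕ) (z : Fin k → M) : Prop where
  compact : CompactSpace M
  connected : ConnectedSpace M
  hausdorff : T2Space M
  injective : Function.Injective z
  order_zero : ∀ i, η.order (z i) = d i
  order_eq_zero : ∀ x, x ∉ Set.range z → η.order x = 0

end HolomorphicOneForm

/-! ### Permutations given by two lines of symbols -/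

/-- Two nonempty words in the same symbols, each symbol occurring exactly once in each word. -/
def IsTruePermutation (top bot : List ℕ) : Prop :=
  top ≠ [] ∧ top.Nodup ∧ bot.Perm top

/-- No proper initial part of the top line has the same symbols as the initial part of the bottom
line of the same length. -/
def IsIrreduciblePermutation (top bot : List ℕ) : Prop :=
  ∀ k, 0 < k → k < top.length → (top.take k).toFinset ≠ (bot.take k).toFinset

/-- The first symbol of one of the lines coincides with the last symbol of the complementary line,
and the set of symbols of neither line is a proper subset of that of the other one. -/
def IsCylindrical (top bot : List ℕ) : Prop :=
  ((∃ a, top.head? = some a ∧ bot.getLast? = some a) ∨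
    (∃ a, bot.head? = some a ∧ top.getLast? = some a)) ∧
  ¬ top.toFinset ⊂ bot.toFinset ∧ ¬ bot.toFinset ⊂ top.toFinset

/-! ### The suspension over an interval exchange transformation

The intervals have lengths `lam a`, they are ordered as in `top` before the exchange
and as in `bot` after the exchange. -/

/-- The vector `|X_a| + i (π(a) - a)` of the side labelled by `a`, where the position of `a` in the
bottom line is `π` of its position in the top line. -/
def sideVector (top bot : List ℕ) (lam : ℕ → ℝ) (a : ℕ) : ℂ :=
  (lam a : ℂ) + ((bot.idxOf a : ℂ) - (top.idxOf a : ℂ)) * Complex.I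

/-- The vertex number `k` of the broken line starting at `0` with consecutive sides `v a`,
`a` running through the word `line`. -/
def lineVertex (line : List ℕ) (v : ℕ → ℂ) (k : ℕ) : ℂ :=
  ((line.take k).map v).sum

/-- The broken line starting at `0` with consecutive sides `v a`, `a` in `line`. -/
def brokenLine (line : List ℕ) (v : ℕ → ℂ) : Set ℂ :=
  ⋃ k ∈ Set.Iio line.length, segment ℝ (lineVertex line v k) (lineVertex line v (k + 1))

/-- The closed polygon bounded from above by the broken line of `top` and from below by the broken
line of `bot`. -/
def suspensionPolygon (top bot : List ℕ) (lam : ℕ → ℝ) : Set ℂ :=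
  {w | ∃ a ∈ brokenLine top (sideVector top bot lam), ∃ b ∈ brokenLine bot (sideVector top bot lam),
    a.re = w.re ∧ b.re = w.re ∧ b.im ≤ w.im ∧ w.im ≤ a.im}

/-- A point of a side of the upper broken line is glued, by the parallel translation, to the
corresponding point of the side of the lower broken line which carries the same symbol. -/
def sideGluing (top bot : List ℕ) (lam : ℕ → ℝ) (p q : suspensionPolygon top bot lam) : Prop :=
  ∃ a ∈ top, ∃ t ∈ Set.Icc (0 : ℝ) 1,
    (p : ℂ) = lineVertex top (sideVector top bot lam) (top.idxOf a)
      + t * sideVector top bot lam a ∧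
    (q : ℂ) = lineVertex bot (sideVector top bot lam) (bot.idxOf a)
      + t * sideVector top bot lam a

/-- The closed surface obtained from the polygon by identifying the pairs of sides; it is the
quotient, with the quotient topology, by the equivalence relation generated by `sideGluing`. -/
abbrev Suspension (top bot : List ℕ) (lam : ℕ → ℝ) : Type :=
  Quot (sideGluing top bot lam)

/-- The point of the suspension represented by a point of the polygon. -/
def Suspension.mk (top bot : List ℕ) (lam : ℕ → ℝ) (p : suspensionPolygon top bot lam) :
    Suspension top bot lam :=
  Quot.mk _ p

/-- The complex structure and the 1-form `η` on the suspension are those induced by the polygon: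
in the interior of the polygon the projection to the suspension is holomorphic and
`η` is `dz` for the coordinate `z` of the plane. (`Function.extend` only serves to view a map
defined on the polygon as a map defined on `ℂ`.) -/
def IsInducedByPolygon (top bot : List ℕ) (lam : ℕ → ℝ) [ChartedSpace ℂ (Suspension top bot lam)]
    (η : HolomorphicOneForm (Suspension top bot lam)) : Prop :=
  ∀ p : suspensionPolygon top bot lam, (p : ℂ) ∈ interior (suspensionPolygon top bot lam) →
    ∀ e ∈ atlas ℂ (Suspension top bot lam), Suspension.mk top bot lam p ∈ e.source →
      ∃ c : ℂ, HasDerivAt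
          (Function.extend Subtype.val (fun q => e (Suspension.mk top bot lam q)) 0) c (p : ℂ) ∧
        η.coeff e (e (Suspension.mk top bot lam p)) * c = 1

/-- The permutation with lines `top` and `bot` represents the stratum `H(d₀, …, dₘ)`: it is an
irreducible permutation, and for all choices of lengths of the intervals the suspension, with the
complex structure and the 1-form induced by `dz` on the polygon, belongs to `H(d₀, …, dₘ)`, where
the zeros `z₀, …, zₘ` of degrees `d₀, …, dₘ` can be enumerated in such a way that `z₀` is at the
left endpoint and `zₘ` at the right endpoint of the horizontal segment `X = [0, ∑ lam a]`. -/
def RepresentsStratum (top bot : List ℕ) {m : ℕ} (d : Fin (m + 1) → ℕ) : Prop :=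
  IsTruePermutation top bot ∧ IsIrreduciblePermutation top bot ∧
  ∀ lam : ℕ → ℝ, (∀ a ∈ top, 0 < lam a) →
    ∃ (_ : ChartedSpace ℂ (Suspension top bot lam))
      (_ : IsManifold 𝓘(ℂ) ω (Suspension top bot lam))
      (η : HolomorphicOneForm (Suspension top bot lam)),
      IsInducedByPolygon top bot lam η ∧
      ∃ z : Fin (m + 1) → Suspension top bot lam,
        η.MemStratum d z ∧
        (∃ h : (0 : ℂ) ∈ suspensionPolygon top bot lam,
          Suspension.mk top bot lam ⟨0, h⟩ = z 0) ∧
        (∃ h : (((top.map lam).sum : ℝ) : ℂ) ∈ suspensionPolygon top bot lam,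
          Suspension.mk top bot lam ⟨_, h⟩ = z (Fin.last m))

/-! ### The explicit permutation -/

/-- The top line `0 1 2 … 4g-4` (for `g ≥ 2`). -/
def principalTop (g : ℕ) : List ℕ := List.range (4 * g - 3)

/-- The bottom line `4 3 2 | 5 | 8 7 6 | 9 | 12 11 10 | … | 4g-7 | 4g-4 4g-5 4g-6 | 1 0`
(for `g ≥ 2`; for `g = 2` it is `4 3 2 1 0`). -/
def principalBot (g : ℕ) : List ℕ :=
  [4, 3, 2] ++
    (List.range (g - 2)).flatMap (fun j => [4 * j + 5, 4 * j + 8, 4 * j + 7, 4 * j + 6]) ++ [1, 0]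

/-- The symbols to be erased: for every `i` the `dᵢ - 1` odd symbols
`2 (∑_{j < i} dⱼ) + 3, …, 2 (∑_{j ≤ i} dⱼ) - 1`. -/
def erasedSymbols {k : ℕ} (d : Fin k → ℕ) : Finset ℕ :=
  Finset.univ.biUnion fun i =>
    (Finset.Ico 1 (d i)).image fun r => 2 * (∑ j ∈ Finset.Iio i, d j) + 2 * r + 1

/-- Erase the symbols of `s` from a line. -/
def eraseSymbols (s : Finset ℕ) (line : List ℕ) : List ℕ :=
  line.filter (fun a => a ∉ s)

end

noncomputable section

/-! ### Flat charts on a quotient of a planar set -/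

namespace FlatQuotient

open Filter Topology Metric Set

/-- A continuous `k`-th root of a function which is complex differentiable and has isolated zeros
is complex differentiable. -/
theorem differentiableAt_of_pow_eq {g f : ℂ → ℂ} {p : ℂ} {k : ℕ} (hk : 0 < k)
    (hf : ∀ᶠ z in 𝓝 p, DifferentiableAt ℂ f z) (hg : ∀ᶠ z in 𝓝 p, ContinuousAt g z)
    (h : ∀ᶠ z in 𝓝 p, g z ^ k = f z) (hne : ∀ᶠ z in 𝓝[≠] p, f z ≠ 0) :
    DifferentiableAt ℂ g p := by
  have away : ∀ z, g z ≠ 0 → ContinuousAt g z → DifferentiableAt ℂ f z →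
      (∀ᶠ y in 𝓝 z, g y ^ k = f y) → DifferentiableAt ℂ g z := by
    intro z hz hc hd hev
    have hs : HasStrictDerivAt (fun x : ℂ => x ^ k) ((k : ℂ) * g z ^ (k - 1)) (g z) :=
      hasStrictDerivAt_pow k (g z)
    have hn : (k : ℂ) * g z ^ (k - 1) ≠ 0 :=
      mul_ne_zero (by exact_mod_cast hk.ne') (pow_ne_zero _ hz)
    set l := hs.localInverse _ _ _ hn
    have hl : ∀ᶠ x in 𝓝 (g z), l (x ^ k) = x :=
      (hs.hasStrictFDerivAt_equiv hn).eventually_left_inverse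
    have hld : DifferentiableAt ℂ l (g z ^ k) :=
      (hs.to_localInverse hn).hasDerivAt.differentiableAt
    have e1 : g =ᶠ[𝓝 z] fun y => l (f y) := by
      filter_upwards [hc.eventually hl, hev] with y h1 h2
      rw [← h2, h1]
    refine DifferentiableAt.congr_of_eventuallyEq ?_ e1
    rw [hev.self_of_nhds] at hld
    exact hld.comp z hd
  refine (Complex.analyticAt_of_differentiable_on_punctured_nhds_of_continuousAt ?_
    hg.self_of_nhds).differentiableAt
  have h' := h.eventually_nhds
  filter_upwards [hne, hf.filter_mono nhdsWithin_le_nhds, hg.filter_mono nhdsWithin_le_nhds,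
    h'.filter_mono nhdsWithin_le_nhds] with z h1 h2 h3 h4
  refine away z (fun h0 => h1 ?_) h3 h2 h4
  rw [← h4.self_of_nhds, h0, zero_pow hk.ne']

theorem eventually_pow_add_ne_zero {k : ℕ} (hk : 0 < k) (c p : ℂ) :
    ∀ᶠ z in 𝓝[≠] p, z ^ k + c ≠ 0 := by
  have hP : (Polynomial.X ^ k + Polynomial.C c : Polynomial ℂ) ≠ 0 :=
    Polynomial.X_pow_add_C_ne_zero hk c
  have hfin := (Polynomial.rootSet_finite (Polynomial.X ^ k + Polynomial.C c : Polynomial ℂ) ℂ)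
  have : ∀ᶠ z in 𝓝[≠] p,
      z ∉ (Polynomial.X ^ k + Polynomial.C c : Polynomial ℂ).rootSet ℂ := by
    have h1 := (hfin.subset (sdiff_subset (t := {p}))).isClosed.isOpen_compl.mem_nhds
      (x := p) (by simp)
    filter_upwards [nhdsWithin_le_nhds h1, self_mem_nhdsWithin] with z hz hz' hz''
    exact hz ⟨hz'', hz'⟩
  filter_upwards [this] with z hz h0
  apply hz
  rw [Polynomial.mem_rootSet]
  exact ⟨hP, by simpa using h0⟩

variable {P : Set ℂ} {Rel : P → P → Prop}

/-- `e ^ k` is a local primitive of `dz` on the quotient of the planar set `P`. -/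
def IsFlat (e : OpenPartialHomeomorph (Quot Rel) ℂ) (k : ℕ) : Prop :=
  0 < k ∧ ∀ p : P, Quot.mk Rel p ∈ e.source →
    ∃ c : ℂ, ∀ᶠ q in 𝓝 p, e (Quot.mk Rel q) ^ k = (q : ℂ) + c

theorem isOpen_sep_eq {e e' : OpenPartialHomeomorph (Quot Rel) ℂ} {k k' : ℕ}
    (he : IsFlat e k) (he' : IsFlat e' k') (c : ℂ) :
    IsOpen {s | s ∈ e.source ∩ e'.source ∧ e' s ^ k' = e s ^ k + c} := by
  rw [← (isQuotientMap_quot_mk (r := Rel)).isOpen_preimage, isOpen_iff_mem_nhds]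
  rintro p ⟨⟨hp, hp'⟩, hc⟩
  obtain ⟨a, ha⟩ := he.2 p hp
  obtain ⟨b, hb⟩ := he'.2 p hp'
  have hsrc : ∀ᶠ q in 𝓝 p, Quot.mk Rel q ∈ e.source ∩ e'.source :=
    continuous_quot_mk.continuousAt.eventually
      ((e.open_source.inter e'.open_source).mem_nhds ⟨hp, hp'⟩)
  have h0 := ha.self_of_nhds
  have h0' := hb.self_of_nhds
  filter_upwards [ha, hb, hsrc] with q h1 h2 h3
  refine ⟨h3, ?_⟩
  rw [h1, h2]
  rw [h0, h0'] at hc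
  linear_combination hc

theorem eventually_transition {e e' : OpenPartialHomeomorph (Quot Rel) ℂ} {k k' : ℕ}
    (he : IsFlat e k) (he' : IsFlat e' k') {w : ℂ} (hw : w ∈ (e.symm ≫ₕ e').source) :
    ∃ c : ℂ, ∀ᶠ z in 𝓝 w, z ∈ (e.symm ≫ₕ e').source ∧ e' (e.symm z) ^ k' = z ^ k + c := by
  have hw1 : w ∈ e.target := by
    have := hw; simp only [OpenPartialHomeomorph.trans_source, mem_inter_iff] at this
    simpa using this.1
  have hw2 : e.symm w ∈ e'.source := by
    have := hw; simp only [OpenPartialHomeomorph.trans_source, mem_inter_iff] at this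
    simpa using this.2
  refine ⟨e' (e.symm w) ^ k' - w ^ k, ?_⟩
  have hopen := isOpen_sep_eq he he' (e' (e.symm w) ^ k' - w ^ k)
  have hmem : e.symm w ∈ {s | s ∈ e.source ∩ e'.source ∧
      e' s ^ k' = e s ^ k + (e' (e.symm w) ^ k' - w ^ k)} := by
    refine ⟨⟨e.map_target hw1, hw2⟩, ?_⟩
    rw [e.right_inv hw1]; ring
  have := (e.continuousAt_symm hw1).eventually (hopen.mem_nhds hmem)
  filter_upwards [this, (e.symm ≫ₕ e').open_source.mem_nhds hw, e.open_target.mem_nhds hw1]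
    with z h1 h2 h3
  refine ⟨h2, ?_⟩
  have := h1.2
  rwa [e.right_inv h3] at this

theorem differentiableAt_transition {e e' : OpenPartialHomeomorph (Quot Rel) ℂ} {k k' : ℕ}
    (he : IsFlat e k) (he' : IsFlat e' k') {w : ℂ} (hw : w ∈ (e.symm ≫ₕ e').source) :
    DifferentiableAt ℂ (fun z => e' (e.symm z)) w := by
  obtain ⟨c, hc⟩ := eventually_transition he he' hw
  refine differentiableAt_of_pow_eq (f := fun z => z ^ k + c) he'.1
    (Eventually.of_forall fun z => by fun_prop) ?_ (hc.mono fun z hz => hz.2)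
    (eventually_pow_add_ne_zero he.1 c w)
  filter_upwards [hc] with z hz
  exact (e.symm ≫ₕ e').continuousAt hz.1

theorem coeff_transition {e e' : OpenPartialHomeomorph (Quot Rel) ℂ} {k k' : ℕ}
    (he : IsFlat e k) (he' : IsFlat e' k') {s : Quot Rel} (hs : s ∈ e.source ∩ e'.source) :
    (k : ℂ) * e s ^ (k - 1) =
      (k' : ℂ) * e' s ^ (k' - 1) * deriv (fun w => e' (e.symm w)) (e s) := by
  have hw : e s ∈ (e.symm ≫ₕ e').source := by
    simp only [OpenPartialHomeomorph.trans_source, mem_inter_iff]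
    refine ⟨by simpa using e.map_source hs.1, ?_⟩
    simpa [e.left_inv hs.1] using hs.2
  obtain ⟨c, hc⟩ := eventually_transition he he' hw
  have hd := (differentiableAt_transition he he' hw).hasDerivAt
  have h1 := hd.pow k'
  have h2 : HasDerivAt (fun z : ℂ => z ^ k + c) ((k : ℂ) * e s ^ (k - 1)) (e s) :=
    (hasDerivAt_pow k (e s)).add_const c
  have h3 := h2.congr_of_eventuallyEq (hc.mono fun z hz => hz.2)
  have h4 := h3.unique h1
  simpa [e.left_inv hs.1] using h4

open Classical in
/-- The coefficient of the 1-form `dz` in a flat chart. -/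
def flatCoeff (e : OpenPartialHomeomorph (Quot Rel) ℂ) (w : ℂ) : ℂ :=
  if h : ∃ k, IsFlat e k then (h.choose : ℂ) * w ^ (h.choose - 1) else 0

theorem exists_flatCoeff {e : OpenPartialHomeomorph (Quot Rel) ℂ} {k : ℕ} (he : IsFlat e k) :
    ∃ j, IsFlat e j ∧ ∀ w, flatCoeff e w = (j : ℂ) * w ^ (j - 1) :=
  have h : ∃ k, IsFlat e k := ⟨k, he⟩
  ⟨h.choose, h.choose_spec, fun w => by rw [flatCoeff, dif_pos h]⟩

theorem flatCoeff_eq {e : OpenPartialHomeomorph (Quot Rel) ℂ} {k : ℕ} (he : IsFlat e k) {w : ℂ}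
    (hw : w ∈ e.target) : flatCoeff e w = (k : ℂ) * w ^ (k - 1) := by
  obtain ⟨j, hj, hj'⟩ := exists_flatCoeff he
  have hs := e.map_target hw
  have := coeff_transition hj he ⟨hs, hs⟩
  rw [e.right_inv hw] at this
  rw [hj', this]
  have hd : (fun w => e (e.symm w)) =ᶠ[𝓝 w] id := by
    filter_upwards [e.open_target.mem_nhds hw] with z hz
    exact e.right_inv hz
  rw [hd.deriv_eq]; simp

/-- The 1-form induced by `dz` for an atlas of flat charts. -/
def flatForm [ChartedSpace ℂ (Quot Rel)] (h : ∀ e ∈ atlas ℂ (Quot Rel), ∃ k, IsFlat e k) :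
    HolomorphicOneForm (Quot Rel) where
  coeff := flatCoeff
  analytic := by
    intro e he w _
    obtain ⟨k, hk⟩ := h e he
    obtain ⟨j, -, hj⟩ := exists_flatCoeff hk
    have : flatCoeff e = fun w => (j : ℂ) * w ^ (j - 1) := funext hj
    rw [this]
    fun_prop
  compat := by
    intro e he e' he' s hs
    obtain ⟨k, hk⟩ := h e he
    obtain ⟨k', hk'⟩ := h e' he'
    rw [flatCoeff_eq hk (e.map_source hs.1), flatCoeff_eq hk' (e'.map_source hs.2)]
    exact coeff_transition hk hk' hs

theorem isManifold_of_isFlat [ChartedSpace ℂ (Quot Rel)]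
    (h : ∀ e ∈ atlas ℂ (Quot Rel), ∃ k, IsFlat e k) : IsManifold 𝓘(ℂ) ω (Quot Rel) := by
  refine isManifold_of_contDiffOn _ _ _ fun e e' he he' => ?_
  obtain ⟨k, hk⟩ := h e he
  obtain ⟨k', hk'⟩ := h e' he'
  simp only [modelWithCornersSelf_coe, modelWithCornersSelf_coe_symm, Function.id_comp,
    Function.comp_id, preimage_id, range_id, inter_univ]
  refine DifferentiableOn.contDiffOn (fun w hw => ?_) (e.symm ≫ₕ e').open_source
  exact (differentiableAt_transition hk hk' hw).differentiableWithinAt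

theorem flatForm_order [ChartedSpace ℂ (Quot Rel)]
    (h : ∀ e ∈ atlas ℂ (Quot Rel), ∃ k, IsFlat e k) {s : Quot Rel} {k : ℕ}
    (hk : IsFlat (chartAt ℂ s) k) (hs : chartAt ℂ s s = 0) :
    (flatForm h).order s = (k - 1 : ℕ) := by
  have h0 : (0 : ℂ) ∈ (chartAt ℂ s).target := hs ▸ mem_chart_target ℂ s
  have hev : flatCoeff (chartAt ℂ s) =ᶠ[𝓝 0] fun w => (k : ℂ) * w ^ (k - 1) := by
    filter_upwards [(chartAt ℂ s).open_target.mem_nhds h0] with w hw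
    exact flatCoeff_eq hk hw
  change analyticOrderAt (flatCoeff (chartAt ℂ s)) (chartAt ℂ s s) = _
  rw [hs, analyticOrderAt_congr hev]
  have han : AnalyticAt ℂ (fun w : ℂ => (k : ℂ) * w ^ (k - 1)) 0 := by fun_prop
  rw [han.analyticOrderAt_eq_natCast]
  exact ⟨fun _ => (k : ℂ), by fun_prop, Nat.cast_ne_zero.2 hk.1.ne', Eventually.of_forall
    fun z => by simp [mul_comm]⟩

theorem hasDerivAt_chart {e : OpenPartialHomeomorph (Quot Rel) ℂ} {k : ℕ} (he : IsFlat e k)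
    {p : P} (hp : (p : ℂ) ∈ interior P) (hpe : Quot.mk Rel p ∈ e.source) :
    ∃ c : ℂ, HasDerivAt (Function.extend Subtype.val (fun q => e (Quot.mk Rel q)) 0) c (p : ℂ) ∧
      flatCoeff e (e (Quot.mk Rel p)) * c = 1 := by
  set G : ℂ → ℂ := Function.extend Subtype.val (fun q : P => e (Quot.mk Rel q)) 0
  have hG : ∀ q : P, G q = e (Quot.mk Rel q) := fun q => Subtype.val_injective.extend_apply _ _ q
  obtain ⟨a, ha⟩ := he.2 p hpe
  have hmap : ∀ z : P, (z : ℂ) ∈ interior P → map Subtype.val (𝓝 z) = 𝓝 (z : ℂ) := fun z hz =>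
    map_nhds_subtype_coe_eq_nhds z.2 (mem_interior_iff_mem_nhds.1 hz)
  have hpow : ∀ᶠ z in 𝓝 (p : ℂ), G z ^ k = z + a := by
    rw [← hmap p hp, eventually_map]
    filter_upwards [ha] with q hq
    rw [hG, hq]
  have hcont : ∀ᶠ z in 𝓝 (p : ℂ), ContinuousAt G z := by
    have hsrc : ∀ᶠ q in 𝓝 p, Quot.mk Rel q ∈ e.source :=
      continuous_quot_mk.continuousAt.eventually (e.open_source.mem_nhds hpe)
    have hint : ∀ᶠ q : P in 𝓝 p, (q : ℂ) ∈ interior P :=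
      continuous_subtype_val.continuousAt.eventually (isOpen_interior.mem_nhds hp)
    rw [← hmap p hp, eventually_map]
    filter_upwards [hsrc, hint] with q h1 h2
    rw [ContinuousAt, hG, ← hmap q h2, tendsto_map'_iff]
    have : G ∘ Subtype.val = fun q : P => e (Quot.mk Rel q) := funext hG
    rw [this]
    exact (e.continuousAt h1).comp continuous_quot_mk.continuousAt
  have hd : DifferentiableAt ℂ G p := by
    refine differentiableAt_of_pow_eq (f := fun z => z + a) he.1
      (Eventually.of_forall fun z => by fun_prop) hcont hpow ?_
    simpa using eventually_pow_add_ne_zero one_pos a (p : ℂ)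
  refine ⟨deriv G p, hd.hasDerivAt, ?_⟩
  have h1 := hd.hasDerivAt.pow k
  have h2 : HasDerivAt (fun z : ℂ => z + a) 1 (p : ℂ) := (hasDerivAt_id _).add_const a
  have h3 := (h2.congr_of_eventuallyEq hpow).unique h1
  rw [flatCoeff_eq he (e.map_source hpe), ← hG, h3]

end FlatQuotient

namespace FlatQuotient

open Filter Topology Metric Set

/-- A system of local `k`-th roots `E x` of `p - x` near finitely many points `x ∈ F`, compatible
with the identifications `Rel`, which identifies a neighbourhood in the quotient with a disc. -/
structure IsStar {P : Set ℂ} (Rel : P → P → Prop) (F : Set P) (E : P → P → ℂ) (k : ℕ) (r : ℝ) :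
    Prop where
  k_pos : 0 < k
  r_pos : 0 < r
  finite : F.Finite
  disjoint : ∀ x ∈ F, ∀ y ∈ F, ∀ p : P, dist p x < r → dist p y < r → x = y
  cont : ∀ x ∈ F, ContinuousOn (E x) (ball x r)
  pow_eq : ∀ x ∈ F, ∀ p ∈ ball x r, E x p ^ k = (p : ℂ) - x
  compat : ∀ x ∈ F, ∀ p ∈ ball x r, ∀ q, (Rel p q ∨ Rel q p) → ∃ y ∈ F, q ∈ ball y r ∧ E y q = E x p
  inj : ∀ x ∈ F, ∀ y ∈ F, ∀ p ∈ ball x r, ∀ q ∈ ball y r, E x p = E y q →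
    Quot.mk Rel p = Quot.mk Rel q
  surj : ∀ ζ : ℂ, ‖ζ‖ ^ k < r → ∃ x ∈ F, ∃ p ∈ ball x r, E x p = ζ

namespace IsStar

variable {P : Set ℂ} {Rel : P → P → Prop} {F : Set P} {E : P → P → ℂ} {k : ℕ} {r : ℝ}

theorem norm_pow (h : IsStar Rel F E k r) {x p : P} (hx : x ∈ F) (hp : p ∈ ball x r) :
    ‖E x p‖ ^ k = dist p x := by
  rw [← _root_.norm_pow, h.pow_eq x hx p hp, Subtype.dist_eq, dist_eq_norm]

theorem mono (h : IsStar Rel F E k r) {r' : ℝ} (h0 : 0 < r') (hr : r' ≤ r) :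
    IsStar Rel F E k r' where
  k_pos := h.k_pos
  r_pos := h0
  finite := h.finite
  disjoint x hx y hy p h1 h2 := h.disjoint x hx y hy p (h1.trans_le hr) (h2.trans_le hr)
  cont x hx := (h.cont x hx).mono (ball_subset_ball hr)
  pow_eq x hx p hp := h.pow_eq x hx p (ball_subset_ball hr hp)
  compat x hx p hp q hq := by
    obtain ⟨y, hy, hqy, he⟩ := h.compat x hx p (ball_subset_ball hr hp) q hq
    refine ⟨y, hy, ?_, he⟩
    rw [mem_ball, ← h.norm_pow hy hqy, he, h.norm_pow hx (ball_subset_ball hr hp)]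
    exact hp
  inj x hx y hy p hp q hq he :=
    h.inj x hx y hy p (ball_subset_ball hr hp) q (ball_subset_ball hr hq) he
  surj ζ hζ := by
    obtain ⟨x, hx, p, hp, he⟩ := h.surj ζ (hζ.trans_le hr)
    refine ⟨x, hx, p, ?_, he⟩
    rwa [mem_ball, ← h.norm_pow hx hp, he]

theorem exists_of_eqvGen (h : IsStar Rel F E k r) {p q : P} (hpq : Relation.EqvGen Rel p q) :
    (∀ x ∈ F, p ∈ ball x r → ∃ y ∈ F, q ∈ ball y r ∧ E y q = E x p) ∧
      (∀ x ∈ F, q ∈ ball x r → ∃ y ∈ F, p ∈ ball y r ∧ E y p = E x q) := by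
  induction hpq with
  | rel p q hpq =>
    exact ⟨fun x hx hp => h.compat x hx p hp q (.inl hpq),
      fun x hx hp => h.compat x hx q hp p (.inr hpq)⟩
  | refl p => exact ⟨fun x hx hp => ⟨x, hx, hp, rfl⟩, fun x hx hp => ⟨x, hx, hp, rfl⟩⟩
  | symm p q _ ih => exact ⟨ih.2, ih.1⟩
  | trans p q s _ _ ih ih' =>
    constructor
    · intro x hx hp
      obtain ⟨y, hy, hq, e⟩ := ih.1 x hx hp
      obtain ⟨z, hz, hs, e'⟩ := ih'.1 y hy hq
      exact ⟨z, hz, hs, e'.trans e⟩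
    · intro x hx hp
      obtain ⟨y, hy, hq, e⟩ := ih'.2 x hx hp
      obtain ⟨z, hz, hs, e'⟩ := ih.2 y hy hq
      exact ⟨z, hz, hs, e'.trans e⟩

theorem exists_of_mk_eq (h : IsStar Rel F E k r) {p q : P} (hpq : Quot.mk Rel p = Quot.mk Rel q)
    {x : P} (hx : x ∈ F) (hp : p ∈ ball x r) : ∃ y ∈ F, q ∈ ball y r ∧ E y q = E x p :=
  (h.exists_of_eqvGen (Quot.eqvGen_exact hpq)).1 x hx hp

theorem eq_of_mk_eq (h : IsStar Rel F E k r) {p q : P} (hpq : Quot.mk Rel p = Quot.mk Rel q)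
    {x y : P} (hx : x ∈ F) (hp : p ∈ ball x r) (hy : y ∈ F) (hq : q ∈ ball y r) :
    E x p = E y q := by
  obtain ⟨z, hz, hqz, e⟩ := h.exists_of_mk_eq hpq hx hp
  rw [← e, h.disjoint z hz y hy q hqz hq]

/-- The part of the planar set covered by the star. -/
def dom (F : Set P) (r : ℝ) : Set P := ⋃ x ∈ F, ball x r

theorem mem_dom {p : P} : p ∈ dom F r ↔ ∃ x ∈ F, p ∈ ball x r := by simp [dom]

theorem isOpen_image (h : IsStar Rel F E k r) : IsOpen (Quot.mk Rel '' dom F r) := by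
  rw [← (isQuotientMap_quot_mk (r := Rel)).isOpen_preimage]
  have : Quot.mk Rel ⁻¹' (Quot.mk Rel '' dom F r) = dom F r := by
    refine Subset.antisymm ?_ (subset_preimage_image _ _)
    rintro p ⟨q, hq, hqp⟩
    obtain ⟨x, hx, hqx⟩ := mem_dom.1 hq
    obtain ⟨y, hy, hp, -⟩ := h.exists_of_mk_eq hqp hx hqx
    exact mem_dom.2 ⟨y, hy, hp⟩
  rw [this]
  exact isOpen_biUnion fun x _ => isOpen_ball

open Classical in
/-- The function on the quotient induced by the roots of a star. -/
def descend (Rel : P → P → Prop) (F : Set P) (E : P → P → ℂ) (r : ℝ) (s : Quot Rel) : ℂ :=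
  if h : ∃ p : P × P, p.1 ∈ F ∧ p.2 ∈ ball p.1 r ∧ Quot.mk Rel p.2 = s then
    E h.choose.1 h.choose.2 else 0

theorem descend_mk (h : IsStar Rel F E k r) {x p : P} (hx : x ∈ F) (hp : p ∈ ball x r) :
    descend Rel F E r (Quot.mk Rel p) = E x p := by
  have hex : ∃ q : P × P, q.1 ∈ F ∧ q.2 ∈ ball q.1 r ∧ Quot.mk Rel q.2 = Quot.mk Rel p :=
    ⟨(x, p), hx, hp, rfl⟩
  rw [descend, dif_pos hex]
  have hs := hex.choose_spec
  exact h.eq_of_mk_eq hs.2.2 hs.1 hs.2.1 hx hp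

theorem bijOn_descend (h : IsStar Rel F E k r) :
    BijOn (descend Rel F E r) (Quot.mk Rel '' dom F r) {ζ : ℂ | ‖ζ‖ ^ k < r} := by
  refine ⟨?_, ?_, ?_⟩
  · rintro _ ⟨p, hp, rfl⟩
    obtain ⟨x, hx, hp⟩ := mem_dom.1 hp
    rw [h.descend_mk hx hp, mem_ofPred_eq, h.norm_pow hx hp]
    exact hp
  · rintro _ ⟨p, hp, rfl⟩ _ ⟨q, hq, rfl⟩ he
    obtain ⟨x, hx, hp⟩ := mem_dom.1 hp
    obtain ⟨y, hy, hq⟩ := mem_dom.1 hq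
    rw [h.descend_mk hx hp, h.descend_mk hy hq] at he
    exact h.inj x hx y hy p hp q hq he
  · intro ζ hζ
    obtain ⟨x, hx, p, hp, he⟩ := h.surj ζ hζ
    exact ⟨_, ⟨p, mem_dom.2 ⟨x, hx, hp⟩, rfl⟩, by rw [h.descend_mk hx hp, he]⟩

theorem continuousOn_descend (h : IsStar Rel F E k r) :
    ContinuousOn (descend Rel F E r) (Quot.mk Rel '' dom F r) := by
  rw [(isQuotientMap_quot_mk (r := Rel)).continuousOn_isOpen_iff h.isOpen_image]
  rintro p ⟨q, hq, hqp⟩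
  obtain ⟨x, hx, hqx⟩ := mem_dom.1 hq
  obtain ⟨y, hy, hp, -⟩ := h.exists_of_mk_eq hqp hx hqx
  refine ContinuousAt.continuousWithinAt ?_
  refine ((h.cont y hy).continuousAt (isOpen_ball.mem_nhds hp)).congr ?_
  filter_upwards [isOpen_ball.mem_nhds hp] with z hz
  exact (h.descend_mk hy hz).symm

theorem continuousOn_inverse (h : IsStar Rel F E k r) [CompactSpace P] {φ : ℂ → Quot Rel}
    (hφ : ∀ x ∈ F, ∀ p ∈ ball x r, φ (E x p) = Quot.mk Rel p) :
    ContinuousOn φ {ζ : ℂ | ‖ζ‖ ^ k < r} := by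
  intro ζ₀ hζ₀
  obtain ⟨ρ, h1, h2⟩ := exists_between (show ‖ζ₀‖ ^ k < r from hζ₀)
  have hopen : IsOpen {ζ : ℂ | ‖ζ‖ ^ k < ρ} := isOpen_lt (by fun_prop) continuous_const
  refine ContinuousAt.continuousWithinAt ?_
  suffices hs : ContinuousOn φ {ζ : ℂ | ‖ζ‖ ^ k ≤ ρ} from
    hs.continuousAt (mem_of_superset (hopen.mem_nhds h1) fun z (hz : ‖z‖ ^ k < ρ) => hz.le)
  set K : Set P := ⋃ x ∈ F, closedBall x ρ
  have hKd : ∀ p ∈ K, ∃ x ∈ F, dist p x ≤ ρ := fun p hp => by simpa [K] using hp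
  have hK : IsCompact K := h.finite.isCompact_biUnion fun x _ => isClosed_closedBall.isCompact
  have : CompactSpace K := isCompact_iff_compactSpace.1 hK
  have hcont : ContinuousOn (fun p => descend Rel F E r (Quot.mk Rel p)) K := by
    refine h.continuousOn_descend.comp continuous_quot_mk.continuousOn fun p hp => ?_
    obtain ⟨x, hx, hpx⟩ := hKd p hp
    exact ⟨p, mem_dom.2 ⟨x, hx, hpx.trans_lt h2⟩, rfl⟩
  have hval : ∀ p ∈ K, ∃ x ∈ F, p ∈ ball x r ∧ descend Rel F E r (Quot.mk Rel p) = E x p := by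
    intro p hp
    obtain ⟨x, hx, hpx⟩ := hKd p hp
    exact ⟨x, hx, hpx.trans_lt h2, h.descend_mk hx (hpx.trans_lt h2)⟩
  have hmaps : ∀ p ∈ K, ‖descend Rel F E r (Quot.mk Rel p)‖ ^ k ≤ ρ := by
    intro p hp
    obtain ⟨x, hx, hpx⟩ := hKd p hp
    rw [h.descend_mk hx (hpx.trans_lt h2), h.norm_pow hx (hpx.trans_lt h2)]
    exact hpx
  let f : K → {ζ : ℂ | ‖ζ‖ ^ k ≤ ρ} := fun p => ⟨_, hmaps p p.2⟩
  have hf : Continuous f := (continuousOn_iff_continuous_domRestrict.1 hcont).subtype_mk _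
  have hsurj : Function.Surjective f := by
    rintro ⟨ζ, hζ⟩
    obtain ⟨x, hx, p, hp, he⟩ := h.surj ζ (lt_of_le_of_lt hζ h2)
    have hpK : p ∈ K := by
      simp only [K, mem_iUnion, mem_closedBall, exists_prop]
      exact ⟨x, hx, by rw [← h.norm_pow hx hp, he]; exact hζ⟩
    exact ⟨⟨p, hpK⟩, Subtype.ext (by simp only [f]; rw [h.descend_mk hx hp, he])⟩
  have hq : IsQuotientMap f := hf.isClosedMap.isQuotientMap hf hsurj
  rw [continuousOn_iff_continuous_domRestrict, hq.continuous_iff]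
  have : Set.domRestrict {ζ : ℂ | ‖ζ‖ ^ k ≤ ρ} φ ∘ f = fun p : K => Quot.mk Rel (p : P) := by
    funext p
    obtain ⟨x, hx, hp, he⟩ := hval p p.2
    change φ (descend Rel F E r (Quot.mk Rel (p : P))) = _
    rw [he, hφ x hx p hp]
  rw [this]
  exact continuous_quot_mk.comp continuous_subtype_val

theorem exists_chart [CompactSpace P] (h : IsStar Rel F E k r) :
    ∃ e : OpenPartialHomeomorph (Quot Rel) ℂ, e.source = Quot.mk Rel '' dom F r ∧
      (∀ x ∈ F, ∀ p ∈ ball x r, e (Quot.mk Rel p) = E x p) ∧ IsFlat e k := by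
  obtain ⟨x₀, hx₀, -⟩ := h.surj 0 (by simpa [zero_pow h.k_pos.ne'] using h.r_pos)
  have : Nonempty (Quot Rel) := ⟨Quot.mk Rel x₀⟩
  set pe := h.bijOn_descend.toPartialEquiv (descend Rel F E r) _ _ with hpe
  let e : OpenPartialHomeomorph (Quot Rel) ℂ :=
    { pe with
      open_source := h.isOpen_image
      open_target := isOpen_lt (by fun_prop) continuous_const
      continuousOn_toFun := h.continuousOn_descend
      continuousOn_invFun := by
        refine h.continuousOn_inverse fun x hx p hp => ?_
        have hmem : Quot.mk Rel p ∈ pe.source := ⟨p, mem_dom.2 ⟨x, hx, hp⟩, rfl⟩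
        have := pe.left_inv hmem
        have h2 : pe (Quot.mk Rel p) = E x p := h.descend_mk hx hp
        rw [h2] at this
        exact this }
  have he : ∀ x ∈ F, ∀ p ∈ ball x r, e (Quot.mk Rel p) = E x p := fun x hx p hp =>
    h.descend_mk hx hp
  refine ⟨e, rfl, he, h.k_pos, ?_⟩
  rintro p ⟨q, hq, hqp⟩
  obtain ⟨x, hx, hqx⟩ := mem_dom.1 hq
  obtain ⟨y, hy, hp, -⟩ := h.exists_of_mk_eq hqp hx hqx
  refine ⟨-y, ?_⟩
  filter_upwards [isOpen_ball.mem_nhds hp] with z hz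
  rw [he y hy z hz, h.pow_eq y hy z hz, sub_eq_add_neg]

end IsStar

/-- The point `s` of the quotient has a star of order `k` around it. -/
def HasStar {P : Set ℂ} (Rel : P → P → Prop) (s : Quot Rel) (k : ℕ) : Prop :=
  ∃ F E r, IsStar Rel F E k r ∧ ∀ x ∈ F, Quot.mk Rel x = s

variable {P : Set ℂ} {Rel : P → P → Prop}

theorem IsStar.nonempty {F : Set P} {E : P → P → ℂ} {k : ℕ} {r : ℝ} (h : IsStar Rel F E k r) :
    F.Nonempty := by
  obtain ⟨x₀, hx₀, -⟩ := h.surj 0 (by simpa [zero_pow h.k_pos.ne'] using h.r_pos)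
  exact ⟨x₀, hx₀⟩

theorem HasStar.exists_chart [CompactSpace P] {s : Quot Rel} {k : ℕ} (h : HasStar Rel s k) :
    ∃ e : OpenPartialHomeomorph (Quot Rel) ℂ, s ∈ e.source ∧ e s = 0 ∧ IsFlat e k := by
  obtain ⟨F, E, r, h, hs⟩ := h
  obtain ⟨e, h1, h2, h3⟩ := h.exists_chart
  obtain ⟨x, hx⟩ := h.nonempty
  have hb : x ∈ ball x r := mem_ball_self h.r_pos
  have hxs := hs x hx
  refine ⟨e, ?_, ?_, h3⟩
  · rw [h1, ← hxs]
    exact ⟨x, IsStar.mem_dom.2 ⟨x, hx, hb⟩, rfl⟩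
  · rw [← hxs, h2 x hx x hb]
    have := h.pow_eq x hx x hb
    rw [sub_self] at this
    exact (pow_eq_zero_iff h.k_pos.ne').1 this

theorem t2Space_of_hasStar {k : Quot Rel → ℕ} (h : ∀ s, HasStar Rel s (k s)) :
    T2Space (Quot Rel) := by
  refine ⟨fun s t hst => ?_⟩
  obtain ⟨F, E, r, h1, hs⟩ := h s
  obtain ⟨F', E', r', h2, ht⟩ := h t
  have hsep : ∃ ε > 0, ∀ x ∈ F, ∀ y ∈ F', ε ≤ dist x y := by
    have hd : Disjoint F F' := disjoint_left.2 fun x hx hx' => hst ((hs x hx).symm.trans (ht x hx'))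
    obtain ⟨ε, hε, hh⟩ := (h1.finite.isCompact).exists_thickening_subset_open
      (h2.finite.isClosed.isOpen_compl) (disjoint_left.1 hd)
    refine ⟨ε, hε, fun x hx y hy => ?_⟩
    by_contra hlt
    exact hh (mem_thickening_iff.2 ⟨x, hx, by rw [dist_comm]; exact not_le.1 hlt⟩) hy
  obtain ⟨ε, hε, hd⟩ := hsep
  have g1 := h1.mono (r' := min r (ε / 2)) (lt_min h1.r_pos (half_pos hε)) (min_le_left _ _)
  have g2 := h2.mono (r' := min r' (ε / 2)) (lt_min h2.r_pos (half_pos hε)) (min_le_left _ _)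
  refine ⟨_, _, g1.isOpen_image, g2.isOpen_image, ?_, ?_, ?_⟩
  · obtain ⟨x, hx⟩ := h1.nonempty
    exact ⟨x, IsStar.mem_dom.2 ⟨x, hx, mem_ball_self g1.r_pos⟩, hs x hx⟩
  · obtain ⟨x, hx⟩ := h2.nonempty
    exact ⟨x, IsStar.mem_dom.2 ⟨x, hx, mem_ball_self g2.r_pos⟩, ht x hx⟩
  · rw [disjoint_left]
    rintro _ ⟨p, hp, rfl⟩ ⟨q, hq, hqp⟩
    obtain ⟨y, hy, hqy⟩ := IsStar.mem_dom.1 hq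
    obtain ⟨x, hx, hpx⟩ := IsStar.mem_dom.1 hp
    obtain ⟨z, hz, hpz, -⟩ := g2.exists_of_mk_eq hqp hy hqy
    have := hd x hx z hz
    have h3 := (mem_ball.1 hpx).trans_le (min_le_right _ _)
    have h4 := (mem_ball.1 hpz).trans_le (min_le_right _ _)
    have := dist_triangle_left x z p
    linarith

/-- A quotient of a compact planar set with a star around each point is a Hausdorff Riemann surface
with a 1-form induced by `dz`. -/
theorem exists_structure [CompactSpace P] {k : Quot Rel → ℕ} (h : ∀ s, HasStar Rel s (k s)) :
    ∃ (_ : ChartedSpace ℂ (Quot Rel)) (_ : IsManifold 𝓘(ℂ) ω (Quot Rel))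
      (η : HolomorphicOneForm (Quot Rel)),
      (∀ p : P, (p : ℂ) ∈ interior P → ∀ e ∈ atlas ℂ (Quot Rel), Quot.mk Rel p ∈ e.source →
        ∃ c : ℂ, HasDerivAt (Function.extend Subtype.val (fun q => e (Quot.mk Rel q)) 0) c (p : ℂ) ∧
          η.coeff e (e (Quot.mk Rel p)) * c = 1) ∧
      ∀ s, η.order s = (k s - 1 : ℕ) := by
  choose e he1 he2 he3 using fun s => (h s).exists_chart
  let cs : ChartedSpace ℂ (Quot Rel) :=
    { atlas := range e
      chartAt := e
      mem_chart_source := he1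
      chart_mem_atlas := fun s => ⟨s, rfl⟩ }
  have hflat : ∀ f ∈ atlas ℂ (Quot Rel), ∃ k, IsFlat f k := by
    rintro _ ⟨s, rfl⟩
    exact ⟨_, he3 s⟩
  refine ⟨cs, isManifold_of_isFlat hflat, flatForm hflat, ?_, fun s => ?_⟩
  · intro p hp f hf hpf
    obtain ⟨j, hj⟩ := hflat f hf
    exact hasDerivAt_chart hj hp hpf
  · exact flatForm_order hflat (he3 s) (he2 s)

end FlatQuotient

/-! ### Broken lines -/

namespace Polygon

open Set

/-- The oriented area spanned by two vectors of the plane. -/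
def cross (a b : ℂ) : ℝ := a.re * b.im - a.im * b.re

theorem lineVertex_zero (l : List ℕ) (v : ℕ → ℂ) : lineVertex l v 0 = 0 := by simp [lineVertex]

theorem lineVertex_succ (l : List ℕ) (v : ℕ → ℂ) {a : ℕ} (ha : a ∈ l) :
    lineVertex l v (l.idxOf a + 1) = lineVertex l v (l.idxOf a) + v a := by
  have h := List.idxOf_lt_length_of_mem ha
  rw [lineVertex, List.take_succ_eq_append_getElem h]
  simp [lineVertex]

theorem exists_idxOf_eq {l : List ℕ} (hl : l.Nodup) {j : ℕ} (hj : j < l.length) :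
    ∃ a ∈ l, l.idxOf a = j :=
  ⟨l[j], List.getElem_mem hj, hl.idxOf_getElem j hj⟩

theorem eq_of_idxOf_eq {l : List ℕ} {a b : ℕ} (ha : a ∈ l) (h : l.idxOf a = l.idxOf b) : a = b :=
  (List.idxOf_inj ha).1 h

variable {l : List ℕ} {v : ℕ → ℂ}

theorem lineVertex_re_lt (hl : l.Nodup) (hv : ∀ a ∈ l, 0 < (v a).re) {i j : ℕ} (hij : i < j)
    (hj : j ≤ l.length) : (lineVertex l v i).re < (lineVertex l v j).re := by
  induction j with
  | zero => omega
  | succ j ih =>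
    obtain ⟨a, ha, rfl⟩ := exists_idxOf_eq hl (j := j) (by omega)
    have h1 : (lineVertex l v (l.idxOf a)).re < (lineVertex l v (l.idxOf a + 1)).re := by
      rw [lineVertex_succ l v ha, Complex.add_re]
      linarith [hv a ha]
    rcases Nat.lt_succ_iff_lt_or_eq.1 hij with h | h
    · exact (ih h (by omega)).trans h1
    · rwa [h]

theorem lineVertex_re_le (hl : l.Nodup) (hv : ∀ a ∈ l, 0 < (v a).re) {i j : ℕ} (hij : i ≤ j)
    (hj : j ≤ l.length) : (lineVertex l v i).re ≤ (lineVertex l v j).re := by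
  rcases hij.lt_or_eq with h | h
  · exact (lineVertex_re_lt hl hv h hj).le
  · rw [h]

theorem mem_brokenLine (hl : l.Nodup) {z : ℂ} :
    z ∈ brokenLine l v ↔ ∃ a ∈ l, ∃ t ∈ Icc (0 : ℝ) 1,
      z = lineVertex l v (l.idxOf a) + t * v a := by
  simp only [brokenLine, mem_iUnion, mem_Iio, exists_prop]
  constructor
  · rintro ⟨k, hk, hz⟩
    obtain ⟨a, ha, rfl⟩ := exists_idxOf_eq hl hk
    rw [lineVertex_succ l v ha, segment_eq_image'] at hz
    obtain ⟨t, ht, rfl⟩ := hz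
    exact ⟨a, ha, t, ht, by simp⟩
  · rintro ⟨a, ha, t, ht, rfl⟩
    refine ⟨_, List.idxOf_lt_length_of_mem ha, ?_⟩
    rw [lineVertex_succ l v ha, segment_eq_image']
    exact ⟨t, ht, by simp⟩

theorem isCompact_brokenLine : IsCompact (brokenLine l v) := by
  refine (finite_Iio _).isCompact_biUnion fun k _ => ?_
  rw [segment_eq_image']
  exact isCompact_Icc.image (by fun_prop)

/-- A broken line is a graph: over the side `a` its only points are those of the side. -/
theorem cross_eq_zero (hl : l.Nodup) (hv : ∀ a ∈ l, 0 < (v a).re) {z : ℂ}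
    (hz : z ∈ brokenLine l v) {a : ℕ} (ha : a ∈ l) (h1 : (lineVertex l v (l.idxOf a)).re ≤ z.re)
    (h2 : z.re ≤ (lineVertex l v (l.idxOf a)).re + (v a).re) :
    cross (v a) (z - lineVertex l v (l.idxOf a)) = 0 := by
  obtain ⟨b, hb, t, ht, rfl⟩ := (mem_brokenLine hl).1 hz
  have hla := List.idxOf_lt_length_of_mem ha
  have hlb := List.idxOf_lt_length_of_mem hb
  have hva := hv a ha
  have hvb := hv b hb
  have sa := lineVertex_succ l v ha
  have sb := lineVertex_succ l v hb
  simp only [Complex.add_re, Complex.re_ofReal_mul] at h1 h2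
  rcases lt_trichotomy (l.idxOf b) (l.idxOf a) with h | h | h
  · have h3 := lineVertex_re_le hl hv (i := l.idxOf b + 1) h hla.le
    have h3' := congrArg Complex.re sb
    rw [Complex.add_re] at h3'
    have ht1 : t = 1 := le_antisymm ht.2 (by nlinarith)
    subst ht1
    rcases Nat.lt_or_eq_of_le (Nat.succ_le_of_lt h) with h4 | h4
    · have := lineVertex_re_lt hl hv h4 hla.le
      simp only [Nat.succ_eq_add_one] at this
      linarith
    · rw [← h4, Nat.succ_eq_add_one, sb]
      simp [cross]
  · rw [eq_of_idxOf_eq hb h]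
    simp [cross]; ring
  · have h3 := lineVertex_re_le hl hv (i := l.idxOf a + 1) h hlb.le
    have h3' := congrArg Complex.re sa
    rw [Complex.add_re] at h3'
    have ht1 : t = 0 := le_antisymm (by nlinarith) ht.1
    subst ht1
    rcases Nat.lt_or_eq_of_le (Nat.succ_le_of_lt h) with h4 | h4
    · have := lineVertex_re_lt hl hv h4 hlb.le
      simp only [Nat.succ_eq_add_one] at this
      linarith
    · rw [← h4, Nat.succ_eq_add_one, sa]
      simp [cross]; ring

theorem cross_sub_eq (hl : l.Nodup) (hv : ∀ a ∈ l, 0 < (v a).re) {z w : ℂ}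
    (hz : z ∈ brokenLine l v) (hzw : z.re = w.re) {a : ℕ} (ha : a ∈ l)
    (h1 : (lineVertex l v (l.idxOf a)).re ≤ w.re)
    (h2 : w.re ≤ (lineVertex l v (l.idxOf a)).re + (v a).re) :
    cross (v a) (w - lineVertex l v (l.idxOf a)) = (v a).re * (w.im - z.im) := by
  have := cross_eq_zero hl hv hz ha (hzw ▸ h1) (hzw ▸ h2)
  simp only [cross, Complex.sub_re, Complex.sub_im] at this ⊢
  rw [hzw] at this
  linarith

theorem exists_mem_brokenLine (hl : l.Nodup) (hv : ∀ a ∈ l, 0 < (v a).re) {x : ℝ} {a : ℕ}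
    (ha : a ∈ l) (h1 : (lineVertex l v (l.idxOf a)).re ≤ x)
    (h2 : x ≤ (lineVertex l v (l.idxOf a)).re + (v a).re) :
    ∃ z ∈ brokenLine l v, z.re = x := by
  have hva := hv a ha
  refine ⟨_, (mem_brokenLine hl).2 ⟨a, ha, (x - (lineVertex l v (l.idxOf a)).re) / (v a).re,
    ⟨div_nonneg (by linarith) hva.le, (div_le_one hva).2 (by linarith)⟩, rfl⟩, ?_⟩
  rw [Complex.add_re, Complex.re_ofReal_mul]
  field_simp
  ring

theorem exists_strip (hl : l.Nodup) (h0 : l ≠ []) {x : ℝ}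
    (hx : 0 ≤ x) (hx' : x ≤ (lineVertex l v l.length).re) :
    ∃ a ∈ l, (lineVertex l v (l.idxOf a)).re ≤ x ∧
      x ≤ (lineVertex l v (l.idxOf a)).re + (v a).re := by
  classical
  have hpos : 0 < l.length := List.length_pos_iff.2 h0
  have hex : ∃ j, j < l.length ∧ x ≤ (lineVertex l v (j + 1)).re :=
    ⟨l.length - 1, by omega, by rwa [Nat.sub_add_cancel hpos]⟩
  have hs := Nat.find_spec hex
  obtain ⟨a, ha, hj⟩ := exists_idxOf_eq hl hs.1
  refine ⟨a, ha, ?_, ?_⟩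
  · rcases Nat.eq_zero_or_pos (l.idxOf a) with h | h
    · rw [h, lineVertex_zero]; simpa
    · have := Nat.find_min hex (m := l.idxOf a - 1) (by omega)
      rw [Nat.sub_add_cancel h] at this
      by_contra hlt
      exact this ⟨by omega, (not_le.1 hlt).le⟩
  · rw [← Complex.add_re, ← lineVertex_succ l v ha, hj]
    exact hs.2

theorem re_mem_of_mem_brokenLine (hl : l.Nodup) (hv : ∀ a ∈ l, 0 < (v a).re) {z : ℂ}
    (hz : z ∈ brokenLine l v) : z.re ∈ Icc 0 (lineVertex l v l.length).re := by
  obtain ⟨a, ha, t, ht, rfl⟩ := (mem_brokenLine hl).1 hz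
  have hla := List.idxOf_lt_length_of_mem ha
  have h1 := lineVertex_re_le hl hv (Nat.zero_le (l.idxOf a)) hla.le
  have h2 := lineVertex_re_le hl hv (i := l.idxOf a + 1) hla le_rfl
  rw [lineVertex_succ l v ha, Complex.add_re] at h2
  rw [lineVertex_zero, Complex.zero_re] at h1
  have := hv a ha
  simp only [Complex.add_re, Complex.re_ofReal_mul, mem_Icc]
  constructor
  · nlinarith [ht.1]
  · nlinarith [ht.2]

/-! ### The heights of the vertices -/

theorem sum_range_lt_sum {s : Finset ℕ} {k : ℕ} (hk : s.card = k) (hs : s ≠ Finset.range k) :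
    ∑ i ∈ Finset.range k, i < ∑ i ∈ s, i := by
  have h1 := Finset.sum_inter_add_sum_sdiff s (Finset.range k) (fun i => i)
  have h2 := Finset.sum_inter_add_sum_sdiff (Finset.range k) s (fun i => i)
  rw [Finset.inter_comm] at h2
  have hc : (s \ Finset.range k).card = (Finset.range k \ s).card := by
    have a1 := Finset.card_sdiff_add_card_inter s (Finset.range k)
    have a2 := Finset.card_sdiff_add_card_inter (Finset.range k) s
    rw [Finset.inter_comm, Finset.card_range] at a2
    omega
  have hne : (Finset.range k \ s).Nonempty := by
    rw [Finset.nonempty_iff_ne_empty, Ne, Finset.sdiff_eq_empty_iff_subset]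
    intro h
    exact hs (Finset.eq_of_subset_of_card_le h (by simp [hk])).symm
  have h3 : ∑ i ∈ Finset.range k \ s, i < (Finset.range k \ s).card • k := by
    refine (Finset.sum_lt_sum_of_nonempty hne (g := fun _ => k) fun i hi => ?_).trans_eq (by simp)
    exact Finset.mem_range.1 (Finset.mem_sdiff.1 hi).1
  have h4 : (s \ Finset.range k).card • k ≤ ∑ i ∈ s \ Finset.range k, i :=
    Finset.card_nsmul_le_sum _ _ _ fun i hi => by
      simpa using (Finset.mem_sdiff.1 hi).2
  rw [hc] at h4
  omega

theorem sum_take_idxOf {l : List ℕ} (hl : l.Nodup) {k : ℕ} (hk : k ≤ l.length) :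
    ((l.take k).map fun a => l.idxOf a).sum = ∑ i ∈ Finset.range k, i := by
  induction k with
  | zero => simp
  | succ k ih =>
    rw [List.take_succ_eq_append_getElem hk, List.map_append, List.sum_append, ih (by omega),
      Finset.sum_range_succ]
    simp [hl.idxOf_getElem k hk]

theorem sum_take_idxOf_lt {l l' : List ℕ} (hl : l.Nodup) (hp : l'.Perm l)
    {k : ℕ} (hk : k ≤ l.length) (hne : (l.take k).toFinset ≠ (l'.take k).toFinset) :
    ((l.take k).map fun a => l.idxOf a).sum < ((l.take k).map fun a => l'.idxOf a).sum := by
  have hl' : l'.Nodup := hp.nodup_iff.2 hl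
  have hnd : (l.take k).Nodup := hl.sublist (List.take_sublist _ _)
  have hmem : ∀ a ∈ l.take k, a ∈ l' := fun a ha => hp.mem_iff.2 (List.mem_of_mem_take ha)
  have hinj : Set.InjOn (fun a => l'.idxOf a) ((l.take k).toFinset : Set ℕ) := by
    intro a ha b _ h
    exact eq_of_idxOf_eq (hmem a (by simpa using ha)) h
  rw [sum_take_idxOf hl hk, ← List.sum_toFinset _ hnd,
    ← Finset.sum_image (f := fun i => i) hinj]
  have hcard : ((l.take k).toFinset.image fun a => l'.idxOf a).card = k := by
    rw [Finset.card_image_of_injOn hinj, List.toFinset_card_of_nodup hnd, List.length_take]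
    omega
  refine sum_range_lt_sum hcard fun h => hne ?_
  refine Finset.eq_of_subset_of_card_le (fun a ha => ?_) ?_
  · have h1 : l'.idxOf a ∈ Finset.range k := h ▸ Finset.mem_image_of_mem _ ha
    have h2 := hmem a (by simpa using ha)
    rw [List.mem_toFinset, List.mem_take_iff_idxOf_lt h2]
    exact Finset.mem_range.1 h1
  · rw [List.toFinset_card_of_nodup hnd,
      List.toFinset_card_of_nodup (hl'.sublist (List.take_sublist _ _)), List.length_take,
      List.length_take, hp.length_eq]

theorem lineVertex_im (l top bot : List ℕ) (lam : ℕ → ℝ) (k : ℕ) :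
    (lineVertex l (sideVector top bot lam) k).im =
      (((l.take k).map fun a => bot.idxOf a).sum : ℝ) -
        (((l.take k).map fun a => top.idxOf a).sum : ℝ) := by
  rw [lineVertex]
  induction l.take k with
  | nil => simp
  | cons a l ih =>
    simp only [List.map_cons, List.sum_cons, Complex.add_im, ih]
    simp only [sideVector, Complex.add_im, Complex.ofReal_im, Complex.mul_im, Complex.I_im,
      Complex.I_re, Complex.sub_re, Complex.natCast_re, Complex.sub_im, Complex.natCast_im]
    push_cast
    ring

theorem lineVertex_re (l top bot : List ℕ) (lam : ℕ → ℝ) (k : ℕ) :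
    (lineVertex l (sideVector top bot lam) k).re = ((l.take k).map lam).sum := by
  rw [lineVertex]
  induction l.take k with
  | nil => simp
  | cons a l ih =>
    simp only [List.map_cons, List.sum_cons, Complex.add_re, ih]
    simp [sideVector]

theorem sideVector_re (top bot : List ℕ) (lam : ℕ → ℝ) (a : ℕ) :
    (sideVector top bot lam a).re = lam a := by
  simp [sideVector]

theorem sideVector_im (top bot : List ℕ) (lam : ℕ → ℝ) (a : ℕ) :
    (sideVector top bot lam a).im = bot.idxOf a - top.idxOf a := by
  simp [sideVector]

end Polygon

/-! ### The suspension polygon -/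

namespace Polygon

open Set Filter Topology

/-- An irreducible permutation of at least two symbols with positive lengths. -/
structure Admissible (top bot : List ℕ) (lam : ℕ → ℝ) : Prop where
  perm : IsTruePermutation top bot
  irr : IsIrreduciblePermutation top bot
  two_le : 2 ≤ top.length
  pos : ∀ a ∈ top, 0 < lam a

/-- The left end of the side `a` of the upper broken line. -/
def topLeft (top bot : List ℕ) (lam : ℕ → ℝ) (a : ℕ) : ℂ :=
  lineVertex top (sideVector top bot lam) (top.idxOf a)

/-- The left end of the side `a` of the lower broken line. -/
def botLeft (top bot : List ℕ) (lam : ℕ → ℝ) (a : ℕ) : ℂ :=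
  lineVertex bot (sideVector top bot lam) (bot.idxOf a)

/-- The right end of the side `a` of the upper broken line. -/
def topRight (top bot : List ℕ) (lam : ℕ → ℝ) (a : ℕ) : ℂ :=
  topLeft top bot lam a + sideVector top bot lam a

/-- The right end of the side `a` of the lower broken line. -/
def botRight (top bot : List ℕ) (lam : ℕ → ℝ) (a : ℕ) : ℂ :=
  botLeft top bot lam a + sideVector top bot lam a

variable {top bot : List ℕ} {lam : ℕ → ℝ}

namespace Admissible

theorem nodup_top (h : Admissible top bot lam) : top.Nodup := h.perm.2.1

theorem nodup_bot (h : Admissible top bot lam) : bot.Nodup := h.perm.2.2.nodup_iff.2 h.nodup_top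

theorem mem_bot (h : Admissible top bot lam) {a : ℕ} : a ∈ bot ↔ a ∈ top := h.perm.2.2.mem_iff

theorem length_bot (h : Admissible top bot lam) : bot.length = top.length :=
  h.perm.2.2.length_eq

theorem bot_ne_nil (h : Admissible top bot lam) : bot ≠ [] := by
  rw [← List.length_pos_iff, h.length_bot]; linarith [h.two_le]

theorem idxOf_top_lt (_h : Admissible top bot lam) {a : ℕ} (ha : a ∈ top) :
    top.idxOf a < top.length := List.idxOf_lt_length_of_mem ha

theorem idxOf_bot_lt (h : Admissible top bot lam) {a : ℕ} (ha : a ∈ top) :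
    bot.idxOf a < top.length := h.length_bot ▸ List.idxOf_lt_length_of_mem (h.mem_bot.2 ha)

theorem exists_top (h : Admissible top bot lam) {j : ℕ} (hj : j < top.length) :
    ∃ a ∈ top, top.idxOf a = j := exists_idxOf_eq h.nodup_top hj

theorem exists_bot (h : Admissible top bot lam) {j : ℕ} (hj : j < top.length) :
    ∃ a ∈ top, bot.idxOf a = j := by
  obtain ⟨a, ha, e⟩ := exists_idxOf_eq h.nodup_bot (h.length_bot ▸ hj)
  exact ⟨a, h.mem_bot.1 ha, e⟩

theorem eq_of_top (_h : Admissible top bot lam) {a b : ℕ} (ha : a ∈ top)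
    (e : top.idxOf a = top.idxOf b) : a = b := eq_of_idxOf_eq ha e

theorem eq_of_bot (h : Admissible top bot lam) {a b : ℕ} (ha : a ∈ top)
    (e : bot.idxOf a = bot.idxOf b) : a = b := eq_of_idxOf_eq (h.mem_bot.2 ha) e

theorem re_pos (h : Admissible top bot lam) {a : ℕ} (ha : a ∈ top) :
    0 < (sideVector top bot lam a).re := by
  rw [sideVector_re]; exact h.pos a ha

theorem re_pos_bot (h : Admissible top bot lam) : ∀ a ∈ bot, 0 < (sideVector top bot lam a).re :=
  fun _ ha => h.re_pos (h.mem_bot.1 ha)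

theorem top_vertex_im_pos (h : Admissible top bot lam) {k : ℕ} (h0 : 0 < k) (hk : k < top.length) :
    0 < (lineVertex top (sideVector top bot lam) k).im := by
  have := sum_take_idxOf_lt h.nodup_top h.perm.2.2 hk.le (h.irr k h0 hk)
  rw [lineVertex_im, sub_pos]
  exact_mod_cast this

theorem bot_vertex_im_neg (h : Admissible top bot lam) {k : ℕ} (h0 : 0 < k) (hk : k < top.length) :
    (lineVertex bot (sideVector top bot lam) k).im < 0 := by
  have := sum_take_idxOf_lt h.nodup_bot h.perm.2.2.symm (h.length_bot ▸ hk.le)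
    (h.irr k h0 hk).symm
  rw [lineVertex_im, sub_neg]
  exact_mod_cast this

theorem top_end (h : Admissible top bot lam) :
    lineVertex top (sideVector top bot lam) top.length = ((top.map lam).sum : ℝ) := by
  apply Complex.ext
  · rw [lineVertex_re, List.take_length, Complex.ofReal_re]
  · rw [lineVertex_im, Complex.ofReal_im, List.take_length, sub_eq_zero]
    have h1 := sum_take_idxOf h.nodup_top le_rfl
    have h2 := sum_take_idxOf h.nodup_bot le_rfl
    rw [List.take_length] at h1 h2
    rw [h1, (h.perm.2.2.symm.map _).sum_eq, h2, h.length_bot]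

theorem bot_end (h : Admissible top bot lam) :
    lineVertex bot (sideVector top bot lam) top.length = ((top.map lam).sum : ℝ) := by
  rw [← h.top_end, lineVertex, lineVertex, List.take_length, ← h.length_bot, List.take_length]
  exact (h.perm.2.2.map _).sum_eq

theorem top_vertex_im_nonneg (h : Admissible top bot lam) {k : ℕ} (hk : k ≤ top.length) :
    0 ≤ (lineVertex top (sideVector top bot lam) k).im := by
  rcases Nat.eq_zero_or_pos k with rfl | h0
  · simp [lineVertex_zero]
  · rcases hk.lt_or_eq with h1 | rfl
    · exact (h.top_vertex_im_pos h0 h1).le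
    · rw [h.top_end, Complex.ofReal_im]

theorem bot_vertex_im_nonpos (h : Admissible top bot lam) {k : ℕ} (hk : k ≤ top.length) :
    (lineVertex bot (sideVector top bot lam) k).im ≤ 0 := by
  rcases Nat.eq_zero_or_pos k with rfl | h0
  · simp [lineVertex_zero]
  · rcases hk.lt_or_eq with h1 | rfl
    · exact (h.bot_vertex_im_neg h0 h1).le
    · rw [h.bot_end, Complex.ofReal_im]

theorem topRight_eq (_h : Admissible top bot lam) {a : ℕ} (ha : a ∈ top) :
    topRight top bot lam a = lineVertex top (sideVector top bot lam) (top.idxOf a + 1) :=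
  (lineVertex_succ _ _ ha).symm

theorem botRight_eq (h : Admissible top bot lam) {a : ℕ} (ha : a ∈ top) :
    botRight top bot lam a = lineVertex bot (sideVector top bot lam) (bot.idxOf a + 1) :=
  (lineVertex_succ _ _ (h.mem_bot.2 ha)).symm

theorem topLeft_im_nonneg (h : Admissible top bot lam) {a : ℕ} (ha : a ∈ top) :
    0 ≤ (topLeft top bot lam a).im := h.top_vertex_im_nonneg (h.idxOf_top_lt ha).le

theorem topRight_im_nonneg (h : Admissible top bot lam) {a : ℕ} (ha : a ∈ top) :
    0 ≤ (topRight top bot lam a).im := by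
  rw [h.topRight_eq ha]; exact h.top_vertex_im_nonneg (h.idxOf_top_lt ha)

theorem botLeft_im_nonpos (h : Admissible top bot lam) {a : ℕ} (ha : a ∈ top) :
    (botLeft top bot lam a).im ≤ 0 := h.bot_vertex_im_nonpos (h.idxOf_bot_lt ha).le

theorem botRight_im_nonpos (h : Admissible top bot lam) {a : ℕ} (ha : a ∈ top) :
    (botRight top bot lam a).im ≤ 0 := by
  rw [h.botRight_eq ha]; exact h.bot_vertex_im_nonpos (h.idxOf_bot_lt ha)

theorem side_im (p v : ℂ) (t : ℝ) : (p + t * v).im = (1 - t) * p.im + t * (p + v).im := by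
  simp; ring

theorem top_side_im_pos (h : Admissible top bot lam) {a : ℕ} (ha : a ∈ top) {t : ℝ} (h0 : 0 < t)
    (h1 : t < 1) : 0 < (topLeft top bot lam a + t * sideVector top bot lam a).im := by
  rw [side_im]
  have e1 := h.topLeft_im_nonneg ha
  have e2 := h.topRight_im_nonneg ha
  have hl := h.idxOf_top_lt ha
  have h2 := h.two_le
  rcases Nat.eq_zero_or_pos (top.idxOf a) with hz | hz
  · have : 0 < (topRight top bot lam a).im := by
      rw [h.topRight_eq ha]; exact h.top_vertex_im_pos (by omega) (by omega)
    have := mul_pos h0 this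
    have := mul_nonneg (sub_nonneg.2 h1.le) e1
    rw [topRight] at *; linarith
  · have : 0 < (topLeft top bot lam a).im := h.top_vertex_im_pos hz hl
    have := mul_pos (sub_pos.2 h1) this
    have := mul_nonneg h0.le e2
    rw [topRight] at *; linarith

theorem bot_side_im_neg (h : Admissible top bot lam) {a : ℕ} (ha : a ∈ top) {t : ℝ} (h0 : 0 < t)
    (h1 : t < 1) : (botLeft top bot lam a + t * sideVector top bot lam a).im < 0 := by
  rw [side_im]
  have e1 := h.botLeft_im_nonpos ha
  have e2 := h.botRight_im_nonpos ha
  have hl := h.idxOf_bot_lt ha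
  have h2 := h.two_le
  rcases Nat.eq_zero_or_pos (bot.idxOf a) with hz | hz
  · have : (botRight top bot lam a).im < 0 := by
      rw [h.botRight_eq ha]; exact h.bot_vertex_im_neg (by omega) (by omega)
    have := mul_neg_of_pos_of_neg h0 this
    have := mul_nonpos_of_nonneg_of_nonpos (sub_nonneg.2 h1.le) e1
    rw [botRight] at *; linarith
  · have : (botLeft top bot lam a).im < 0 := h.bot_vertex_im_neg hz hl
    have := mul_neg_of_pos_of_neg (sub_pos.2 h1) this
    have := mul_nonpos_of_nonneg_of_nonpos h0.le e2
    rw [botRight] at *; linarith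

theorem mem_top_line (h : Admissible top bot lam) {z : ℂ} :
    z ∈ brokenLine top (sideVector top bot lam) ↔ ∃ a ∈ top, ∃ t ∈ Icc (0 : ℝ) 1,
      z = topLeft top bot lam a + t * sideVector top bot lam a := mem_brokenLine h.nodup_top

theorem mem_bot_line (h : Admissible top bot lam) {z : ℂ} :
    z ∈ brokenLine bot (sideVector top bot lam) ↔ ∃ a ∈ top, ∃ t ∈ Icc (0 : ℝ) 1,
      z = botLeft top bot lam a + t * sideVector top bot lam a := by
  simp_rw [mem_brokenLine h.nodup_bot, h.mem_bot, botLeft]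

theorem top_line_im_nonneg (h : Admissible top bot lam) {z : ℂ}
    (hz : z ∈ brokenLine top (sideVector top bot lam)) : 0 ≤ z.im := by
  obtain ⟨a, ha, t, ht, rfl⟩ := h.mem_top_line.1 hz
  rw [side_im]
  exact add_nonneg (mul_nonneg (sub_nonneg.2 ht.2) (h.topLeft_im_nonneg ha))
    (mul_nonneg ht.1 (h.topRight_im_nonneg ha))

theorem bot_line_im_nonpos (h : Admissible top bot lam) {z : ℂ}
    (hz : z ∈ brokenLine bot (sideVector top bot lam)) : z.im ≤ 0 := by
  obtain ⟨a, ha, t, ht, rfl⟩ := h.mem_bot_line.1 hz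
  rw [side_im]
  exact add_nonpos (mul_nonpos_of_nonneg_of_nonpos (sub_nonneg.2 ht.2) (h.botLeft_im_nonpos ha))
    (mul_nonpos_of_nonneg_of_nonpos ht.1 (h.botRight_im_nonpos ha))

/-! #### Membership in the polygon -/

theorem exists_top_strip (h : Admissible top bot lam) {x : ℝ} (hx : 0 ≤ x)
    (hx' : x ≤ (top.map lam).sum) : ∃ a ∈ top, (topLeft top bot lam a).re ≤ x ∧
      x ≤ (topLeft top bot lam a).re + (sideVector top bot lam a).re :=
  exists_strip h.nodup_top h.perm.1 hx (by rwa [h.top_end, Complex.ofReal_re])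

theorem exists_bot_strip (h : Admissible top bot lam) {x : ℝ} (hx : 0 ≤ x)
    (hx' : x ≤ (top.map lam).sum) : ∃ a ∈ top, (botLeft top bot lam a).re ≤ x ∧
      x ≤ (botLeft top bot lam a).re + (sideVector top bot lam a).re := by
  obtain ⟨a, ha, h1⟩ := exists_strip (v := sideVector top bot lam) h.nodup_bot h.bot_ne_nil hx
    (by rwa [h.length_bot, h.bot_end, Complex.ofReal_re])
  exact ⟨a, h.mem_bot.1 ha, h1⟩

theorem top_strip_subset (h : Admissible top bot lam) {x : ℝ} {a : ℕ} (ha : a ∈ top)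
    (h1 : (topLeft top bot lam a).re ≤ x)
    (h2 : x ≤ (topLeft top bot lam a).re + (sideVector top bot lam a).re) :
    0 ≤ x ∧ x ≤ (top.map lam).sum := by
  obtain ⟨z, hz, rfl⟩ := exists_mem_brokenLine h.nodup_top (fun a => h.re_pos) ha h1 h2
  have := re_mem_of_mem_brokenLine h.nodup_top (fun a => h.re_pos) hz
  rwa [h.top_end, Complex.ofReal_re] at this

theorem bot_strip_subset (h : Admissible top bot lam) {x : ℝ} {a : ℕ} (ha : a ∈ top)
    (h1 : (botLeft top bot lam a).re ≤ x)
    (h2 : x ≤ (botLeft top bot lam a).re + (sideVector top bot lam a).re) :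
    0 ≤ x ∧ x ≤ (top.map lam).sum := by
  obtain ⟨z, hz, rfl⟩ := exists_mem_brokenLine h.nodup_bot h.re_pos_bot (h.mem_bot.2 ha) h1 h2
  have := re_mem_of_mem_brokenLine h.nodup_bot h.re_pos_bot hz
  rwa [h.length_bot, h.bot_end, Complex.ofReal_re] at this

theorem re_mem (h : Admissible top bot lam) {w : ℂ} (hw : w ∈ suspensionPolygon top bot lam) :
    0 ≤ w.re ∧ w.re ≤ (top.map lam).sum := by
  obtain ⟨a, ha, -, -, e, -⟩ := hw
  have := re_mem_of_mem_brokenLine h.nodup_top (fun a => h.re_pos) ha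
  rwa [h.top_end, Complex.ofReal_re, e] at this

theorem mem_of_top (h : Admissible top bot lam) {w : ℂ} {a : ℕ} (ha : a ∈ top) (hw : 0 ≤ w.im)
    (h1 : (topLeft top bot lam a).re ≤ w.re)
    (h2 : w.re ≤ (topLeft top bot lam a).re + (sideVector top bot lam a).re)
    (h3 : cross (sideVector top bot lam a) (w - topLeft top bot lam a) ≤ 0) :
    w ∈ suspensionPolygon top bot lam := by
  obtain ⟨z, hz, e⟩ := exists_mem_brokenLine h.nodup_top (fun a => h.re_pos) ha h1 h2
  obtain ⟨h0, hL⟩ := h.top_strip_subset ha h1 h2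
  obtain ⟨b, hb, h1', h2'⟩ := h.exists_bot_strip h0 hL
  obtain ⟨z', hz', e'⟩ := exists_mem_brokenLine h.nodup_bot h.re_pos_bot (h.mem_bot.2 hb) h1' h2'
  refine ⟨z, hz, z', hz', e, e', (h.bot_line_im_nonpos hz').trans hw, ?_⟩
  have := cross_sub_eq h.nodup_top (fun a => h.re_pos) hz e ha h1 h2
  rw [topLeft, this] at h3
  have := h.re_pos ha
  nlinarith

theorem mem_of_bot (h : Admissible top bot lam) {w : ℂ} {a : ℕ} (ha : a ∈ top) (hw : w.im ≤ 0)
    (h1 : (botLeft top bot lam a).re ≤ w.re)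
    (h2 : w.re ≤ (botLeft top bot lam a).re + (sideVector top bot lam a).re)
    (h3 : 0 ≤ cross (sideVector top bot lam a) (w - botLeft top bot lam a)) :
    w ∈ suspensionPolygon top bot lam := by
  obtain ⟨z, hz, e⟩ := exists_mem_brokenLine h.nodup_bot h.re_pos_bot (h.mem_bot.2 ha) h1 h2
  obtain ⟨h0, hL⟩ := h.bot_strip_subset ha h1 h2
  obtain ⟨b, hb, h1', h2'⟩ := h.exists_top_strip h0 hL
  obtain ⟨z', hz', e'⟩ := exists_mem_brokenLine h.nodup_top (fun a => h.re_pos) hb h1' h2'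
  refine ⟨z', hz', z, hz, e', e, ?_, hw.trans (h.top_line_im_nonneg hz')⟩
  have := cross_sub_eq h.nodup_bot h.re_pos_bot hz e (h.mem_bot.2 ha) h1 h2
  rw [botLeft, this] at h3
  have := h.re_pos ha
  nlinarith

theorem cross_top_nonpos (h : Admissible top bot lam) {w : ℂ}
    (hw : w ∈ suspensionPolygon top bot lam) {a : ℕ} (ha : a ∈ top)
    (h1 : (topLeft top bot lam a).re ≤ w.re)
    (h2 : w.re ≤ (topLeft top bot lam a).re + (sideVector top bot lam a).re) :
    cross (sideVector top bot lam a) (w - topLeft top bot lam a) ≤ 0 := by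
  obtain ⟨z, hz, -, -, e, -, -, hi⟩ := hw
  rw [topLeft, cross_sub_eq h.nodup_top (fun a => h.re_pos) hz e ha h1 h2]
  exact mul_nonpos_of_nonneg_of_nonpos (h.re_pos ha).le (sub_nonpos.2 hi)

theorem cross_bot_nonneg (h : Admissible top bot lam) {w : ℂ}
    (hw : w ∈ suspensionPolygon top bot lam) {a : ℕ} (ha : a ∈ top)
    (h1 : (botLeft top bot lam a).re ≤ w.re)
    (h2 : w.re ≤ (botLeft top bot lam a).re + (sideVector top bot lam a).re) :
    0 ≤ cross (sideVector top bot lam a) (w - botLeft top bot lam a) := by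
  obtain ⟨-, -, z, hz, -, e, hi, -⟩ := hw
  rw [botLeft, cross_sub_eq h.nodup_bot h.re_pos_bot hz e (h.mem_bot.2 ha) h1 h2]
  exact mul_nonneg (h.re_pos ha).le (sub_nonneg.2 hi)

theorem mem_of_mem_top_line (h : Admissible top bot lam) {z : ℂ}
    (hz : z ∈ brokenLine top (sideVector top bot lam)) : z ∈ suspensionPolygon top bot lam := by
  have hre := re_mem_of_mem_brokenLine h.nodup_top (fun a => h.re_pos) hz
  rw [h.top_end, Complex.ofReal_re] at hre
  obtain ⟨a, ha, h1, h2⟩ := h.exists_top_strip hre.1 hre.2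
  exact h.mem_of_top ha (h.top_line_im_nonneg hz) h1 h2
    (cross_eq_zero h.nodup_top (fun a => h.re_pos) hz ha h1 h2).le

theorem mem_of_mem_bot_line (h : Admissible top bot lam) {z : ℂ}
    (hz : z ∈ brokenLine bot (sideVector top bot lam)) : z ∈ suspensionPolygon top bot lam := by
  have hre := re_mem_of_mem_brokenLine h.nodup_bot h.re_pos_bot hz
  rw [h.length_bot, h.bot_end, Complex.ofReal_re] at hre
  obtain ⟨a, ha, h1, h2⟩ := h.exists_bot_strip hre.1 hre.2
  exact h.mem_of_bot ha (h.bot_line_im_nonpos hz) h1 h2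
    (cross_eq_zero h.nodup_bot h.re_pos_bot hz (h.mem_bot.2 ha) h1 h2).ge

theorem top_side_mem (h : Admissible top bot lam) {a : ℕ} (ha : a ∈ top) {t : ℝ}
    (ht : t ∈ Icc (0 : ℝ) 1) :
    topLeft top bot lam a + t * sideVector top bot lam a ∈ suspensionPolygon top bot lam :=
  h.mem_of_mem_top_line (h.mem_top_line.2 ⟨a, ha, t, ht, rfl⟩)

theorem bot_side_mem (h : Admissible top bot lam) {a : ℕ} (ha : a ∈ top) {t : ℝ}
    (ht : t ∈ Icc (0 : ℝ) 1) :
    botLeft top bot lam a + t * sideVector top bot lam a ∈ suspensionPolygon top bot lam :=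
  h.mem_of_mem_bot_line (h.mem_bot_line.2 ⟨a, ha, t, ht, rfl⟩)

theorem topLeft_mem (h : Admissible top bot lam) {a : ℕ} (ha : a ∈ top) :
    topLeft top bot lam a ∈ suspensionPolygon top bot lam := by
  simpa using h.top_side_mem ha (t := 0) (by simp)

theorem topRight_mem (h : Admissible top bot lam) {a : ℕ} (ha : a ∈ top) :
    topRight top bot lam a ∈ suspensionPolygon top bot lam := by
  simpa [topRight] using h.top_side_mem ha (t := 1) (by simp)

theorem botLeft_mem (h : Admissible top bot lam) {a : ℕ} (ha : a ∈ top) :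
    botLeft top bot lam a ∈ suspensionPolygon top bot lam := by
  simpa using h.bot_side_mem ha (t := 0) (by simp)

theorem botRight_mem (h : Admissible top bot lam) {a : ℕ} (ha : a ∈ top) :
    botRight top bot lam a ∈ suspensionPolygon top bot lam := by
  simpa [botRight] using h.bot_side_mem ha (t := 1) (by simp)

/-! #### Compactness and connectedness -/

theorem isCompact_polygon (h : Admissible top bot lam) :
    IsCompact (suspensionPolygon top bot lam) := by
  set v := sideVector top bot lam
  let K : Set (ℂ × ℂ × ℝ) := (brokenLine top v ×ˢ brokenLine bot v ×ˢ Icc (0 : ℝ) 1) ∩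
    {x | x.1.re = x.2.1.re}
  have hK : IsCompact K :=
    (isCompact_brokenLine.prod (isCompact_brokenLine.prod isCompact_Icc)).inter_right
      (isClosed_eq (by fun_prop) (by fun_prop))
  let f : ℂ × ℂ × ℝ → ℂ := fun x =>
    x.1.re + ((1 - x.2.2) * x.2.1.im + x.2.2 * x.1.im : ℝ) * Complex.I
  have hf : Continuous f := by fun_prop
  have : suspensionPolygon top bot lam = f '' K := by
    ext w
    constructor
    · rintro ⟨a, ha, b, hb, e, e', h1, h2⟩
      have hseg : w.im ∈ segment ℝ b.im a.im := by
        rw [segment_eq_Icc (h1.trans h2)]; exact ⟨h1, h2⟩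
      rw [segment_eq_image] at hseg
      obtain ⟨t, ht, hw⟩ := hseg
      refine ⟨(a, b, t), ⟨⟨ha, hb, ht⟩, e.trans e'.symm⟩, ?_⟩
      apply Complex.ext
      · simp [f, e]
      · simp only [smul_eq_mul] at hw
        simp [f, hw]
    · rintro ⟨⟨a, b, t⟩, ⟨⟨ha, hb, ht⟩, e⟩, rfl⟩
      have e0 : a.re = b.re := e
      have h1 := h.top_line_im_nonneg ha
      have h2 := h.bot_line_im_nonpos hb
      refine ⟨a, ha, b, hb, by simp [f], by simp [f, e0], ?_, ?_⟩
      · simp [f]; nlinarith [ht.1, ht.2]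
      · simp [f]; nlinarith [ht.1, ht.2]
  rw [this]
  exact hK.image hf

theorem isConnected_polygon (h : Admissible top bot lam) :
    IsConnected (suspensionPolygon top bot lam) := by
  have hL : 0 ≤ (top.map lam).sum :=
    List.sum_nonneg fun x hx => by
      obtain ⟨a, ha, rfl⟩ := List.mem_map.1 hx
      exact (h.pos a ha).le
  have hreal : ∀ x ∈ Icc 0 (top.map lam).sum, ((x : ℝ) : ℂ) ∈ suspensionPolygon top bot lam := by
    intro x hx
    obtain ⟨a, ha, h1, h2⟩ := h.exists_top_strip hx.1 hx.2
    obtain ⟨z, hz, e⟩ := exists_mem_brokenLine h.nodup_top (fun a => h.re_pos) ha h1 h2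
    refine h.mem_of_top ha (by simp) (by simpa using h1) (by simpa using h2) ?_
    have := cross_sub_eq h.nodup_top (fun a => h.re_pos) hz (w := (x : ℂ)) (by simpa using e) ha
      (by simpa [topLeft] using h1) (by simpa [topLeft] using h2)
    rw [topLeft, this, Complex.ofReal_im, zero_sub]
    have := mul_nonneg (h.re_pos ha).le (h.top_line_im_nonneg hz)
    linarith
  have h0 : (0 : ℂ) ∈ suspensionPolygon top bot lam := by
    simpa using hreal 0 ⟨le_rfl, hL⟩
  refine ⟨⟨0, h0⟩, isPreconnected_of_forall 0 fun w hw => ?_⟩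
  have hre := h.re_mem hw
  refine ⟨(fun x : ℝ => (x : ℂ)) '' Icc 0 (top.map lam).sum ∪ segment ℝ (w.re : ℂ) w, ?_, ?_, ?_,
    ?_⟩
  · rintro z (⟨x, hx, rfl⟩ | hz)
    · exact hreal x hx
    · rw [segment_eq_image'] at hz
      obtain ⟨t, ht, rfl⟩ := hz
      obtain ⟨a, ha, b, hb, e, e', h1, h2⟩ := hw
      have h3 := h.top_line_im_nonneg ha
      have h4 := h.bot_line_im_nonpos hb
      refine ⟨a, ha, b, hb, by simp [e], by simp [e'], ?_, ?_⟩
      · simp; nlinarith [ht.1, ht.2]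
      · simp; nlinarith [ht.1, ht.2]
  · exact .inl ⟨0, ⟨le_rfl, hL⟩, by simp⟩
  · exact .inr (right_mem_segment _ _ _)
  · exact IsPreconnected.union (w.re : ℂ) ⟨w.re, hre, rfl⟩ (left_mem_segment _ _ _)
      (isPreconnected_Icc.image _ (by fun_prop)) (convex_segment _ _).isPreconnected

end Admissible

end Polygon

/-! ### The polygon near its vertices and sides -/

namespace Polygon

open Set Filter Topology Metric FlatQuotient

theorem exists_eq_mul_of_cross_eq_zero {a b : ℂ} (ha : 0 < a.re) (h : cross a b = 0) :
    b = ((b.re / a.re : ℝ) : ℂ) * a := by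
  simp only [cross] at h
  apply Complex.ext
  · rw [Complex.re_ofReal_mul]; field_simp
  · rw [Complex.im_ofReal_mul]; field_simp; linarith

variable {top bot : List ℕ} {lam : ℕ → ℝ}

/-- The scale at which the polygon looks like a sector near each of its vertices. -/
structure SmallScale (top bot : List ℕ) (lam : ℕ → ℝ) (r : ℝ) : Prop where
  re : ∀ a ∈ top, r ≤ (sideVector top bot lam a).re
  top_im : ∀ k, 0 < k → k < top.length → r ≤ (lineVertex top (sideVector top bot lam) k).im
  bot_im : ∀ k, 0 < k → k < top.length → (lineVertex bot (sideVector top bot lam) k).im ≤ -r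

namespace Admissible

theorem eventually_smallScale (h : Admissible top bot lam) :
    ∀ᶠ r in 𝓝[>] (0 : ℝ), SmallScale top bot lam r := by
  have key : ∀ c : ℝ, 0 < c → ∀ᶠ r in 𝓝[>] (0 : ℝ), r ≤ c := fun c hc =>
    (eventually_le_nhds hc).filter_mono nhdsWithin_le_nhds
  have h1 : ∀ᶠ r in 𝓝[>] (0 : ℝ), ∀ a ∈ {a | a ∈ top}, r ≤ (sideVector top bot lam a).re :=
    (eventually_all_finite top.finite_toSet).2 fun a ha => key _ (h.re_pos ha)
  have h2 : ∀ᶠ r in 𝓝[>] (0 : ℝ), ∀ k ∈ Ioo 0 top.length,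
      r ≤ (lineVertex top (sideVector top bot lam) k).im :=
    (eventually_all_finite (finite_Ioo _ _)).2 fun k hk => key _ (h.top_vertex_im_pos hk.1 hk.2)
  have h3 : ∀ᶠ r in 𝓝[>] (0 : ℝ), ∀ k ∈ Ioo 0 top.length,
      r ≤ -(lineVertex bot (sideVector top bot lam) k).im :=
    (eventually_all_finite (finite_Ioo _ _)).2 fun k hk =>
      key _ (neg_pos.2 (h.bot_vertex_im_neg hk.1 hk.2))
  filter_upwards [h1, h2, h3] with r e1 e2 e3
  exact ⟨e1, fun k a b => e2 k ⟨a, b⟩, fun k a b => le_neg.1 (e3 k ⟨a, b⟩)⟩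

theorem near_topLeft (h : Admissible top bot lam) {r : ℝ} (hr : SmallScale top bot lam r) {a : ℕ}
    (ha : a ∈ top) (ha0 : top.idxOf a ≠ 0) {w : ℂ} (hw : ‖w‖ < r) (hw0 : 0 ≤ w.re) :
    topLeft top bot lam a + w ∈ suspensionPolygon top bot lam ↔
      cross (sideVector top bot lam a) w ≤ 0 := by
  have hre := (abs_le.1 (Complex.abs_re_le_norm w)).2
  have him := (abs_le.1 (Complex.abs_im_le_norm w)).1
  have h1 := hr.re a ha
  have h2 : r ≤ (topLeft top bot lam a).im :=
    hr.top_im _ (Nat.pos_of_ne_zero ha0) (h.idxOf_top_lt ha)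
  have e : topLeft top bot lam a + w - topLeft top bot lam a = w := by ring
  constructor
  · intro hm
    have := h.cross_top_nonpos hm ha (by simpa using hw0) (by simp; linarith)
    rwa [e] at this
  · intro hc
    exact h.mem_of_top ha (by simp; linarith) (by simpa using hw0) (by simp; linarith) (by rwa [e])

theorem near_botLeft (h : Admissible top bot lam) {r : ℝ} (hr : SmallScale top bot lam r) {a : ℕ}
    (ha : a ∈ top) (ha0 : bot.idxOf a ≠ 0) {w : ℂ} (hw : ‖w‖ < r) (hw0 : 0 ≤ w.re) :
    botLeft top bot lam a + w ∈ suspensionPolygon top bot lam ↔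
      0 ≤ cross (sideVector top bot lam a) w := by
  have hre := (abs_le.1 (Complex.abs_re_le_norm w)).2
  have him := (abs_le.1 (Complex.abs_im_le_norm w)).2
  have h1 := hr.re a ha
  have h2 : (botLeft top bot lam a).im ≤ -r :=
    hr.bot_im _ (Nat.pos_of_ne_zero ha0) (h.idxOf_bot_lt ha)
  have e : botLeft top bot lam a + w - botLeft top bot lam a = w := by ring
  constructor
  · intro hm
    have := h.cross_bot_nonneg hm ha (by simpa using hw0) (by simp; linarith)
    rwa [e] at this
  · intro hc
    exact h.mem_of_bot ha (by simp; linarith) (by simpa using hw0) (by simp; linarith) (by rwa [e])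

theorem near_topRight (h : Admissible top bot lam) {r : ℝ} (hr : SmallScale top bot lam r) {a : ℕ}
    (ha : a ∈ top) (ha0 : top.idxOf a + 1 ≠ top.length) {w : ℂ} (hw : ‖w‖ < r) (hw0 : w.re ≤ 0) :
    topRight top bot lam a + w ∈ suspensionPolygon top bot lam ↔
      cross (sideVector top bot lam a) w ≤ 0 := by
  have hre := (abs_le.1 (Complex.abs_re_le_norm w)).1
  have him := (abs_le.1 (Complex.abs_im_le_norm w)).1
  have h1 := hr.re a ha
  have hl := h.idxOf_top_lt ha
  have h2 : r ≤ (topRight top bot lam a).im := by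
    rw [h.topRight_eq ha]; exact hr.top_im _ (by omega) (by omega)
  have e : cross (sideVector top bot lam a) (topRight top bot lam a + w - topLeft top bot lam a) =
      cross (sideVector top bot lam a) w := by
    rw [topRight]; simp only [cross, Complex.add_re, Complex.add_im, Complex.sub_re, Complex.sub_im]
    ring
  constructor
  · intro hm
    rw [← e]
    exact h.cross_top_nonpos hm ha (by simp [topRight]; linarith) (by simp [topRight]; linarith)
  · intro hc
    exact h.mem_of_top ha (by rw [Complex.add_im]; linarith) (by simp [topRight]; linarith)
      (by simp [topRight]; linarith) (by rwa [e])

theorem near_botRight (h : Admissible top bot lam) {r : ℝ} (hr : SmallScale top bot lam r) {a : ℕ}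
    (ha : a ∈ top) (ha0 : bot.idxOf a + 1 ≠ top.length) {w : ℂ} (hw : ‖w‖ < r) (hw0 : w.re ≤ 0) :
    botRight top bot lam a + w ∈ suspensionPolygon top bot lam ↔
      0 ≤ cross (sideVector top bot lam a) w := by
  have hre := (abs_le.1 (Complex.abs_re_le_norm w)).1
  have him := (abs_le.1 (Complex.abs_im_le_norm w)).2
  have h1 := hr.re a ha
  have hl := h.idxOf_bot_lt ha
  have h2 : (botRight top bot lam a).im ≤ -r := by
    rw [h.botRight_eq ha]; exact hr.bot_im _ (by omega) (by omega)
  have e : cross (sideVector top bot lam a) (botRight top bot lam a + w - botLeft top bot lam a) =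
      cross (sideVector top bot lam a) w := by
    rw [botRight]; simp only [cross, Complex.add_re, Complex.add_im, Complex.sub_re, Complex.sub_im]
    ring
  constructor
  · intro hm
    rw [← e]
    exact h.cross_bot_nonneg hm ha (by simp [botRight]; linarith) (by simp [botRight]; linarith)
  · intro hc
    exact h.mem_of_bot ha (by rw [Complex.add_im]; linarith) (by simp [botRight]; linarith)
      (by simp [botRight]; linarith) (by rwa [e])

theorem topLeft_first (_h : Admissible top bot lam) {a : ℕ} (ha0 : top.idxOf a = 0) :
    topLeft top bot lam a = 0 := by rw [topLeft, ha0, lineVertex_zero]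

theorem botLeft_first (_h : Admissible top bot lam) {a : ℕ} (ha0 : bot.idxOf a = 0) :
    botLeft top bot lam a = 0 := by rw [botLeft, ha0, lineVertex_zero]

theorem topRight_last (h : Admissible top bot lam) {a : ℕ} (ha : a ∈ top)
    (ha0 : top.idxOf a + 1 = top.length) :
    topRight top bot lam a = ((top.map lam).sum : ℝ) := by rw [h.topRight_eq ha, ha0, h.top_end]

theorem botRight_last (h : Admissible top bot lam) {a : ℕ} (ha : a ∈ top)
    (ha0 : bot.idxOf a + 1 = top.length) :
    botRight top bot lam a = ((top.map lam).sum : ℝ) := by rw [h.botRight_eq ha, ha0, h.bot_end]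

theorem near_start (h : Admissible top bot lam) {r : ℝ} (hr : SmallScale top bot lam r) {a b : ℕ}
    (ha : a ∈ top) (ha0 : top.idxOf a = 0) (hb : b ∈ top) (hb0 : bot.idxOf b = 0)
    {w : ℂ} (hw : ‖w‖ < r) (hw0 : 0 ≤ w.re) :
    w ∈ suspensionPolygon top bot lam ↔
      cross (sideVector top bot lam a) w ≤ 0 ∧ 0 ≤ cross (sideVector top bot lam b) w := by
  have hre := (abs_le.1 (Complex.abs_re_le_norm w)).2
  have h1 := hr.re a ha
  have h2 := hr.re b hb
  have ea := h.topLeft_first ha0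
  have eb := h.botLeft_first hb0
  constructor
  · intro hm
    have := h.cross_top_nonpos hm ha (by simpa [ea] using hw0) (by rw [ea]; simp; linarith)
    have := h.cross_bot_nonneg hm hb (by simpa [eb] using hw0) (by rw [eb]; simp; linarith)
    simp_all
  · rintro ⟨hc, hc'⟩
    rcases le_total 0 w.im with hi | hi
    · exact h.mem_of_top ha hi (by simpa [ea] using hw0) (by rw [ea]; simp; linarith)
        (by simpa [ea])
    · exact h.mem_of_bot hb hi (by simpa [eb] using hw0) (by rw [eb]; simp; linarith)
        (by simpa [eb])

theorem near_finish (h : Admissible top bot lam) {r : ℝ} (hr : SmallScale top bot lam r) {a b : ℕ}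
    (ha : a ∈ top) (ha0 : top.idxOf a + 1 = top.length) (hb : b ∈ top)
    (hb0 : bot.idxOf b + 1 = top.length) {w : ℂ} (hw : ‖w‖ < r) (hw0 : w.re ≤ 0) :
    (((top.map lam).sum : ℝ) : ℂ) + w ∈ suspensionPolygon top bot lam ↔
      cross (sideVector top bot lam a) w ≤ 0 ∧ 0 ≤ cross (sideVector top bot lam b) w := by
  have hre := (abs_le.1 (Complex.abs_re_le_norm w)).1
  have h1 := hr.re a ha
  have h2 := hr.re b hb
  have ea := h.topRight_last ha ha0
  have eb := h.botRight_last hb hb0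
  have ea' := congrArg Complex.re ea
  have eb' := congrArg Complex.re eb
  simp only [topRight, botRight, Complex.add_re, Complex.ofReal_re] at ea' eb'
  have ca : cross (sideVector top bot lam a)
      ((((top.map lam).sum : ℝ) : ℂ) + w - topLeft top bot lam a) =
      cross (sideVector top bot lam a) w := by
    rw [← ea, topRight]
    simp only [cross, Complex.add_re, Complex.add_im, Complex.sub_re, Complex.sub_im]
    ring
  have cb : cross (sideVector top bot lam b)
      ((((top.map lam).sum : ℝ) : ℂ) + w - botLeft top bot lam b) =
      cross (sideVector top bot lam b) w := by
    rw [← eb, botRight]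
    simp only [cross, Complex.add_re, Complex.add_im, Complex.sub_re, Complex.sub_im]
    ring
  constructor
  · intro hm
    have c1 := h.cross_top_nonpos hm ha (by simp; linarith) (by simp; linarith)
    have c2 := h.cross_bot_nonneg hm hb (by simp; linarith) (by simp; linarith)
    rw [ca] at c1
    rw [cb] at c2
    exact ⟨c1, c2⟩
  · rintro ⟨hc, hc'⟩
    rcases le_total 0 w.im with hi | hi
    · exact h.mem_of_top ha (by simpa using hi) (by simp; linarith) (by simp; linarith)
        (by rwa [ca])
    · exact h.mem_of_bot hb (by simpa using hi) (by simp; linarith) (by simp; linarith)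
        (by rwa [cb])

/-! #### Interior points -/

theorem start_of_re_eq_zero (h : Admissible top bot lam) {w : ℂ}
    (hw : w ∈ suspensionPolygon top bot lam) (h0 : w.re = 0) : w = 0 := by
  obtain ⟨a, ha, ha0⟩ := h.exists_top (j := 0) (by linarith [h.two_le])
  obtain ⟨b, hb, hb0⟩ := h.exists_bot (j := 0) (by linarith [h.two_le])
  have ea := h.topLeft_first ha0
  have eb := h.botLeft_first hb0
  have h1 := h.re_pos ha
  have h2 := h.re_pos hb
  have c1 := h.cross_top_nonpos hw ha (by simp [ea, h0]) (by rw [ea, h0]; simpa using h1.le)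
  have c2 := h.cross_bot_nonneg hw hb (by simp [eb, h0]) (by rw [eb, h0]; simpa using h2.le)
  simp only [cross, ea, eb, sub_zero, h0, mul_zero] at c1 c2
  exact Complex.ext h0 (by rw [Complex.zero_im]; nlinarith)

theorem finish_of_re_eq (h : Admissible top bot lam) {w : ℂ}
    (hw : w ∈ suspensionPolygon top bot lam) (h0 : w.re = (top.map lam).sum) :
    w = ((top.map lam).sum : ℝ) := by
  obtain ⟨a, ha, ha0⟩ := h.exists_top (j := top.length - 1) (by have := h.two_le; omega)
  obtain ⟨b, hb, hb0⟩ := h.exists_bot (j := top.length - 1) (by have := h.two_le; omega)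
  have hN := h.two_le
  have ea := h.topRight_last ha (by omega)
  have eb := h.botRight_last hb (by omega)
  have h1 := h.re_pos ha
  have h2 := h.re_pos hb
  have ea' := congrArg Complex.re ea
  have eb' := congrArg Complex.re eb
  have ea2 := congrArg Complex.im ea
  have eb2 := congrArg Complex.im eb
  simp only [topRight, botRight, Complex.add_re, Complex.ofReal_re, Complex.add_im,
    Complex.ofReal_im] at ea' eb' ea2 eb2
  have c1 := h.cross_top_nonpos hw ha (by linarith) (by linarith)
  have c2 := h.cross_bot_nonneg hw hb (by linarith) (by linarith)
  simp only [cross, Complex.sub_re, Complex.sub_im] at c1 c2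
  have r1 : w.re - (topLeft top bot lam a).re = (sideVector top bot lam a).re := by linarith
  have r2 : w.re - (botLeft top bot lam b).re = (sideVector top bot lam b).re := by linarith
  rw [r1] at c1
  rw [r2] at c2
  refine Complex.ext h0 ?_
  rw [Complex.ofReal_im]
  nlinarith

theorem mem_nhds_of_not_mem_lines (h : Admissible top bot lam) {p : ℂ}
    (hp : p ∈ suspensionPolygon top bot lam) (ht : p ∉ brokenLine top (sideVector top bot lam))
    (hb : p ∉ brokenLine bot (sideVector top bot lam)) : suspensionPolygon top bot lam ∈ 𝓝 p := by
  have hre := h.re_mem hp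
  have hzero : (0 : ℂ) ∈ brokenLine top (sideVector top bot lam) := by
    obtain ⟨a, ha, ha0⟩ := h.exists_top (j := 0) (by linarith [h.two_le])
    exact h.mem_top_line.2 ⟨a, ha, 0, by simp, by simp [h.topLeft_first ha0]⟩
  have hend : (((top.map lam).sum : ℝ) : ℂ) ∈ brokenLine top (sideVector top bot lam) := by
    have hN := h.two_le
    obtain ⟨a, ha, ha0⟩ := h.exists_top (j := top.length - 1) (by omega)
    refine h.mem_top_line.2 ⟨a, ha, 1, by simp, ?_⟩
    rw [← h.topRight_last ha (by omega), topRight]; simp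
  have h0 : 0 < p.re := hre.1.lt_of_ne fun e => ht (h.start_of_re_eq_zero hp e.symm ▸ hzero)
  have h1 : p.re < (top.map lam).sum := hre.2.lt_of_ne fun e => ht (h.finish_of_re_eq hp e ▸ hend)
  have ev0 : ∀ᶠ w : ℂ in 𝓝 p, 0 < w.re := Complex.continuous_re.continuousAt.eventually_const_lt h0
  have ev1 : ∀ᶠ w : ℂ in 𝓝 p, w.re < (top.map lam).sum :=
    Complex.continuous_re.continuousAt.eventually_lt_const h1
  have strip : ∀ q v : ℂ, (q.re ≤ p.re → p.re ≤ q.re + v.re → 0 < cross v (p - q)) →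
      ∀ᶠ w in 𝓝 p, q.re ≤ w.re → w.re ≤ q.re + v.re → 0 < cross v (w - q) := by
    intro q v hq
    by_cases c1 : q.re ≤ p.re
    · by_cases c2 : p.re ≤ q.re + v.re
      · have hc : ContinuousAt (fun w => cross v (w - q)) p := by
          unfold cross; fun_prop
        filter_upwards [hc.eventually_const_lt (hq c1 c2)] with w hw _ _
        exact hw
      · filter_upwards [Complex.continuous_re.continuousAt.eventually_const_lt (not_le.1 c2)]
          with w hw _ hw'
        linarith
    · filter_upwards [Complex.continuous_re.continuousAt.eventually_lt_const (not_le.1 c1)]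
        with w hw hw'
      linarith
  have strip' : ∀ q v : ℂ, (q.re ≤ p.re → p.re ≤ q.re + v.re → cross v (p - q) < 0) →
      ∀ᶠ w in 𝓝 p, q.re ≤ w.re → w.re ≤ q.re + v.re → cross v (w - q) < 0 := by
    intro q v hq
    by_cases c1 : q.re ≤ p.re
    · by_cases c2 : p.re ≤ q.re + v.re
      · have hc : ContinuousAt (fun w => cross v (w - q)) p := by
          unfold cross; fun_prop
        filter_upwards [hc.eventually_lt_const (hq c1 c2)] with w hw _ _
        exact hw
      · filter_upwards [Complex.continuous_re.continuousAt.eventually_const_lt (not_le.1 c2)]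
          with w hw _ hw'
        linarith
    · filter_upwards [Complex.continuous_re.continuousAt.eventually_lt_const (not_le.1 c1)]
        with w hw hw'
      linarith
  have side : ∀ q v : ℂ, 0 < v.re → cross v (p - q) = 0 → q.re ≤ p.re → p.re ≤ q.re + v.re →
      ∃ t ∈ Icc (0 : ℝ) 1, p = q + t * v := by
    intro q v hv hc c1 c2
    refine ⟨_, ⟨?_, ?_⟩, eq_add_of_sub_eq' (exists_eq_mul_of_cross_eq_zero hv hc)⟩
    · exact div_nonneg (by simpa using c1) hv.le
    · rw [div_le_one hv, Complex.sub_re]; linarith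
  have evt : ∀ᶠ w in 𝓝 p, ∀ a ∈ {a | a ∈ top}, (topLeft top bot lam a).re ≤ w.re →
      w.re ≤ (topLeft top bot lam a).re + (sideVector top bot lam a).re →
      cross (sideVector top bot lam a) (w - topLeft top bot lam a) < 0 := by
    refine (eventually_all_finite top.finite_toSet).2 fun a ha => strip' _ _ fun c1 c2 => ?_
    refine (h.cross_top_nonpos hp ha c1 c2).lt_of_ne fun e => ht ?_
    obtain ⟨t, htt, e'⟩ := side _ _ (h.re_pos ha) e c1 c2
    exact h.mem_top_line.2 ⟨a, ha, t, htt, e'⟩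
  have evb : ∀ᶠ w in 𝓝 p, ∀ a ∈ {a | a ∈ top}, (botLeft top bot lam a).re ≤ w.re →
      w.re ≤ (botLeft top bot lam a).re + (sideVector top bot lam a).re →
      0 < cross (sideVector top bot lam a) (w - botLeft top bot lam a) := by
    refine (eventually_all_finite top.finite_toSet).2 fun a ha => strip _ _ fun c1 c2 => ?_
    refine (h.cross_bot_nonneg hp ha c1 c2).lt_of_ne fun e => hb ?_
    obtain ⟨t, htt, e'⟩ := side _ _ (h.re_pos ha) e.symm c1 c2
    exact h.mem_bot_line.2 ⟨a, ha, t, htt, e'⟩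
  filter_upwards [ev0, ev1, evt, evb] with w w0 w1 wt wb
  rcases le_total 0 w.im with hi | hi
  · obtain ⟨a, ha, c1, c2⟩ := h.exists_top_strip w0.le w1.le
    exact h.mem_of_top ha hi c1 c2 (wt a ha c1 c2).le
  · obtain ⟨a, ha, c1, c2⟩ := h.exists_bot_strip w0.le w1.le
    exact h.mem_of_bot ha hi c1 c2 (wb a ha c1 c2).le

theorem hasStar_interior (h : Admissible top bot lam) {p : suspensionPolygon top bot lam}
    (ht : (p : ℂ) ∉ brokenLine top (sideVector top bot lam))
    (hb : (p : ℂ) ∉ brokenLine bot (sideVector top bot lam)) :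
    HasStar (sideGluing top bot lam) (Suspension.mk top bot lam p) 1 := by
  have hn := h.mem_nhds_of_not_mem_lines p.2 ht hb
  have hn1 := (isCompact_brokenLine (l := top) (v := sideVector top bot lam)).isClosed.isOpen_compl.mem_nhds
    ht
  have hn2 := (isCompact_brokenLine (l := bot) (v := sideVector top bot lam)).isClosed.isOpen_compl.mem_nhds
    hb
  obtain ⟨r, hr, hball⟩ := Metric.mem_nhds_iff.1 (inter_mem hn (inter_mem hn1 hn2))
  refine ⟨{p}, fun x q => (q : ℂ) - x, r, ?_, by rintro x rfl; rfl⟩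
  have hb' : ∀ q : suspensionPolygon top bot lam, q ∈ ball p r → (q : ℂ) ∈ ball (p : ℂ) r :=
    fun q hq => hq
  exact
  { k_pos := one_pos
    r_pos := hr
    finite := finite_singleton p
    disjoint := by rintro x rfl y rfl q _ _; rfl
    cont := fun x _ => by fun_prop
    pow_eq := fun x _ q _ => pow_one _
    compat := by
      rintro x rfl q hq s (hs | hs)
      · obtain ⟨a, ha, t, ht, e1, e2⟩ := hs
        exact absurd (h.mem_top_line.2 ⟨a, ha, t, ht, e1⟩) (hball (hb' q hq)).2.1
      · obtain ⟨a, ha, t, ht, e1, e2⟩ := hs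
        exact absurd (h.mem_bot_line.2 ⟨a, ha, t, ht, e2⟩) (hball (hb' q hq)).2.2
    inj := by
      rintro x rfl y rfl q hq s hs e
      rw [Subtype.ext (sub_left_injective e)]
    surj := fun ζ hζ => by
      have hmem : (p : ℂ) + ζ ∈ ball (p : ℂ) r := by simpa [dist_eq_norm] using hζ
      exact ⟨p, rfl, ⟨p + ζ, (hball hmem).1⟩, hmem, by simp⟩ }

/-! #### Interior points of sides -/

theorem eq_of_topLeft_strip (h : Admissible top bot lam) {a b : ℕ} (ha : a ∈ top) (hb : b ∈ top)
    {x : ℝ} (h1 : (topLeft top bot lam a).re < x)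
    (h2 : x < (topLeft top bot lam a).re + (sideVector top bot lam a).re)
    (h3 : (topLeft top bot lam b).re ≤ x)
    (h4 : x ≤ (topLeft top bot lam b).re + (sideVector top bot lam b).re) : a = b := by
  have ea := congrArg Complex.re (h.topRight_eq ha)
  have eb := congrArg Complex.re (h.topRight_eq hb)
  simp only [topRight, Complex.add_re] at ea eb
  rcases lt_trichotomy (top.idxOf a) (top.idxOf b) with hlt | heq | hlt
  · have := lineVertex_re_le (v := sideVector top bot lam) h.nodup_top (fun a => h.re_pos)
      (i := top.idxOf a + 1) hlt (h.idxOf_top_lt hb).le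
    simp only [topLeft] at *; linarith
  · exact h.eq_of_top ha heq
  · have := lineVertex_re_le (v := sideVector top bot lam) h.nodup_top (fun a => h.re_pos)
      (i := top.idxOf b + 1) hlt (h.idxOf_top_lt ha).le
    simp only [topLeft] at *; linarith

theorem eq_of_botLeft_strip (h : Admissible top bot lam) {a b : ℕ} (ha : a ∈ top) (hb : b ∈ top)
    {x : ℝ} (h1 : (botLeft top bot lam a).re < x)
    (h2 : x < (botLeft top bot lam a).re + (sideVector top bot lam a).re)
    (h3 : (botLeft top bot lam b).re ≤ x)
    (h4 : x ≤ (botLeft top bot lam b).re + (sideVector top bot lam b).re) : a = b := by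
  have ea := congrArg Complex.re (h.botRight_eq ha)
  have eb := congrArg Complex.re (h.botRight_eq hb)
  simp only [botRight, Complex.add_re] at ea eb
  rcases lt_trichotomy (bot.idxOf a) (bot.idxOf b) with hlt | heq | hlt
  · have := lineVertex_re_le (v := sideVector top bot lam) h.nodup_bot h.re_pos_bot
      (i := bot.idxOf a + 1) hlt (h.length_bot ▸ (h.idxOf_bot_lt hb).le)
    simp only [botLeft] at *; linarith
  · exact h.eq_of_bot ha heq
  · have := lineVertex_re_le (v := sideVector top bot lam) h.nodup_bot h.re_pos_bot
      (i := bot.idxOf b + 1) hlt (h.length_bot ▸ (h.idxOf_bot_lt ha).le)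
    simp only [botLeft] at *; linarith

theorem hasStar_side (h : Admissible top bot lam) {a : ℕ} (ha : a ∈ top) {t : ℝ} (h0 : 0 < t)
    (h1 : t < 1) :
    HasStar (sideGluing top bot lam)
      (Suspension.mk top bot lam ⟨_, h.top_side_mem ha ⟨h0.le, h1.le⟩⟩) 1 := by
  set v := sideVector top bot lam a with hv
  set p : suspensionPolygon top bot lam := ⟨_, h.top_side_mem ha ⟨h0.le, h1.le⟩⟩ with hp
  set q : suspensionPolygon top bot lam := ⟨_, h.bot_side_mem ha ⟨h0.le, h1.le⟩⟩ with hq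
  have hpv : (p : ℂ) = topLeft top bot lam a + t * v := rfl
  have hqv : (q : ℂ) = botLeft top bot lam a + t * v := rfl
  have hpi : 0 < (p : ℂ).im := h.top_side_im_pos ha h0 h1
  have hqi : (q : ℂ).im < 0 := h.bot_side_im_neg ha h0 h1
  have hvp : 0 < v.re := h.re_pos ha
  obtain ⟨r, hr, r1, r2, r3, r4⟩ : ∃ r > 0, r ≤ (p : ℂ).im ∧ r ≤ -(q : ℂ).im ∧ r ≤ t * v.re ∧
      r ≤ (1 - t) * v.re :=
    ⟨min (min (p : ℂ).im (-(q : ℂ).im)) (min (t * v.re) ((1 - t) * v.re)),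
      lt_min (lt_min hpi (neg_pos.2 hqi))
        (lt_min (mul_pos h0 hvp) (mul_pos (sub_pos.2 h1) hvp)),
      (min_le_left _ _).trans (min_le_left _ _), (min_le_left _ _).trans (min_le_right _ _),
      (min_le_right _ _).trans (min_le_left _ _), (min_le_right _ _).trans (min_le_right _ _)⟩
  have hpre : (p : ℂ).re = (topLeft top bot lam a).re + t * v.re := by rw [hpv]; simp
  have hqre : (q : ℂ).re = (botLeft top bot lam a).re + t * v.re := by rw [hqv]; simp
  have bnd : ∀ w : ℂ, ‖w‖ < r → -r < w.re ∧ w.re < r ∧ -r < w.im ∧ w.im < r := by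
    intro w hw
    have e1 := abs_le.1 (Complex.abs_re_le_norm w)
    have e2 := abs_le.1 (Complex.abs_im_le_norm w)
    exact ⟨by linarith, by linarith, by linarith, by linarith⟩
  have cp : ∀ w : ℂ, cross v ((p : ℂ) + w - topLeft top bot lam a) = cross v w := by
    intro w; rw [hpv]; simp [cross]; ring
  have cq : ∀ w : ℂ, cross v ((q : ℂ) + w - botLeft top bot lam a) = cross v w := by
    intro w; rw [hqv]; simp [cross]; ring
  have memp : ∀ w : ℂ, ‖w‖ < r →
      ((p : ℂ) + w ∈ suspensionPolygon top bot lam ↔ cross v w ≤ 0) := by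
    intro w hw
    obtain ⟨b1, b2, b3, b4⟩ := bnd w hw
    constructor
    · intro hm
      rw [← cp]
      exact h.cross_top_nonpos hm ha (by rw [Complex.add_re]; linarith)
        (by rw [Complex.add_re]; linarith)
    · intro hc
      exact h.mem_of_top ha (by rw [Complex.add_im]; linarith)
        (by rw [Complex.add_re]; linarith) (by rw [Complex.add_re]; linarith) (by rwa [cp])
  have memq : ∀ w : ℂ, ‖w‖ < r →
      ((q : ℂ) + w ∈ suspensionPolygon top bot lam ↔ 0 ≤ cross v w) := by
    intro w hw
    obtain ⟨b1, b2, b3, b4⟩ := bnd w hw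
    constructor
    · intro hm
      rw [← cq]
      exact h.cross_bot_nonneg hm ha (by rw [Complex.add_re]; linarith)
        (by rw [Complex.add_re]; linarith)
    · intro hc
      exact h.mem_of_bot ha (by rw [Complex.add_im]; linarith)
        (by rw [Complex.add_re]; linarith) (by rw [Complex.add_re]; linarith) (by rwa [cq])
  have glue : ∀ y z : suspensionPolygon top bot lam, ‖(y : ℂ) - p‖ < r →
      (z : ℂ) - q = (y : ℂ) - p → Quot.mk (sideGluing top bot lam) y = Quot.mk _ z := by
    intro y z hy e
    obtain ⟨b1, b2, b3, b4⟩ := bnd _ hy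
    have ey : (p : ℂ) + (y - p) = y := by ring
    have ez : (q : ℂ) + (y - p) = z := by rw [← e]; ring
    have c1 := (memp _ hy).1 (by rw [ey]; exact y.2)
    have c2 := (memq _ hy).1 (by rw [ez]; exact z.2)
    have e3 := exists_eq_mul_of_cross_eq_zero hvp (le_antisymm c1 c2)
    set s := ((y : ℂ) - p).re / v.re with hs
    have hsr : s * v.re = ((y : ℂ) - p).re := by rw [hs]; field_simp
    refine Quot.sound ⟨a, ha, t + s, ⟨by nlinarith, by nlinarith⟩, ?_, ?_⟩
    · rw [← ey, e3, hpv, topLeft]; push_cast; ring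
    · rw [← ez, e3, hqv, botLeft]; push_cast; ring
  refine ⟨{p, q}, fun x y => (y : ℂ) - x, r, ?_, ?_⟩
  · refine
    { k_pos := one_pos
      r_pos := hr
      finite := by simp
      disjoint := ?_
      cont := fun x _ => by fun_prop
      pow_eq := fun x _ y _ => pow_one _
      compat := ?_
      inj := ?_
      surj := ?_ }
    · have hpq : ∀ y : suspensionPolygon top bot lam, dist y p < r → dist y q < r → False := by
        intro y d1 d2
        rw [Subtype.dist_eq, dist_eq_norm] at d1 d2
        have b1 := (bnd _ d1).2.2.1
        have b2 := (bnd _ d2).2.2.2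
        rw [Complex.sub_im] at b1 b2
        linarith
      rintro x (rfl | rfl) y (rfl | rfl) z d1 d2
      · rfl
      · exact (hpq z d1 d2).elim
      · exact (hpq z d2 d1).elim
      · rfl
    · have dst : ∀ x y : suspensionPolygon top bot lam, y ∈ ball x r ↔ ‖(y : ℂ) - x‖ < r := by
        intro x y; rw [mem_ball, Subtype.dist_eq, dist_eq_norm]
      have side : ∀ b s, s ∈ Icc (0 : ℝ) 1 → b ∈ top →
          (topLeft top bot lam b).re ≤ (topLeft top bot lam b + s * sideVector top bot lam b).re ∧
          (topLeft top bot lam b + s * sideVector top bot lam b).re ≤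
            (topLeft top bot lam b).re + (sideVector top bot lam b).re ∧
          (botLeft top bot lam b).re ≤ (botLeft top bot lam b + s * sideVector top bot lam b).re ∧
          (botLeft top bot lam b + s * sideVector top bot lam b).re ≤
            (botLeft top bot lam b).re + (sideVector top bot lam b).re := by
        intro b s hs hb
        have := h.re_pos hb
        simp only [Complex.add_re, Complex.re_ofReal_mul]
        refine ⟨?_, ?_, ?_, ?_⟩ <;> nlinarith [hs.1, hs.2]
      rintro x (rfl | rfl) y hy z (hz | hz)
      · obtain ⟨b, hb, s, hs, e1, e2⟩ := hz
        rw [dst] at hy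
        obtain ⟨b1, b2, b3, b4⟩ := bnd _ hy
        change (y : ℂ) = topLeft top bot lam b + _ at e1
        have sd := side b s hs hb
        rw [← e1] at sd
        rw [Complex.sub_re] at b1 b2
        obtain rfl := h.eq_of_topLeft_strip ha hb (x := (y : ℂ).re) (by linarith)
          (by linarith) sd.1 sd.2.1
        have e3 : (z : ℂ) - q = y - p := by
          rw [e1, e2, hpv, hqv, botLeft]; ring
        exact ⟨q, by simp, by rw [dst, e3]; exact hy, e3⟩
      · obtain ⟨b, hb, s, hs, e1, e2⟩ := hz
        have := h.bot_line_im_nonpos (h.mem_bot_line.2 ⟨b, hb, s, hs, e2⟩)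
        rw [dst] at hy
        have b3 := (bnd _ hy).2.2.1
        rw [Complex.sub_im] at b3
        linarith
      · obtain ⟨b, hb, s, hs, e1, e2⟩ := hz
        have := h.top_line_im_nonneg (h.mem_top_line.2 ⟨b, hb, s, hs, e1⟩)
        rw [dst] at hy
        have b3 := (bnd _ hy).2.2.2
        rw [Complex.sub_im] at b3
        linarith
      · obtain ⟨b, hb, s, hs, e1, e2⟩ := hz
        rw [dst] at hy
        obtain ⟨b1, b2, b3, b4⟩ := bnd _ hy
        change (y : ℂ) = botLeft top bot lam b + _ at e2
        have sd := side b s hs hb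
        rw [← e2] at sd
        rw [Complex.sub_re] at b1 b2
        obtain rfl := h.eq_of_botLeft_strip ha hb (x := (y : ℂ).re) (by linarith)
          (by linarith) sd.2.2.1 sd.2.2.2
        have e3 : (z : ℂ) - p = y - q := by
          rw [e1, e2, hpv, hqv, topLeft]; ring
        exact ⟨p, by simp, by rw [dst, e3]; exact hy, e3⟩
    · rintro x (rfl | rfl) y (rfl | rfl) z hz s hs e
      · rw [Subtype.ext (sub_left_injective e)]
      · exact glue z s (by rwa [mem_ball, Subtype.dist_eq, dist_eq_norm] at hz) e.symm
      · exact (glue s z (by rwa [mem_ball, Subtype.dist_eq, dist_eq_norm] at hs) e).symm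
      · rw [Subtype.ext (sub_left_injective e)]
    · intro ζ hζ
      rw [pow_one] at hζ
      rcases le_total (cross v ζ) 0 with hc | hc
      · refine ⟨p, by simp, ⟨p + ζ, (memp ζ hζ).2 hc⟩, ?_, by simp⟩
        rw [mem_ball, Subtype.dist_eq, dist_eq_norm]; simpa using hζ
      · refine ⟨q, by simp, ⟨q + ζ, (memq ζ hζ).2 hc⟩, ?_, by simp⟩
        rw [mem_ball, Subtype.dist_eq, dist_eq_norm]; simpa using hζ
  · rintro x (rfl | rfl)
    · rfl
    · exact (Quot.sound ⟨a, ha, t, ⟨h0.le, h1.le⟩, rfl, rfl⟩).symm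

end Admissible

end Polygon

/-! ### Labels of half-planes at the vertices -/

namespace Polygon

open Set Filter Topology Metric FlatQuotient

/-- A labelling of the right half-planes at the left ends of the sides (by `c`, `R`) and of the left
half-planes at the right ends of the sides (by `c'`, `Q`): `c`, `c'` is the class of the vertex, and
the roots of unity `R`, `Q` are the positions in the cyclic order around the vertex. -/
structure CornerLabels {ι : Type*} (top bot : List ℕ) (k : ι → ℕ) (c c' : ℕ → ι)
    (R Q : ℕ → ℂ) : Prop where
  k_pos : ∀ i, 0 < k i
  pow_R : ∀ a ∈ top, R a ^ k (c a) = 1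
  first : ∀ a ∈ top, ∀ b ∈ top, top.idxOf a = 0 → bot.idxOf b = 0 → c a = c b ∧ R a = R b
  last : ∀ a ∈ top, ∀ b ∈ top, top.idxOf a + 1 = top.length → bot.idxOf b + 1 = top.length →
    c' a = c' b ∧ Q a = Q b
  top_next : ∀ x ∈ top, ∀ y ∈ top, top.idxOf y = top.idxOf x + 1 →
    c y = c' x ∧ R y = Complex.exp (2 * Real.pi * Complex.I / k (c' x)) * Q x
  bot_next : ∀ x ∈ top, ∀ y ∈ top, bot.idxOf y = bot.idxOf x + 1 → c y = c' x ∧ R y = Q x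
  exists_R : ∀ i η, η ^ k i = 1 → ∃ a ∈ top, c a = i ∧ R a = η
  inj_R : ∀ a ∈ top, ∀ b ∈ top, top.idxOf a ≠ 0 → top.idxOf b ≠ 0 → c a = c b → R a = R b → a = b

variable {top bot : List ℕ} {lam : ℕ → ℝ}

namespace Admissible

theorem bot_ne_zero_of_top_eq_zero (h : Admissible top bot lam) {a : ℕ} (ha : a ∈ top)
    (h0 : top.idxOf a = 0) : 0 < bot.idxOf a ∧ 0 < (sideVector top bot lam a).im := by
  have h1 := h.top_vertex_im_pos (k := 1) one_pos (by linarith [h.two_le])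
  have h2 := h.topRight_eq ha
  rw [h0, zero_add] at h2
  rw [← h2, topRight, h.topLeft_first h0, zero_add] at h1
  refine ⟨?_, h1⟩
  rw [sideVector_im, h0] at h1
  simpa using h1

theorem top_ne_zero_of_bot_eq_zero (h : Admissible top bot lam) {a : ℕ} (ha : a ∈ top)
    (h0 : bot.idxOf a = 0) : 0 < top.idxOf a ∧ (sideVector top bot lam a).im < 0 := by
  have h1 := h.bot_vertex_im_neg (k := 1) one_pos (by linarith [h.two_le])
  have h2 := h.botRight_eq ha
  rw [h0, zero_add] at h2
  rw [← h2, botRight, h.botLeft_first h0, zero_add] at h1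
  refine ⟨?_, h1⟩
  rw [sideVector_im, h0] at h1
  simpa using h1

theorem bot_ne_last_of_top_last (h : Admissible top bot lam) {a : ℕ} (ha : a ∈ top)
    (h0 : top.idxOf a + 1 = top.length) :
    bot.idxOf a + 1 ≠ top.length ∧ (sideVector top bot lam a).im < 0 := by
  have hN := h.two_le
  have h1 := h.top_vertex_im_pos (k := top.idxOf a) (by omega) (by omega)
  have h2 := congrArg Complex.im (h.topRight_last ha h0)
  rw [topRight, Complex.add_im, Complex.ofReal_im] at h2
  rw [← topLeft] at h1
  have h3 : (sideVector top bot lam a).im < 0 := by linarith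
  refine ⟨fun he => ?_, h3⟩
  rw [sideVector_im] at h3
  have : bot.idxOf a = top.idxOf a := by omega
  rw [this] at h3
  simp at h3

theorem top_ne_last_of_bot_last (h : Admissible top bot lam) {a : ℕ} (ha : a ∈ top)
    (h0 : bot.idxOf a + 1 = top.length) :
    top.idxOf a + 1 ≠ top.length ∧ 0 < (sideVector top bot lam a).im := by
  have hN := h.two_le
  have h1 := h.bot_vertex_im_neg (k := bot.idxOf a) (by omega) (by omega)
  have h2 := congrArg Complex.im (h.botRight_last ha h0)
  rw [botRight, Complex.add_im, Complex.ofReal_im] at h2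
  rw [← botLeft] at h1
  have h3 : 0 < (sideVector top bot lam a).im := by linarith
  refine ⟨fun he => ?_, h3⟩
  rw [sideVector_im] at h3
  have : bot.idxOf a = top.idxOf a := by omega
  rw [this] at h3
  simp at h3

/-- The symbols with a given label are either a single symbol, or the two symbols which share a
vertex of the polygon. -/
theorem label_cases {κ : Type*} {A : Set ℕ} {L : ℕ → κ} {α β : ℕ} (hα : α ∈ A) (hβ : β ∈ A)
    (hne : α ≠ β) (hL : L α = L β) (hinj : ∀ a ∈ A, ∀ b ∈ A, a ≠ α → b ≠ α → L a = L b → a = b)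
    {a : ℕ} (ha : a ∈ A) :
    (a ≠ α ∧ a ≠ β ∧ ∀ b ∈ A, (L b = L a ↔ b = a)) ∨
      (∀ b ∈ A, (L b = L a ↔ b = α ∨ b = β)) := by
  by_cases h : a = α ∨ a = β
  · right
    have hla : L a = L α := by rcases h with rfl | rfl <;> simp [hL]
    intro b hb
    rw [hla]
    constructor
    · intro e
      by_cases hbα : b = α
      · exact .inl hbα
      · exact .inr (hinj b hb β hβ hbα hne.symm (e.trans hL))
    · rintro (rfl | rfl)
      · rfl
      · exact hL.symm
  · left
    push Not at h
    refine ⟨h.1, h.2, fun b hb => ⟨fun e => ?_, fun e => by rw [e]⟩⟩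
    by_cases hbα : b = α
    · subst hbα
      exact absurd (hinj a ha β hβ h.1 hne.symm (e.symm.trans hL)) h.2
    · exact hinj b hb a ha hbα h.1 e

/-- Gluing of two sectors (or of three, for the two symbols `α`, `β`) to a half-plane. -/
theorem exists_common_image {S : Type*} {P : Set ℂ} (mk : P → S) {A C : Set ℕ} {U D : ℕ → ℂ}
    {x : ℕ → ℝ} {α β : ℕ} (hα : α ∈ A) (hβ : β ∈ A) (hne : α ≠ β)
    (hU : ∀ a ∈ A, a ≠ α → (U a ∈ P ↔ x a ≤ 0))
    (hD : ∀ a ∈ A, a ≠ β → (D a ∈ P ↔ 0 ≤ x a)) (hUD : U α = D β)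
    (hm : U α ∈ P ↔ x α ≤ 0 ∧ 0 ≤ x β)
    (glue : ∀ a ∈ A, x a = 0 → ∀ p q : P, (p : ℂ) = U a → (q : ℂ) = D a → mk p = mk q)
    (key : ¬(x β ≤ 0 ∧ 0 ≤ x α))
    (hC : (∃ a ∈ A, a ≠ α ∧ a ≠ β ∧ ∀ b, b ∈ C ↔ b = a) ∨ (∀ b, b ∈ C ↔ b = α ∨ b = β)) :
    ∃ s, (∃ a ∈ C, ∃ p : P, ((p : ℂ) = U a ∨ (p : ℂ) = D a) ∧ mk p = s) ∧
      ∀ a ∈ C, ∀ p : P, ((p : ℂ) = U a ∨ (p : ℂ) = D a) → mk p = s := by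
  have same : ∀ p q : P, (p : ℂ) = q → mk p = mk q := fun p q e => by rw [Subtype.ext e]
  rcases hC with ⟨a, ha, h1, h2, hC⟩ | hC
  · have g : ∀ p q : P, (p : ℂ) = U a → (q : ℂ) = D a → mk p = mk q := by
      intro p q hp hq
      exact glue a ha (le_antisymm ((hU a ha h1).1 (hp ▸ p.2)) ((hD a ha h2).1 (hq ▸ q.2))) p q hp hq
    rcases le_total (x a) 0 with hx | hx
    · refine ⟨mk ⟨U a, (hU a ha h1).2 hx⟩, ⟨a, (hC a).2 rfl, _, .inl rfl, rfl⟩, ?_⟩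
      intro b hb p hp
      obtain rfl := (hC b).1 hb
      rcases hp with hp | hp
      · exact same _ _ hp
      · exact (g _ _ rfl hp).symm
    · refine ⟨mk ⟨D a, (hD a ha h2).2 hx⟩, ⟨a, (hC a).2 rfl, _, .inr rfl, rfl⟩, ?_⟩
      intro b hb p hp
      obtain rfl := (hC b).1 hb
      rcases hp with hp | hp
      · exact g _ _ hp rfl
      · exact same _ _ hp
  · have mα : α ∈ C := (hC α).2 (.inl rfl)
    have mβ : β ∈ C := (hC β).2 (.inr rfl)
    have gα : ∀ p q : P, (p : ℂ) = U α → (q : ℂ) = D α → mk p = mk q := by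
      intro p q hp hq
      have e1 := hm.1 (hp ▸ p.2)
      exact glue α hα (le_antisymm e1.1 ((hD α hα hne).1 (hq ▸ q.2))) p q hp hq
    have gβ : ∀ p q : P, (p : ℂ) = U β → (q : ℂ) = U α → mk p = mk q := by
      intro p q hp hq
      have e1 := hm.1 (hq ▸ q.2)
      exact glue β hβ (le_antisymm ((hU β hβ hne.symm).1 (hp ▸ p.2)) e1.2) p q hp (hq.trans hUD)
    have gno : ∀ p q : P, (p : ℂ) = U β → (q : ℂ) = D α → False := by
      intro p q hp hq
      exact key ⟨(hU β hβ hne.symm).1 (hp ▸ p.2), (hD α hα hne).1 (hq ▸ q.2)⟩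
    have red : ∀ b ∈ C, ∀ p : P, ((p : ℂ) = U b ∨ (p : ℂ) = D b) →
        (p : ℂ) = U α ∨ (p : ℂ) = U β ∨ (p : ℂ) = D α := by
      intro b hb p hp
      rcases (hC b).1 hb with rfl | rfl <;> rcases hp with hp | hp
      · exact .inl hp
      · exact .inr (.inr hp)
      · exact .inr (.inl hp)
      · exact .inl (hp.trans hUD.symm)
    rcases le_or_gt (x β) 0 with hx | hx
    · have hmem := (hU β hβ hne.symm).2 hx
      refine ⟨mk ⟨U β, hmem⟩, ⟨β, mβ, _, .inl rfl, rfl⟩, fun b hb p hp => ?_⟩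
      rcases red b hb p hp with e | e | e
      · exact (gβ _ _ rfl e).symm
      · exact same _ _ e
      · exact (gno ⟨U β, hmem⟩ p rfl e).elim
    · rcases le_or_gt (x α) 0 with hy | hy
      · have hmem := hm.2 ⟨hy, hx.le⟩
        refine ⟨mk ⟨U α, hmem⟩, ⟨α, mα, _, .inl rfl, rfl⟩, fun b hb p hp => ?_⟩
        rcases red b hb p hp with e | e | e
        · exact same _ _ e
        · exact gβ _ _ e rfl
        · exact (gα _ _ rfl e).symm
      · have hmem := (hD α hα hne).2 hy.le
        refine ⟨mk ⟨D α, hmem⟩, ⟨α, mα, _, .inr rfl, rfl⟩, fun b hb p hp => ?_⟩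
        rcases red b hb p hp with e | e | e
        · exact gα _ _ e rfl
        · exact (gno p ⟨D α, hmem⟩ e rfl).elim
        · exact same _ _ e

theorem cross_key {va vb w : ℂ} (ha : 0 < va.re) (hb : 0 < vb.re) (ha' : 0 < va.im)
    (hb' : vb.im < 0) (hw : 0 ≤ w.re) (hw0 : w ≠ 0) : ¬(cross vb w ≤ 0 ∧ 0 ≤ cross va w) := by
  rintro ⟨h1, h2⟩
  simp only [cross] at h1 h2
  have h3 : w.im ≤ 0 := by
    by_contra hc
    push Not at hc
    nlinarith [mul_pos hb hc, mul_nonneg (neg_pos.2 hb').le hw]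
  have h4 : w.re ≤ 0 := by
    by_contra hc
    push Not at hc
    nlinarith [mul_pos ha' hc, mul_nonneg ha.le (neg_nonneg.2 h3)]
  have h5 : w.re = 0 := le_antisymm h4 hw
  have h6 : w.im = 0 := by
    rw [h5] at h2
    exact le_antisymm h3 (by nlinarith)
  exact hw0 (Complex.ext h5 h6)

end Admissible

variable {ι : Type*} {k : ι → ℕ} {c c' : ℕ → ι} {R Q : ℕ → ℂ}

namespace CornerLabels

theorem exists_bot_next (h : Admissible top bot lam) {x : ℕ} (hx : x ∈ top)
    (hl : bot.idxOf x + 1 ≠ top.length) : ∃ y ∈ top, bot.idxOf y = bot.idxOf x + 1 :=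
  h.exists_bot (by have := h.idxOf_bot_lt hx; omega)

theorem exists_top_next (h : Admissible top bot lam) {x : ℕ} (hx : x ∈ top)
    (hl : top.idxOf x + 1 ≠ top.length) : ∃ y ∈ top, top.idxOf y = top.idxOf x + 1 :=
  h.exists_top (by have := h.idxOf_top_lt hx; omega)

theorem inj_R' (hL : CornerLabels top bot k c c' R Q) (h : Admissible top bot lam) {a b : ℕ}
    (ha : a ∈ top) (hb : b ∈ top) (ha0 : bot.idxOf a ≠ 0) (hb0 : bot.idxOf b ≠ 0)
    (hc : c a = c b) (hR : R a = R b) : a = b := by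
  obtain ⟨β, hβ, hβ0⟩ := h.exists_bot (j := 0) (by linarith [h.two_le])
  have hβt := (h.top_ne_zero_of_bot_eq_zero hβ hβ0).1.ne'
  by_cases h1 : top.idxOf a = 0 <;> by_cases h2 : top.idxOf b = 0
  · exact h.eq_of_top ha (h1.trans h2.symm)
  · have e := hL.first a ha β hβ h1 hβ0
    have := hL.inj_R b hb β hβ h2 hβt (hc.symm.trans e.1) (hR.symm.trans e.2)
    exact absurd (this ▸ hβ0) hb0
  · have e := hL.first b hb β hβ h2 hβ0
    have := hL.inj_R a ha β hβ h1 hβt (hc.trans e.1) (hR.trans e.2)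
    exact absurd (this ▸ hβ0) ha0
  · exact hL.inj_R a ha b hb h1 h2 hc hR

theorem inj_Q (hL : CornerLabels top bot k c c' R Q) (h : Admissible top bot lam) {a b : ℕ}
    (ha : a ∈ top) (hb : b ∈ top) (ha0 : bot.idxOf a + 1 ≠ top.length)
    (hb0 : bot.idxOf b + 1 ≠ top.length) (hc : c' a = c' b) (hQ : Q a = Q b) : a = b := by
  obtain ⟨y, hy, ey⟩ := exists_bot_next h ha ha0
  obtain ⟨z, hz, ez⟩ := exists_bot_next h hb hb0
  have n1 := hL.bot_next a ha y hy ey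
  have n2 := hL.bot_next b hb z hz ez
  have := hL.inj_R' h hy hz (by omega) (by omega) (by rw [n1.1, n2.1, hc]) (by rw [n1.2, n2.2, hQ])
  subst this
  exact h.eq_of_bot ha (by omega)

theorem pow_Q (hL : CornerLabels top bot k c c' R Q) (h : Admissible top bot lam) {a : ℕ}
    (ha : a ∈ top) : Q a ^ k (c' a) = 1 := by
  have key : ∀ b ∈ top, bot.idxOf b + 1 ≠ top.length → Q b ^ k (c' b) = 1 := by
    intro b hb hb0
    obtain ⟨y, hy, ey⟩ := exists_bot_next h hb hb0
    have n1 := hL.bot_next b hb y hy ey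
    rw [← n1.1, ← n1.2]
    exact hL.pow_R y hy
  by_cases h0 : bot.idxOf a + 1 = top.length
  · obtain ⟨α, hα, hα0⟩ := h.exists_top (j := top.length - 1) (by have := h.two_le; omega)
    have hα1 : top.idxOf α + 1 = top.length := by have := h.two_le; omega
    have e := hL.last α hα a ha hα1 h0
    rw [← e.1, ← e.2]
    exact key α hα (h.bot_ne_last_of_top_last hα hα1).1
  · exact key a ha h0

theorem exists_Q (hL : CornerLabels top bot k c c' R Q) (h : Admissible top bot lam) {i : ι} {η : ℂ}
    (hη : η ^ k i = 1) : ∃ a ∈ top, c' a = i ∧ Q a = η := by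
  obtain ⟨a, ha, hai, haη⟩ := hL.exists_R i η hη
  have key : ∃ a ∈ top, c a = i ∧ R a = η ∧ bot.idxOf a ≠ 0 := by
    by_cases h0 : bot.idxOf a = 0
    · obtain ⟨α, hα, hα0⟩ := h.exists_top (j := 0) (by linarith [h.two_le])
      have e := hL.first α hα a ha hα0 h0
      exact ⟨α, hα, e.1.trans hai, e.2.trans haη, (h.bot_ne_zero_of_top_eq_zero hα hα0).1.ne'⟩
    · exact ⟨a, ha, hai, haη, h0⟩
  obtain ⟨a, ha, hai, haη, h0⟩ := key
  obtain ⟨x, hx, ex⟩ := h.exists_bot (j := bot.idxOf a - 1) (by have := h.idxOf_bot_lt ha; omega)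
  have n1 := hL.bot_next x hx a ha (by omega)
  exact ⟨x, hx, n1.1.symm.trans hai, n1.2.symm.trans haη⟩

/-- The right half-plane with a given label. -/
theorem right_halfPlane (hL : CornerLabels top bot k c c' R Q) (h : Admissible top bot lam) {r : ℝ}
    (hr : SmallScale top bot lam r) {i : ι} {η w : ℂ} (hη : η ^ k i = 1) (hw : ‖w‖ < r)
    (hw0 : 0 ≤ w.re) (hw1 : w ≠ 0) :
    ∃ s, (∃ a ∈ top, c a = i ∧ R a = η ∧ ∃ p : suspensionPolygon top bot lam,
        ((p : ℂ) = topLeft top bot lam a + w ∨ (p : ℂ) = botLeft top bot lam a + w) ∧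
          Suspension.mk top bot lam p = s) ∧
      ∀ a ∈ top, c a = i → R a = η → ∀ p : suspensionPolygon top bot lam,
        ((p : ℂ) = topLeft top bot lam a + w ∨ (p : ℂ) = botLeft top bot lam a + w) →
          Suspension.mk top bot lam p = s := by
  obtain ⟨α, hα, hα0⟩ := h.exists_top (j := 0) (by linarith [h.two_le])
  obtain ⟨β, hβ, hβ0⟩ := h.exists_bot (j := 0) (by linarith [h.two_le])
  have fα := h.bot_ne_zero_of_top_eq_zero hα hα0
  have fβ := h.top_ne_zero_of_bot_eq_zero hβ hβ0
  have hne : α ≠ β := by rintro rfl; omega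
  have nα : ∀ a ∈ top, a ≠ α → top.idxOf a ≠ 0 := fun a ha hn e =>
    hn (h.eq_of_top ha (e.trans hα0.symm))
  have nβ : ∀ a ∈ top, a ≠ β → bot.idxOf a ≠ 0 := fun a ha hn e =>
    hn (h.eq_of_bot ha (e.trans hβ0.symm))
  obtain ⟨a₀, ha₀, hi₀, hη₀⟩ := hL.exists_R i η hη
  have hfirst := hL.first α hα β hβ hα0 hβ0
  have cases := Admissible.label_cases (A := {a | a ∈ top}) (L := fun a => (c a, R a)) hα hβ hne
    (Prod.ext hfirst.1 hfirst.2) (fun a ha b hb h1 h2 e =>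
      hL.inj_R a ha b hb (nα a ha h1) (nα b hb h2) (congrArg Prod.fst e) (congrArg Prod.snd e)) ha₀
  have := Admissible.exists_common_image (Suspension.mk top bot lam) (A := {a | a ∈ top})
    (C := {a | a ∈ top ∧ c a = i ∧ R a = η}) (U := fun a => topLeft top bot lam a + w)
    (D := fun a => botLeft top bot lam a + w) (x := fun a => cross (sideVector top bot lam a) w)
    hα hβ hne (fun a ha hn => h.near_topLeft hr ha (nα a ha hn) hw hw0)
    (fun a ha hn => h.near_botLeft hr ha (nβ a ha hn) hw hw0)
    (by simp only [h.topLeft_first hα0, h.botLeft_first hβ0])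
    (by
      simp only [h.topLeft_first hα0, zero_add]
      exact h.near_start hr hα hα0 hβ hβ0 hw hw0)
    (fun a ha hx p q hp hq => by
      have hv := h.re_pos ha
      have e := exists_eq_mul_of_cross_eq_zero hv hx
      have hre := (abs_le.1 (Complex.abs_re_le_norm w)).2
      refine Quot.sound ⟨a, ha, w.re / (sideVector top bot lam a).re,
        ⟨div_nonneg hw0 hv.le, (div_le_one hv).2 (by linarith [hr.re a ha])⟩, ?_, ?_⟩
      · rw [← e]; exact hp
      · rw [← e]; exact hq)
    (Admissible.cross_key (h.re_pos hα) (h.re_pos hβ) fα.2 fβ.2 hw0 hw1)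
    (by
      rcases cases with ⟨h1, h2, h3⟩ | h3
      · refine .inl ⟨a₀, ha₀, h1, h2, fun b => ⟨fun hb => ?_, ?_⟩⟩
        · exact (h3 b hb.1).1 (Prod.ext (hb.2.1.trans hi₀.symm) (hb.2.2.trans hη₀.symm))
        · rintro rfl; exact ⟨ha₀, hi₀, hη₀⟩
      · refine .inr fun b => ⟨fun hb => ?_, fun hb => ?_⟩
        · exact (h3 b hb.1).1 (Prod.ext (hb.2.1.trans hi₀.symm) (hb.2.2.trans hη₀.symm))
        · have hbt : b ∈ top := by rcases hb with rfl | rfl <;> assumption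
          have e := (h3 b hbt).2 hb
          exact ⟨hbt, (congrArg Prod.fst e).trans hi₀, (congrArg Prod.snd e).trans hη₀⟩)
  obtain ⟨s, ⟨a, ha, p, hp, hs⟩, hs'⟩ := this
  exact ⟨s, ⟨a, ha.1, ha.2.1, ha.2.2, p, hp, hs⟩, fun a ha h1 h2 => hs' a ⟨ha, h1, h2⟩⟩

/-- The left half-plane with a given label. -/
theorem left_halfPlane (hL : CornerLabels top bot k c c' R Q) (h : Admissible top bot lam) {r : ℝ}
    (hr : SmallScale top bot lam r) {i : ι} {η w : ℂ} (hη : η ^ k i = 1) (hw : ‖w‖ < r)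
    (hw0 : w.re ≤ 0) (hw1 : w ≠ 0) :
    ∃ s, (∃ a ∈ top, c' a = i ∧ Q a = η ∧ ∃ p : suspensionPolygon top bot lam,
        ((p : ℂ) = topRight top bot lam a + w ∨ (p : ℂ) = botRight top bot lam a + w) ∧
          Suspension.mk top bot lam p = s) ∧
      ∀ a ∈ top, c' a = i → Q a = η → ∀ p : suspensionPolygon top bot lam,
        ((p : ℂ) = topRight top bot lam a + w ∨ (p : ℂ) = botRight top bot lam a + w) →
          Suspension.mk top bot lam p = s := by
  have hN := h.two_le
  obtain ⟨β, hβ, hβ'⟩ := h.exists_top (j := top.length - 1) (by omega)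
  obtain ⟨α, hα, hα'⟩ := h.exists_bot (j := top.length - 1) (by omega)
  have hβ0 : top.idxOf β + 1 = top.length := by omega
  have hα0 : bot.idxOf α + 1 = top.length := by omega
  have fβ := h.bot_ne_last_of_top_last hβ hβ0
  have fα := h.top_ne_last_of_bot_last hα hα0
  have hne : α ≠ β := by rintro rfl; exact fα.1 hβ0
  have nβ : ∀ a ∈ top, a ≠ β → top.idxOf a + 1 ≠ top.length := fun a ha hn e =>
    hn (h.eq_of_top ha (by omega))
  have nα : ∀ a ∈ top, a ≠ α → bot.idxOf a + 1 ≠ top.length := fun a ha hn e =>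
    hn (h.eq_of_bot ha (by omega))
  obtain ⟨a₀, ha₀, hi₀, hη₀⟩ := hL.exists_Q h hη
  have hlast := hL.last β hβ α hα hβ0 hα0
  have cases := Admissible.label_cases (A := {a | a ∈ top}) (L := fun a => (c' a, Q a)) hα hβ hne
    (Prod.ext hlast.1.symm hlast.2.symm) (fun a ha b hb h1 h2 e =>
      hL.inj_Q h ha hb (nα a ha h1) (nα b hb h2) (congrArg Prod.fst e) (congrArg Prod.snd e)) ha₀
  have cneg : ∀ v : ℂ, cross v (-w) = -cross v w := by intro v; simp [cross]; ring
  have := Admissible.exists_common_image (Suspension.mk top bot lam) (A := {a | a ∈ top})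
    (C := {a | a ∈ top ∧ c' a = i ∧ Q a = η}) (U := fun a => botRight top bot lam a + w)
    (D := fun a => topRight top bot lam a + w)
    (x := fun a => cross (sideVector top bot lam a) (-w))
    hα hβ hne
    (fun a ha hn => by
      rw [cneg, neg_nonpos]; exact h.near_botRight hr ha (nα a ha hn) hw hw0)
    (fun a ha hn => by
      rw [cneg, neg_nonneg]; exact h.near_topRight hr ha (nβ a ha hn) hw hw0)
    (by simp only [h.botRight_last hα hα0, h.topRight_last hβ hβ0])
    (by
      simp only [h.botRight_last hα hα0]
      rw [cneg, cneg, neg_nonpos, neg_nonneg, and_comm]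
      exact h.near_finish hr hβ hβ0 hα hα0 hw hw0)
    (fun a ha hx q p hq hp => by
      have hv := h.re_pos ha
      rw [cneg, neg_eq_zero] at hx
      have e := exists_eq_mul_of_cross_eq_zero hv hx
      have hre := (abs_le.1 (Complex.abs_re_le_norm w)).1
      have hra := hr.re a ha
      have e' : sideVector top bot lam a + w =
          ((1 + w.re / (sideVector top bot lam a).re : ℝ) : ℂ) * sideVector top bot lam a := by
        rw [Complex.ofReal_add, add_mul, ← e, Complex.ofReal_one, one_mul]
      refine (Quot.sound ⟨a, ha, 1 + w.re / (sideVector top bot lam a).re, ⟨?_, ?_⟩, ?_, ?_⟩).symm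
      · rw [← neg_le_iff_add_nonneg', le_div_iff₀ hv]; linarith
      · linarith [div_nonpos_of_nonpos_of_nonneg hw0 hv.le]
      · rw [← e', hp, topRight, topLeft, add_assoc]
      · rw [← e', hq, botRight, botLeft, add_assoc])
    (Admissible.cross_key (h.re_pos hα) (h.re_pos hβ) fα.2 fβ.2 (by simpa using hw0)
      (neg_ne_zero.2 hw1))
    (by
      rcases cases with ⟨h1, h2, h3⟩ | h3
      · refine .inl ⟨a₀, ha₀, h1, h2, fun b => ⟨fun hb => ?_, ?_⟩⟩
        · exact (h3 b hb.1).1 (Prod.ext (hb.2.1.trans hi₀.symm) (hb.2.2.trans hη₀.symm))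
        · rintro rfl; exact ⟨ha₀, hi₀, hη₀⟩
      · refine .inr fun b => ⟨fun hb => ?_, fun hb => ?_⟩
        · exact (h3 b hb.1).1 (Prod.ext (hb.2.1.trans hi₀.symm) (hb.2.2.trans hη₀.symm))
        · have hbt : b ∈ top := by rcases hb with rfl | rfl <;> assumption
          have e := (h3 b hbt).2 hb
          exact ⟨hbt, (congrArg Prod.fst e).trans hi₀, (congrArg Prod.snd e).trans hη₀⟩)
  obtain ⟨s, ⟨a, ha, p, hp, hs⟩, hs'⟩ := this
  exact ⟨s, ⟨a, ha.1, ha.2.1, ha.2.2, p, hp.symm, hs⟩,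
    fun a ha h1 h2 p hp => hs' a ⟨ha, h1, h2⟩ p hp.symm⟩

end CornerLabels

end Polygon

/-! ### Stars of the vertices -/

namespace Polygon

open Set Filter Topology Metric FlatQuotient

variable {top bot : List ℕ} {lam : ℕ → ℝ}

/-- The vertex `x` is the left end of a side with symbol `a`. -/
def IsLeftEnd (top bot : List ℕ) (lam : ℕ → ℝ) (a : ℕ) (x : ℂ) : Prop :=
  a ∈ top ∧ (x = topLeft top bot lam a ∨ x = botLeft top bot lam a)

/-- The vertex `x` is the right end of a side with symbol `a`. -/
def IsRightEnd (top bot : List ℕ) (lam : ℕ → ℝ) (a : ℕ) (x : ℂ) : Prop :=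
  a ∈ top ∧ (x = topRight top bot lam a ∨ x = botRight top bot lam a)

namespace Admissible

theorem top_vertex_injective (h : Admissible top bot lam) {i j : ℕ} (hi : i ≤ top.length)
    (hj : j ≤ top.length)
    (e : lineVertex top (sideVector top bot lam) i = lineVertex top (sideVector top bot lam) j) :
    i = j := by
  rcases lt_trichotomy i j with hl | hl | hl
  · have := lineVertex_re_lt (v := sideVector top bot lam) h.nodup_top (fun a => h.re_pos) hl hj
    rw [e] at this; exact absurd this (lt_irrefl _)
  · exact hl
  · have := lineVertex_re_lt (v := sideVector top bot lam) h.nodup_top (fun a => h.re_pos) hl hi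
    rw [e] at this; exact absurd this (lt_irrefl _)

theorem bot_vertex_injective (h : Admissible top bot lam) {i j : ℕ} (hi : i ≤ top.length)
    (hj : j ≤ top.length)
    (e : lineVertex bot (sideVector top bot lam) i = lineVertex bot (sideVector top bot lam) j) :
    i = j := by
  rw [← h.length_bot] at hi hj
  rcases lt_trichotomy i j with hl | hl | hl
  · have := lineVertex_re_lt (v := sideVector top bot lam) h.nodup_bot h.re_pos_bot hl hj
    rw [e] at this; exact absurd this (lt_irrefl _)
  · exact hl
  · have := lineVertex_re_lt (v := sideVector top bot lam) h.nodup_bot h.re_pos_bot hl hi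
    rw [e] at this; exact absurd this (lt_irrefl _)

theorem finish_re_pos (h : Admissible top bot lam) : 0 < (top.map lam).sum := by
  have := lineVertex_re_lt (v := sideVector top bot lam) h.nodup_top (fun a => h.re_pos)
    (i := 0) (j := top.length) (by linarith [h.two_le]) le_rfl
  rwa [lineVertex_zero, h.top_end, Complex.ofReal_re, Complex.zero_re] at this

/-- The upper and the lower broken line have only their end points in common. -/
theorem top_eq_bot_vertex (h : Admissible top bot lam) {i j : ℕ} (hi : i ≤ top.length)
    (hj : j ≤ top.length)
    (e : lineVertex top (sideVector top bot lam) i = lineVertex bot (sideVector top bot lam) j) :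
    (i = 0 ∧ j = 0) ∨ (i = top.length ∧ j = top.length) := by
  have h1 := h.top_vertex_im_nonneg hi
  have h2 := h.bot_vertex_im_nonpos hj
  rw [← e] at h2
  have h3 := le_antisymm h2 h1
  have hL := h.finish_re_pos
  have hi' : i = 0 ∨ i = top.length := by
    by_contra hc
    push Not at hc
    exact (h.top_vertex_im_pos (Nat.pos_of_ne_zero hc.1) (lt_of_le_of_ne hi hc.2)).ne' h3
  have hj' : j = 0 ∨ j = top.length := by
    by_contra hc
    push Not at hc
    rw [e] at h3
    exact (h.bot_vertex_im_neg (Nat.pos_of_ne_zero hc.1) (lt_of_le_of_ne hj hc.2)).ne h3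
  have e' := congrArg Complex.re e
  rcases hi' with rfl | rfl <;> rcases hj' with rfl | rfl
  · exact .inl ⟨rfl, rfl⟩
  · rw [lineVertex_zero, h.bot_end, Complex.ofReal_re, Complex.zero_re] at e'
    exact absurd e' hL.ne
  · rw [lineVertex_zero, h.top_end, Complex.ofReal_re, Complex.zero_re] at e'
    exact absurd e' hL.ne'
  · exact .inr ⟨rfl, rfl⟩

end Admissible

variable {ι : Type*} {k : ι → ℕ} {c c' : ℕ → ι} {R Q : ℕ → ℂ}

/-- `x` is a vertex of the class `i`. -/
def InClass (top bot : List ℕ) (lam : ℕ → ℝ) (c c' : ℕ → ι) (i : ι) (x : ℂ) : Prop :=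
  (∃ a, IsLeftEnd top bot lam a x ∧ c a = i) ∨ ∃ a, IsRightEnd top bot lam a x ∧ c' a = i

namespace CornerLabels

theorem left_left (hL : CornerLabels top bot k c c' R Q) (h : Admissible top bot lam) {a b : ℕ}
    {x : ℂ} (ha : IsLeftEnd top bot lam a x) (hb : IsLeftEnd top bot lam b x) :
    c a = c b ∧ R a = R b := by
  obtain ⟨ha, rfl | rfl⟩ := ha <;> obtain ⟨hb, e | e⟩ := hb
  · rw [h.eq_of_top ha (h.top_vertex_injective (h.idxOf_top_lt ha).le (h.idxOf_top_lt hb).le e)]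
    exact ⟨rfl, rfl⟩
  · have h1 := h.idxOf_top_lt ha
    rcases h.top_eq_bot_vertex h1.le (h.idxOf_bot_lt hb).le e with ⟨e1, e2⟩ | ⟨e1, e2⟩
    · exact hL.first a ha b hb e1 e2
    · omega
  · have h1 := h.idxOf_top_lt hb
    rcases h.top_eq_bot_vertex h1.le (h.idxOf_bot_lt ha).le e.symm with ⟨e1, e2⟩ | ⟨e1, e2⟩
    · have := hL.first b hb a ha e1 e2
      exact ⟨this.1.symm, this.2.symm⟩
    · omega
  · rw [h.eq_of_bot ha (h.bot_vertex_injective (h.idxOf_bot_lt ha).le (h.idxOf_bot_lt hb).le e)]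
    exact ⟨rfl, rfl⟩

theorem right_right (hL : CornerLabels top bot k c c' R Q) (h : Admissible top bot lam) {a b : ℕ}
    {x : ℂ} (ha : IsRightEnd top bot lam a x) (hb : IsRightEnd top bot lam b x) :
    c' a = c' b ∧ Q a = Q b := by
  obtain ⟨ha, rfl | rfl⟩ := ha <;> obtain ⟨hb, e | e⟩ := hb
  · rw [h.topRight_eq ha, h.topRight_eq hb] at e
    have := h.top_vertex_injective (h.idxOf_top_lt ha) (h.idxOf_top_lt hb) e
    rw [h.eq_of_top ha (by omega : top.idxOf a = top.idxOf b)]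
    exact ⟨rfl, rfl⟩
  · rw [h.topRight_eq ha, h.botRight_eq hb] at e
    rcases h.top_eq_bot_vertex (h.idxOf_top_lt ha) (h.idxOf_bot_lt hb) e with
      ⟨e1, e2⟩ | ⟨e1, e2⟩
    · omega
    · exact hL.last a ha b hb e1 e2
  · rw [h.botRight_eq ha, h.topRight_eq hb] at e
    rcases h.top_eq_bot_vertex (h.idxOf_top_lt hb) (h.idxOf_bot_lt ha) e.symm with
      ⟨e1, e2⟩ | ⟨e1, e2⟩
    · omega
    · have := hL.last b hb a ha e1 e2
      exact ⟨this.1.symm, this.2.symm⟩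
  · rw [h.botRight_eq ha, h.botRight_eq hb] at e
    have := h.bot_vertex_injective (h.idxOf_bot_lt ha) (h.idxOf_bot_lt hb) e
    rw [h.eq_of_bot ha (by omega : bot.idxOf a = bot.idxOf b)]
    exact ⟨rfl, rfl⟩

/-- The two labels of a vertex which is both a left end and a right end. -/
theorem left_right (hL : CornerLabels top bot k c c' R Q) (h : Admissible top bot lam) {a b : ℕ}
    {x : ℂ} (ha : IsLeftEnd top bot lam a x) (hb : IsRightEnd top bot lam b x) :
    c a = c' b ∧
      ((x = topLeft top bot lam a ∧ top.idxOf a ≠ 0 ∧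
          R a = Complex.exp (2 * Real.pi * Complex.I / k (c' b)) * Q b) ∨
        (x = botLeft top bot lam a ∧ bot.idxOf a ≠ 0 ∧ R a = Q b)) := by
  obtain ⟨ha, rfl | rfl⟩ := ha <;> obtain ⟨hb, e | e⟩ := hb
  · rw [h.topRight_eq hb] at e
    have := h.top_vertex_injective (h.idxOf_top_lt ha).le (h.idxOf_top_lt hb) e
    have e' := hL.top_next b hb a ha this
    exact ⟨e'.1, .inl ⟨rfl, by omega, e'.2⟩⟩
  · rw [h.botRight_eq hb] at e
    have := h.idxOf_top_lt ha
    rcases h.top_eq_bot_vertex (h.idxOf_top_lt ha).le (h.idxOf_bot_lt hb) e with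
      ⟨e1, e2⟩ | ⟨e1, e2⟩ <;> omega
  · rw [h.topRight_eq hb] at e
    have := h.idxOf_bot_lt ha
    rcases h.top_eq_bot_vertex (h.idxOf_top_lt hb) (h.idxOf_bot_lt ha).le e.symm with
      ⟨e1, e2⟩ | ⟨e1, e2⟩ <;> omega
  · rw [h.botRight_eq hb] at e
    have := h.bot_vertex_injective (h.idxOf_bot_lt ha).le (h.idxOf_bot_lt hb) e
    have e' := hL.bot_next b hb a ha this
    exact ⟨e'.1, .inr ⟨rfl, by omega, e'.2⟩⟩

theorem class_of_left (hL : CornerLabels top bot k c c' R Q) (h : Admissible top bot lam) {a : ℕ}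
    {x : ℂ} {i : ι} (ha : IsLeftEnd top bot lam a x) (hx : InClass top bot lam c c' i x) :
    c a = i := by
  rcases hx with ⟨b, hb, rfl⟩ | ⟨b, hb, rfl⟩
  · exact (hL.left_left h ha hb).1
  · exact (hL.left_right h ha hb).1

theorem class_of_right (hL : CornerLabels top bot k c c' R Q) (h : Admissible top bot lam) {a : ℕ}
    {x : ℂ} {i : ι} (ha : IsRightEnd top bot lam a x) (hx : InClass top bot lam c c' i x) :
    c' a = i := by
  rcases hx with ⟨b, hb, rfl⟩ | ⟨b, hb, rfl⟩
  · exact (hL.left_right h hb ha).1.symm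
  · exact (hL.right_right h ha hb).1

end CornerLabels

namespace Admissible

theorem isLeftEnd_of_isRightEnd (h : Admissible top bot lam) {a : ℕ} {x : ℂ}
    (ha : IsRightEnd top bot lam a x) (hx : x ≠ ((top.map lam).sum : ℝ)) :
    ∃ b, IsLeftEnd top bot lam b x := by
  obtain ⟨ha, rfl | rfl⟩ := ha
  · have hl := h.idxOf_top_lt ha
    obtain ⟨b, hb, e⟩ := h.exists_top (j := top.idxOf a + 1)
      (lt_of_le_of_ne hl fun e => hx (h.topRight_last ha e))
    exact ⟨b, hb, .inl (by rw [h.topRight_eq ha, topLeft, e])⟩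
  · have hl := h.idxOf_bot_lt ha
    obtain ⟨b, hb, e⟩ := h.exists_bot (j := bot.idxOf a + 1)
      (lt_of_le_of_ne hl fun e => hx (h.botRight_last ha e))
    exact ⟨b, hb, .inr (by rw [h.botRight_eq ha, botLeft, e])⟩

theorem isRightEnd_of_isLeftEnd (h : Admissible top bot lam) {a : ℕ} {x : ℂ}
    (ha : IsLeftEnd top bot lam a x) (hx : x ≠ 0) : ∃ b, IsRightEnd top bot lam b x := by
  obtain ⟨ha, rfl | rfl⟩ := ha
  · have hl := h.idxOf_top_lt ha
    have h0 : top.idxOf a ≠ 0 := fun e => hx (h.topLeft_first e)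
    obtain ⟨b, hb, e⟩ := h.exists_top (j := top.idxOf a - 1) (by omega)
    exact ⟨b, hb, .inl (by rw [h.topRight_eq hb, topLeft, e, Nat.sub_add_cancel (by omega)])⟩
  · have hl := h.idxOf_bot_lt ha
    have h0 : bot.idxOf a ≠ 0 := fun e => hx (h.botLeft_first e)
    obtain ⟨b, hb, e⟩ := h.exists_bot (j := bot.idxOf a - 1) (by omega)
    exact ⟨b, hb, .inr (by rw [h.botRight_eq hb, botLeft, e, Nat.sub_add_cancel (by omega)])⟩

/-- A vertex of the polygon on a side of the upper broken line is one of its ends. -/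
theorem eq_end_of_mem_top_side (h : Admissible top bot lam) {x : ℂ}
    (hx : ∃ b, IsLeftEnd top bot lam b x ∨ IsRightEnd top bot lam b x) {a : ℕ} (ha : a ∈ top)
    {t : ℝ} (ht : t ∈ Icc (0 : ℝ) 1)
    (e : x = topLeft top bot lam a + t * sideVector top bot lam a) :
    x = topLeft top bot lam a ∨ x = topRight top bot lam a := by
  rcases ht.1.eq_or_lt with rfl | h0
  · left; simpa using e
  rcases ht.2.eq_or_lt with rfl | h1
  · right; simpa [topRight] using e
  exfalso
  have him := h.top_side_im_pos ha h0 h1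
  rw [← e] at him
  have hv := h.re_pos ha
  have hre : x.re = (topLeft top bot lam a).re + t * (sideVector top bot lam a).re := by
    rw [e, Complex.add_re, Complex.re_ofReal_mul]
  have l1 : (topLeft top bot lam a).re < x.re := by nlinarith
  have l2 : x.re < (topLeft top bot lam a).re + (sideVector top bot lam a).re := by nlinarith
  obtain ⟨b, ⟨hb, e' | e'⟩ | ⟨hb, e' | e'⟩⟩ := hx
  · have := h.eq_of_topLeft_strip ha hb l1 l2 (by rw [e']) (by rw [e']; linarith [h.re_pos hb])
    subst this
    rw [e'] at l1; exact lt_irrefl _ l1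
  · rw [e'] at him; exact absurd him (h.botLeft_im_nonpos hb).not_gt
  · have hr : x.re = (topLeft top bot lam b).re + (sideVector top bot lam b).re := by
      rw [e', topRight, Complex.add_re]
    have := h.eq_of_topLeft_strip ha hb l1 l2 (by linarith [h.re_pos hb]) hr.le
    subst this
    linarith
  · rw [e'] at him; exact absurd him (h.botRight_im_nonpos hb).not_gt

theorem eq_end_of_mem_bot_side (h : Admissible top bot lam) {x : ℂ}
    (hx : ∃ b, IsLeftEnd top bot lam b x ∨ IsRightEnd top bot lam b x) {a : ℕ} (ha : a ∈ top)
    {t : ℝ} (ht : t ∈ Icc (0 : ℝ) 1)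
    (e : x = botLeft top bot lam a + t * sideVector top bot lam a) :
    x = botLeft top bot lam a ∨ x = botRight top bot lam a := by
  rcases ht.1.eq_or_lt with rfl | h0
  · left; simpa using e
  rcases ht.2.eq_or_lt with rfl | h1
  · right; simpa [botRight] using e
  exfalso
  have him := h.bot_side_im_neg ha h0 h1
  rw [← e] at him
  have hv := h.re_pos ha
  have hre : x.re = (botLeft top bot lam a).re + t * (sideVector top bot lam a).re := by
    rw [e, Complex.add_re, Complex.re_ofReal_mul]
  have l1 : (botLeft top bot lam a).re < x.re := by nlinarith
  have l2 : x.re < (botLeft top bot lam a).re + (sideVector top bot lam a).re := by nlinarith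
  obtain ⟨b, ⟨hb, e' | e'⟩ | ⟨hb, e' | e'⟩⟩ := hx
  · rw [e'] at him; exact absurd him (h.topLeft_im_nonneg hb).not_gt
  · have := h.eq_of_botLeft_strip ha hb l1 l2 (by rw [e']) (by rw [e']; linarith [h.re_pos hb])
    subst this
    rw [e'] at l1; exact lt_irrefl _ l1
  · rw [e'] at him; exact absurd him (h.topRight_im_nonneg hb).not_gt
  · have hr : x.re = (botLeft top bot lam b).re + (sideVector top bot lam b).re := by
      rw [e', botRight, Complex.add_re]
    have := h.eq_of_botLeft_strip ha hb l1 l2 (by linarith [h.re_pos hb]) hr.le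
    subst this
    linarith

/-- The vertices of the polygon. -/
def vertices (top bot : List ℕ) (lam : ℕ → ℝ) : Set ℂ :=
  {x | ∃ b, IsLeftEnd top bot lam b x ∨ IsRightEnd top bot lam b x}

theorem finite_vertices (top bot : List ℕ) (lam : ℕ → ℝ) : (vertices top bot lam).Finite := by
  have hf : {a | a ∈ top}.Finite := top.finite_toSet
  refine ((((hf.image (topLeft top bot lam)).union (hf.image (botLeft top bot lam))).union
    (hf.image (topRight top bot lam))).union (hf.image (botRight top bot lam))).subset ?_
  rintro x ⟨b, ⟨hb, rfl | rfl⟩ | ⟨hb, rfl | rfl⟩⟩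
  · exact .inl (.inl (.inl ⟨b, hb, rfl⟩))
  · exact .inl (.inl (.inr ⟨b, hb, rfl⟩))
  · exact .inl (.inr ⟨b, hb, rfl⟩)
  · exact .inr ⟨b, hb, rfl⟩

/-- At the scale `r` the vertices are far from each other and from the sides not containing them. -/
structure Separated (top bot : List ℕ) (lam : ℕ → ℝ) (r : ℝ) : Prop where
  vertices : ∀ x ∈ vertices top bot lam, ∀ y ∈ vertices top bot lam, x ≠ y → 2 * r ≤ dist x y
  top_side : ∀ x ∈ Admissible.vertices top bot lam, ∀ a ∈ top, x ≠ topLeft top bot lam a →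
    x ≠ topRight top bot lam a → ∀ t ∈ Icc (0 : ℝ) 1,
      r ≤ dist (topLeft top bot lam a + t * sideVector top bot lam a) x
  bot_side : ∀ x ∈ Admissible.vertices top bot lam, ∀ a ∈ top, x ≠ botLeft top bot lam a →
    x ≠ botRight top bot lam a → ∀ t ∈ Icc (0 : ℝ) 1,
      r ≤ dist (botLeft top bot lam a + t * sideVector top bot lam a) x

theorem eventually_le_dist_side {p v x : ℂ} (hx : ∀ t ∈ Icc (0 : ℝ) 1, x ≠ p + t * v) :
    ∀ᶠ r in 𝓝[>] (0 : ℝ), ∀ t ∈ Icc (0 : ℝ) 1, r ≤ dist (p + t * v) x := by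
  obtain ⟨t₀, ht₀, hmin⟩ := (isCompact_Icc (a := (0 : ℝ)) (b := 1)).exists_isMinOn ⟨0, by simp⟩
    (f := fun t : ℝ => dist (p + t * v) x) (by fun_prop)
  have hpos : 0 < dist (p + t₀ * v) x := dist_pos.2 (hx t₀ ht₀).symm
  filter_upwards [(eventually_le_nhds hpos).filter_mono nhdsWithin_le_nhds] with r hr t ht
  exact hr.trans (hmin ht)

theorem eventually_separated (h : Admissible top bot lam) :
    ∀ᶠ r in 𝓝[>] (0 : ℝ), Separated top bot lam r := by
  have hV := finite_vertices top bot lam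
  have hA : {a | a ∈ top}.Finite := top.finite_toSet
  have e1 : ∀ᶠ r in 𝓝[>] (0 : ℝ), ∀ x ∈ vertices top bot lam, ∀ y ∈ vertices top bot lam,
      x ≠ y → 2 * r ≤ dist x y := by
    refine (eventually_all_finite hV).2 fun x _ => (eventually_all_finite hV).2 fun y _ => ?_
    by_cases hxy : x = y
    · exact Eventually.of_forall fun r hn => absurd hxy hn
    · filter_upwards [(eventually_le_nhds (half_pos (dist_pos.2 hxy))).filter_mono
        nhdsWithin_le_nhds] with r hr _
      linarith
  have e2 : ∀ᶠ r in 𝓝[>] (0 : ℝ), ∀ x ∈ vertices top bot lam, ∀ a ∈ {a | a ∈ top},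
      x ≠ topLeft top bot lam a → x ≠ topRight top bot lam a → ∀ t ∈ Icc (0 : ℝ) 1,
        r ≤ dist (topLeft top bot lam a + t * sideVector top bot lam a) x := by
    refine (eventually_all_finite hV).2 fun x hx => (eventually_all_finite hA).2 fun a ha => ?_
    by_cases hxa : x = topLeft top bot lam a ∨ x = topRight top bot lam a
    · exact Eventually.of_forall fun r n1 n2 => (hxa.elim n1 n2).elim
    · filter_upwards [eventually_le_dist_side (p := topLeft top bot lam a)
        (v := sideVector top bot lam a) (x := x) fun t ht e =>
          hxa (h.eq_end_of_mem_top_side hx ha ht e)] with r hr _ _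
      exact hr
  have e3 : ∀ᶠ r in 𝓝[>] (0 : ℝ), ∀ x ∈ vertices top bot lam, ∀ a ∈ {a | a ∈ top},
      x ≠ botLeft top bot lam a → x ≠ botRight top bot lam a → ∀ t ∈ Icc (0 : ℝ) 1,
        r ≤ dist (botLeft top bot lam a + t * sideVector top bot lam a) x := by
    refine (eventually_all_finite hV).2 fun x hx => (eventually_all_finite hA).2 fun a ha => ?_
    by_cases hxa : x = botLeft top bot lam a ∨ x = botRight top bot lam a
    · exact Eventually.of_forall fun r n1 n2 => (hxa.elim n1 n2).elim
    · filter_upwards [eventually_le_dist_side (p := botLeft top bot lam a)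
        (v := sideVector top bot lam a) (x := x) fun t ht e =>
          hxa (h.eq_end_of_mem_bot_side hx ha ht e)] with r hr _ _
      exact hr
  filter_upwards [e1, e2, e3] with r h1 h2 h3
  exact ⟨h1, h2, h3⟩

end Admissible

namespace CornerLabels

theorem isLeftEnd_of_inClass (hL : CornerLabels top bot k c c' R Q) (h : Admissible top bot lam)
    {x : ℂ} {i : ι} (hx : InClass top bot lam c c' i x) (hn : x ≠ ((top.map lam).sum : ℝ)) :
    ∃ a, IsLeftEnd top bot lam a x ∧ c a = i := by
  have : ∃ a, IsLeftEnd top bot lam a x := by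
    rcases hx with ⟨b, hb, -⟩ | ⟨b, hb, -⟩
    · exact ⟨b, hb⟩
    · exact h.isLeftEnd_of_isRightEnd hb hn
  obtain ⟨a, ha⟩ := this
  exact ⟨a, ha, hL.class_of_left h ha hx⟩

theorem isRightEnd_of_inClass (hL : CornerLabels top bot k c c' R Q) (h : Admissible top bot lam)
    {x : ℂ} {i : ι} (hx : InClass top bot lam c c' i x) (hn : x ≠ 0) :
    ∃ a, IsRightEnd top bot lam a x ∧ c' a = i := by
  have : ∃ a, IsRightEnd top bot lam a x := by
    rcases hx with ⟨b, hb, -⟩ | ⟨b, hb, -⟩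
    · exact h.isRightEnd_of_isLeftEnd hb hn
    · exact ⟨b, hb⟩
  obtain ⟨a, ha⟩ := this
  exact ⟨a, ha, hL.class_of_right h ha hx⟩

/-! #### All vertices of a class are identified -/

theorem mk_left (h : Admissible top bot lam) {a : ℕ} (ha : a ∈ top) :
    Suspension.mk top bot lam ⟨_, h.topLeft_mem ha⟩ =
      Suspension.mk top bot lam ⟨_, h.botLeft_mem ha⟩ :=
  Quot.sound ⟨a, ha, 0, by simp, by simp [topLeft], by simp [botLeft]⟩

theorem mk_right (h : Admissible top bot lam) {a : ℕ} (ha : a ∈ top) :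
    Suspension.mk top bot lam ⟨_, h.topRight_mem ha⟩ =
      Suspension.mk top bot lam ⟨_, h.botRight_mem ha⟩ :=
  Quot.sound ⟨a, ha, 1, by simp, by simp [topRight, topLeft], by simp [botRight, botLeft]⟩

theorem mk_congr {p q : ℂ} (hp : p ∈ suspensionPolygon top bot lam)
    (hq : q ∈ suspensionPolygon top bot lam) (e : p = q) :
    Suspension.mk top bot lam ⟨p, hp⟩ = Suspension.mk top bot lam ⟨q, hq⟩ := by subst e; rfl

theorem mk_right_eq_mk_left (hL : CornerLabels top bot k c c' R Q) (h : Admissible top bot lam)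
    {x : ℕ} (hx : x ∈ top) : ∃ y, ∃ hy : y ∈ top,
      c y = c' x ∧ R y = Complex.exp (2 * Real.pi * Complex.I / k (c' x)) * Q x ∧
      Suspension.mk top bot lam ⟨_, h.topRight_mem hx⟩ =
        Suspension.mk top bot lam ⟨_, h.topLeft_mem hy⟩ := by
  have key : ∀ x, ∀ hx : x ∈ top, top.idxOf x + 1 ≠ top.length → ∃ y, ∃ hy : y ∈ top,
      c y = c' x ∧ R y = Complex.exp (2 * Real.pi * Complex.I / k (c' x)) * Q x ∧
      Suspension.mk top bot lam ⟨_, h.topRight_mem hx⟩ =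
        Suspension.mk top bot lam ⟨_, h.topLeft_mem hy⟩ := by
    intro x hx hn
    obtain ⟨y, hy, e⟩ := exists_top_next h hx hn
    have n := hL.top_next x hx y hy e
    exact ⟨y, hy, n.1, n.2, mk_congr _ _ (by rw [h.topRight_eq hx, topLeft, e])⟩
  by_cases hn : top.idxOf x + 1 = top.length
  · obtain ⟨β, hβ, hβ'⟩ := h.exists_bot (j := top.length - 1) (by have := h.two_le; omega)
    have hβ0 : bot.idxOf β + 1 = top.length := by have := h.two_le; omega
    obtain ⟨y, hy, e1, e2, e3⟩ := key β hβ (h.top_ne_last_of_bot_last hβ hβ0).1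
    have n := hL.last x hx β hβ hn hβ0
    rw [← n.1] at e1 e2
    rw [← n.2] at e2
    refine ⟨y, hy, e1, e2, ?_⟩
    rw [← e3, mk_right h hβ]
    exact mk_congr _ _ (by rw [h.topRight_last hx hn, h.botRight_last hβ hβ0])
  · exact key x hx hn

theorem exists_rotate (hL : CornerLabels top bot k c c' R Q) (h : Admissible top bot lam)
    {a : ℕ} (ha : a ∈ top) : ∃ y, ∃ hy : y ∈ top,
      c y = c a ∧ R y = Complex.exp (2 * Real.pi * Complex.I / k (c a)) * R a ∧
      Suspension.mk top bot lam ⟨_, h.topLeft_mem ha⟩ =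
        Suspension.mk top bot lam ⟨_, h.topLeft_mem hy⟩ := by
  have key : ∀ a, ∀ ha : a ∈ top, bot.idxOf a ≠ 0 → ∃ y, ∃ hy : y ∈ top,
      c y = c a ∧ R y = Complex.exp (2 * Real.pi * Complex.I / k (c a)) * R a ∧
      Suspension.mk top bot lam ⟨_, h.topLeft_mem ha⟩ =
        Suspension.mk top bot lam ⟨_, h.topLeft_mem hy⟩ := by
    intro a ha h0
    obtain ⟨x, hx, ex⟩ := h.exists_bot (j := bot.idxOf a - 1) (by have := h.idxOf_bot_lt ha; omega)
    have n := hL.bot_next x hx a ha (by omega)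
    obtain ⟨y, hy, e1, e2, e3⟩ := hL.mk_right_eq_mk_left h hx
    rw [← n.1] at e1 e2
    rw [← n.2] at e2
    refine ⟨y, hy, e1, e2, ?_⟩
    rw [← e3, mk_left h ha, mk_right h hx]
    refine mk_congr _ _ ?_
    rw [h.botRight_eq hx, botLeft, ex, Nat.sub_add_cancel (by omega)]
  by_cases h0 : bot.idxOf a = 0
  · obtain ⟨α, hα, hα0⟩ := h.exists_top (j := 0) (by linarith [h.two_le])
    have n := hL.first α hα a ha hα0 h0
    obtain ⟨y, hy, e1, e2, e3⟩ := key α hα (h.bot_ne_zero_of_top_eq_zero hα hα0).1.ne'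
    rw [n.1] at e1 e2
    rw [n.2] at e2
    refine ⟨y, hy, e1, e2, ?_⟩
    rw [← e3, mk_left h ha]
    exact mk_congr _ _ (by rw [h.botLeft_first h0, h.topLeft_first hα0])
  · exact key a ha h0

theorem mk_topLeft_eq (hL : CornerLabels top bot k c c' R Q) (h : Admissible top bot lam)
    {a b : ℕ} (ha : a ∈ top) (hb : b ∈ top) (hc : c a = c b) :
    Suspension.mk top bot lam ⟨_, h.topLeft_mem ha⟩ =
      Suspension.mk top bot lam ⟨_, h.topLeft_mem hb⟩ := by
  have iter : ∀ n : ℕ, ∃ y, ∃ hy : y ∈ top, c y = c a ∧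
      R y = Complex.exp (2 * Real.pi * Complex.I / k (c a)) ^ n * R a ∧
      Suspension.mk top bot lam ⟨_, h.topLeft_mem ha⟩ =
        Suspension.mk top bot lam ⟨_, h.topLeft_mem hy⟩ := by
    intro n
    induction n with
    | zero => exact ⟨a, ha, rfl, by simp, rfl⟩
    | succ n ih =>
      obtain ⟨y, hy, e1, e2, e3⟩ := ih
      obtain ⟨z, hz, f1, f2, f3⟩ := hL.exists_rotate h hy
      refine ⟨z, hz, f1.trans e1, ?_, e3.trans f3⟩
      rw [f2, e2, e1, pow_succ']; ring
  have hk := hL.k_pos (c a)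
  have hprim := Complex.isPrimitiveRoot_exp (k (c a)) hk.ne'
  have ha1 := hL.pow_R a ha
  have hb1 := hL.pow_R b hb
  have ha0 : R a ≠ 0 := by
    intro e; rw [e, zero_pow hk.ne'] at ha1; exact zero_ne_one ha1
  have : NeZero (k (c a)) := ⟨hk.ne'⟩
  obtain ⟨n, -, hn⟩ := hprim.eq_pow_of_pow_eq_one (ξ := R b / R a) (by
    rw [div_pow, ha1, hc, hb1, div_one])
  obtain ⟨y, hy, e1, e2, e3⟩ := iter n
  rw [hn, div_mul_cancel₀ _ ha0] at e2
  rw [e3]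
  by_cases h1 : bot.idxOf y = 0 <;> by_cases h2 : bot.idxOf b = 0
  · obtain rfl := h.eq_of_bot hy (h1.trans h2.symm); rfl
  · obtain ⟨α, hα, hα0⟩ := h.exists_top (j := 0) (by linarith [h.two_le])
    have n := hL.first α hα y hy hα0 h1
    obtain rfl := hL.inj_R' h hα hb (h.bot_ne_zero_of_top_eq_zero hα hα0).1.ne' h2
      (n.1.trans (e1.trans hc)) (n.2.trans e2)
    rw [mk_left h hy]
    exact mk_congr _ _ (by rw [h.botLeft_first h1, h.topLeft_first hα0])
  · obtain ⟨α, hα, hα0⟩ := h.exists_top (j := 0) (by linarith [h.two_le])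
    have n := hL.first α hα b hb hα0 h2
    obtain rfl := hL.inj_R' h hα hy (h.bot_ne_zero_of_top_eq_zero hα hα0).1.ne' h1
      (n.1.trans (hc.symm.trans e1.symm)) (n.2.trans e2.symm)
    rw [mk_left h hb]
    exact mk_congr _ _ (by rw [h.botLeft_first h2, h.topLeft_first hα0])
  · obtain rfl := hL.inj_R' h hy hb h1 h2 (e1.trans hc) e2; rfl

theorem mk_eq_of_inClass (hL : CornerLabels top bot k c c' R Q) (h : Admissible top bot lam)
    {x : suspensionPolygon top bot lam} {i : ι} (hx : InClass top bot lam c c' i x) {b : ℕ}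
    (hb : b ∈ top) (hbi : c b = i) :
    Suspension.mk top bot lam x = Suspension.mk top bot lam ⟨_, h.topLeft_mem hb⟩ := by
  subst hbi
  rcases hx with ⟨a, ⟨ha, e | e⟩, hc⟩ | ⟨a, ⟨ha, e | e⟩, hc⟩
  · exact (mk_congr x.2 (h.topLeft_mem ha) e).trans (hL.mk_topLeft_eq h ha hb hc)
  · exact (mk_congr x.2 (h.botLeft_mem ha) e).trans
      ((mk_left h ha).symm.trans (hL.mk_topLeft_eq h ha hb hc))
  · obtain ⟨y, hy, e1, -, e3⟩ := hL.mk_right_eq_mk_left h ha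
    exact (mk_congr x.2 (h.topRight_mem ha) e).trans
      (e3.trans (hL.mk_topLeft_eq h hy hb (e1.trans hc)))
  · obtain ⟨y, hy, e1, -, e3⟩ := hL.mk_right_eq_mk_left h ha
    exact (mk_congr x.2 (h.botRight_mem ha) e).trans
      ((mk_right h ha).symm.trans (e3.trans (hL.mk_topLeft_eq h hy hb (e1.trans hc))))

end CornerLabels

end Polygon

namespace Polygon

open Set Filter Topology Metric FlatQuotient

theorem neg_cpow_of_im_neg {z : ℂ} (hz : z.im < 0) (s : ℂ) :
    (-z) ^ s = Complex.exp (Real.pi * Complex.I * s) * z ^ s := by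
  have h0 : z ≠ 0 := by rintro rfl; simp at hz
  have hlog : Complex.log (-z) = Complex.log z + Real.pi * Complex.I := by
    rw [Complex.log, Complex.log, norm_neg, Complex.arg_neg_eq_arg_add_pi_of_im_neg hz]
    push_cast; ring
  rw [Complex.cpow_def_of_ne_zero (neg_ne_zero.2 h0), Complex.cpow_def_of_ne_zero h0, hlog,
    ← Complex.exp_add]
  congr 1; ring

theorem exp_pi_mul_inv_pow {k : ℕ} (hk : 0 < k) :
    Complex.exp (Real.pi * Complex.I * (k : ℂ)⁻¹) ^ k = -1 := by
  have : (k : ℂ) ≠ 0 := Nat.cast_ne_zero.2 hk.ne'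
  rw [← Complex.exp_nat_mul, ← Complex.exp_pi_mul_I]
  congr 1; field_simp

variable {top bot : List ℕ} {lam : ℕ → ℝ}
variable {ι : Type*} {k : ι → ℕ} {c c' : ℕ → ι} {R Q : ℕ → ℂ}

open Classical in
/-- The label of the right half-plane at a vertex. -/
def rightLabel (top bot : List ℕ) (lam : ℕ → ℝ) (R : ℕ → ℂ) (x : ℂ) : ℂ :=
  if h : ∃ a, IsLeftEnd top bot lam a x then R h.choose else 0

open Classical in
/-- The label of the left half-plane at a vertex. -/
def leftLabel (top bot : List ℕ) (lam : ℕ → ℝ) (Q : ℕ → ℂ) (x : ℂ) : ℂ :=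
  if h : ∃ a, IsRightEnd top bot lam a x then Q h.choose else 0

/-- The branch of the `k`-th root of `w` in the sector of the polygon at the vertex `x`. -/
def sectorRoot (top bot : List ℕ) (lam : ℕ → ℝ) (R Q : ℕ → ℂ) (k : ℕ) (x w : ℂ) : ℂ :=
  if 0 ≤ w.re then rightLabel top bot lam R x * w ^ (k : ℂ)⁻¹
  else leftLabel top bot lam Q x * (Complex.exp (Real.pi * Complex.I * (k : ℂ)⁻¹) * (-w) ^ (k : ℂ)⁻¹)

theorem sectorRoot_zero {j : ℕ} (hj : 0 < j) (x : ℂ) : sectorRoot top bot lam R Q j x 0 = 0 := by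
  have : ((j : ℂ)⁻¹) ≠ 0 := inv_ne_zero (Nat.cast_ne_zero.2 hj.ne')
  simp [sectorRoot, Complex.zero_cpow this]

namespace CornerLabels

theorem rightLabel_eq (hL : CornerLabels top bot k c c' R Q) (h : Admissible top bot lam) {a : ℕ}
    {x : ℂ} (ha : IsLeftEnd top bot lam a x) : rightLabel top bot lam R x = R a := by
  have hex : ∃ a, IsLeftEnd top bot lam a x := ⟨a, ha⟩
  rw [rightLabel, dif_pos hex]
  exact (hL.left_left h hex.choose_spec ha).2

theorem leftLabel_eq (hL : CornerLabels top bot k c c' R Q) (h : Admissible top bot lam) {a : ℕ}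
    {x : ℂ} (ha : IsRightEnd top bot lam a x) : leftLabel top bot lam Q x = Q a := by
  have hex : ∃ a, IsRightEnd top bot lam a x := ⟨a, ha⟩
  rw [leftLabel, dif_pos hex]
  exact (hL.right_right h hex.choose_spec ha).2

/-- A vertex with points of the polygon to the right of it (or above or below it) is a left end. -/
theorem isLeftEnd_of_re_nonneg (hL : CornerLabels top bot k c c' R Q) (h : Admissible top bot lam)
    {x p : ℂ} {i : ι} (hx : InClass top bot lam c c' i x) (hp : p ∈ suspensionPolygon top bot lam)
    (hre : 0 ≤ (p - x).re) (hne : p ≠ x) : ∃ a, IsLeftEnd top bot lam a x ∧ c a = i := by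
  refine hL.isLeftEnd_of_inClass h hx ?_
  rintro rfl
  have := (h.re_mem hp).2
  simp only [Complex.sub_re, Complex.ofReal_re] at hre
  exact hne (h.finish_of_re_eq hp (by linarith))

theorem isRightEnd_of_re_nonpos (hL : CornerLabels top bot k c c' R Q) (h : Admissible top bot lam)
    {x p : ℂ} {i : ι} (hx : InClass top bot lam c c' i x) (hp : p ∈ suspensionPolygon top bot lam)
    (hre : (p - x).re ≤ 0) (hne : p ≠ x) : ∃ a, IsRightEnd top bot lam a x ∧ c' a = i := by
  refine hL.isRightEnd_of_inClass h hx ?_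
  rintro rfl
  have := (h.re_mem hp).1
  simp only [Complex.sub_re, Complex.zero_re] at hre
  exact hne (h.start_of_re_eq_zero hp (by linarith))

theorem sectorRoot_pow (hL : CornerLabels top bot k c c' R Q) (h : Admissible top bot lam)
    {x p : ℂ} {i : ι} (hx : InClass top bot lam c c' i x)
    (hp : p ∈ suspensionPolygon top bot lam) :
    sectorRoot top bot lam R Q (k i) x (p - x) ^ k i = p - x := by
  have hk := hL.k_pos i
  by_cases hne : p = x
  · rw [hne, sub_self, sectorRoot_zero hk, zero_pow hk.ne']
  rw [sectorRoot]
  split_ifs with hre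
  · obtain ⟨a, ha, rfl⟩ := hL.isLeftEnd_of_re_nonneg h hx hp hre hne
    rw [hL.rightLabel_eq h ha, mul_pow, hL.pow_R a ha.1, one_mul, Complex.cpow_nat_inv_pow _ hk.ne']
  · obtain ⟨a, ha, rfl⟩ := hL.isRightEnd_of_re_nonpos h hx hp (not_le.1 hre).le hne
    rw [hL.leftLabel_eq h ha, mul_pow, mul_pow, hL.pow_Q h ha.1, one_mul, exp_pi_mul_inv_pow hk,
      Complex.cpow_nat_inv_pow _ hk.ne']
    ring

theorem sectorRoot_continuousOn (hL : CornerLabels top bot k c c' R Q)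
    (h : Admissible top bot lam) {r : ℝ} (hr : SmallScale top bot lam r)
    {x : suspensionPolygon top bot lam} {i : ι} (hx : InClass top bot lam c c' i x) :
    ContinuousOn (fun p : suspensionPolygon top bot lam =>
      sectorRoot top bot lam R Q (k i) x (p - x)) (ball x r) := by
  have hk := hL.k_pos i
  have hk0 : ((k i : ℂ)⁻¹) ≠ 0 := inv_ne_zero (Nat.cast_ne_zero.2 hk.ne')
  have hroot : ∀ z : ℂ, 0 ≤ z.re → ContinuousAt (fun w : ℂ => w ^ ((k i : ℂ)⁻¹)) z := by
    intro z hz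
    refine Complex.continuousAt_cpow_const_of_re_pos (.inl hz) ?_
    rw [← Complex.ofReal_natCast, ← Complex.ofReal_inv, Complex.ofReal_re]
    positivity
  have hsub : Continuous fun p : suspensionPolygon top bot lam => (p : ℂ) - x := by fun_prop
  have hre : Continuous fun p : suspensionPolygon top bot lam => ((p : ℂ) - x).re := by fun_prop
  unfold sectorRoot
  refine ContinuousOn.if ?_ ?_ ?_
  · rintro p ⟨hpr, hp⟩
    have hp0 : ((p : ℂ) - x).re = 0 := (frontier_le_subset_eq continuous_const hre hp).symm
    by_cases hne : (p : ℂ) = x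
    · simp [hne, Complex.zero_cpow hk0]
    obtain ⟨a, ha, hai⟩ := hL.isLeftEnd_of_re_nonneg h hx p.2 hp0.ge hne
    obtain ⟨b, hb, hbi⟩ := hL.isRightEnd_of_re_nonpos h hx p.2 hp0.le hne
    have hnorm : ‖(p : ℂ) - x‖ < r := by
      rwa [mem_ball, Subtype.dist_eq, dist_eq_norm] at hpr
    have hpx : (x : ℂ) + (p - x) = p := by ring
    have hv := h.re_pos ha.1
    have him : ((p : ℂ) - x).im ≠ 0 := fun e => hne (sub_eq_zero.1 (Complex.ext hp0 e))
    have hcr : cross (sideVector top bot lam a) (p - x) =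
        (sideVector top bot lam a).re * ((p : ℂ) - x).im := by
      rw [cross, hp0, mul_zero, sub_zero]
    rw [hL.rightLabel_eq h ha, hL.leftLabel_eq h hb]
    rcases (hL.left_right h ha hb).2 with ⟨e1, e2, e3⟩ | ⟨e1, e2, e3⟩
    · have hc := (h.near_topLeft hr ha.1 e2 hnorm hp0.ge).1 (by rw [← e1, hpx]; exact p.2)
      rw [hcr] at hc
      have hneg : ((p : ℂ) - x).im < 0 := lt_of_le_of_ne (by nlinarith) him
      rw [neg_cpow_of_im_neg hneg, e3, hbi]
      have : Complex.exp (2 * Real.pi * Complex.I / k i) =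
          Complex.exp (Real.pi * Complex.I * (k i : ℂ)⁻¹) *
            Complex.exp (Real.pi * Complex.I * (k i : ℂ)⁻¹) := by
        rw [← Complex.exp_add]; congr 1; ring
      rw [this]; ring
    · have hc := (h.near_botLeft hr ha.1 e2 hnorm hp0.ge).1 (by rw [← e1, hpx]; exact p.2)
      rw [hcr] at hc
      have hpos : 0 < ((p : ℂ) - x).im :=
        lt_of_le_of_ne (nonneg_of_mul_nonneg_right hc hv) (Ne.symm him)
      have := neg_cpow_of_im_neg (z := -((p : ℂ) - x)) (by rwa [Complex.neg_im, neg_lt_zero])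
        (k i : ℂ)⁻¹
      rw [neg_neg] at this
      rw [this, e3]
  · refine ContinuousOn.mul continuousOn_const fun p hp => ?_
    have hp0 : 0 ≤ ((p : ℂ) - x).re := closure_minimal (fun _ hq => hq)
      (isClosed_le continuous_const hre) hp.2
    exact (ContinuousAt.comp (f := fun p : suspensionPolygon top bot lam => (p : ℂ) - x)
      (hroot _ hp0) hsub.continuousAt).continuousWithinAt
  · refine ContinuousOn.mul continuousOn_const (ContinuousOn.mul continuousOn_const fun p hp => ?_)
    have hp0 : ((p : ℂ) - x).re ≤ 0 :=
      closure_minimal (t := {q : suspensionPolygon top bot lam | ((q : ℂ) - x).re ≤ 0})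
        (fun q (hq : ¬ 0 ≤ ((q : ℂ) - x).re) => (not_le.1 hq).le)
        (isClosed_le hre continuous_const) hp.2
    have hp1 : 0 ≤ (-((p : ℂ) - x)).re := by rw [Complex.neg_re]; linarith
    exact (ContinuousAt.comp (f := fun p : suspensionPolygon top bot lam => -((p : ℂ) - x))
      (hroot _ hp1) hsub.neg.continuousAt).continuousWithinAt

/-- The corner points of a class have a star of the order of the class. -/
theorem exists_isStar (hL : CornerLabels top bot k c c' R Q) (h : Admissible top bot lam) (i : ι) :
    ∃ r, IsStar (sideGluing top bot lam)
      {x : suspensionPolygon top bot lam | InClass top bot lam c c' i x}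
      (fun x p => sectorRoot top bot lam R Q (k i) x (p - x)) (k i) r := by
  obtain ⟨r, ⟨hr, hs⟩, hr0 : 0 < r⟩ := ((h.eventually_smallScale.and
    h.eventually_separated).and self_mem_nhdsWithin).exists
  have hk := hL.k_pos i
  have hk0 : ((k i : ℂ)⁻¹) ≠ 0 := inv_ne_zero (Nat.cast_ne_zero.2 hk.ne')
  have hvert : ∀ x : ℂ, InClass top bot lam c c' i x → x ∈ Admissible.vertices top bot lam := by
    rintro x (⟨a, ha, -⟩ | ⟨a, ha, -⟩)
    · exact ⟨a, .inl ha⟩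
    · exact ⟨a, .inr ha⟩
  have hball : ∀ x p : suspensionPolygon top bot lam, p ∈ ball x r ↔ ‖(p : ℂ) - x‖ < r := by
    intro x p; rw [mem_ball, Subtype.dist_eq, dist_eq_norm]
  have hexp : Complex.exp (Real.pi * Complex.I * (k i : ℂ)⁻¹) ≠ 0 := Complex.exp_ne_zero _
  obtain ⟨a₀, ha₀, hi₀, -⟩ := hL.exists_R i 1 (one_pow _)
  refine ⟨r,
  { k_pos := hk
    r_pos := hr0
    finite := ?_
    disjoint := ?_
    cont := fun x hx => hL.sectorRoot_continuousOn h hr hx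
    pow_eq := fun x hx p _ => hL.sectorRoot_pow h hx p.2
    compat := ?_
    inj := ?_
    surj := ?_ }⟩
  · exact ((Admissible.finite_vertices top bot lam).preimage
      Subtype.val_injective.injOn).subset fun x hx => hvert x hx
  · intro x hx y hy p h1 h2
    by_contra hne
    have := hs.vertices x (hvert x hx) y (hvert y hy) fun e => hne (Subtype.ext e)
    have h3 := dist_triangle_left x y p
    rw [← Subtype.dist_eq] at this
    linarith
  · have key : ∀ a ∈ top, ∀ t ∈ Icc (0 : ℝ) 1,
        (∀ x p y q : ℂ, ((x = topLeft top bot lam a ∧ y = botLeft top bot lam a) ∨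
            (x = botLeft top bot lam a ∧ y = topLeft top bot lam a)) →
          InClass top bot lam c c' i x → p = x + t * sideVector top bot lam a →
          q = y + t * sideVector top bot lam a →
          InClass top bot lam c c' i y ∧ q - y = p - x ∧
          sectorRoot top bot lam R Q (k i) y (q - y) =
            sectorRoot top bot lam R Q (k i) x (p - x)) ∧
        (∀ x p y q : ℂ, ((x = topRight top bot lam a ∧ y = botRight top bot lam a) ∨
            (x = botRight top bot lam a ∧ y = topRight top bot lam a)) →
          InClass top bot lam c c' i x → p = x + (t - 1) * sideVector top bot lam a →
          q = y + (t - 1) * sideVector top bot lam a →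
          InClass top bot lam c c' i y ∧ q - y = p - x ∧
          sectorRoot top bot lam R Q (k i) y (q - y) =
            sectorRoot top bot lam R Q (k i) x (p - x)) := by
      intro a ha t ht
      have hv := h.re_pos ha
      constructor
      · rintro x p y q hxy hx rfl rfl
        have hxl : IsLeftEnd top bot lam a x := ⟨ha, hxy.imp (·.1) (·.1)⟩
        have hyl : IsLeftEnd top bot lam a y := ⟨ha, (hxy.imp (·.2) (·.2)).symm⟩
        refine ⟨.inl ⟨a, hyl, hL.class_of_left h hxl hx⟩, by ring, ?_⟩
        rw [add_sub_cancel_left, add_sub_cancel_left, sectorRoot, sectorRoot]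
        have : 0 ≤ ((t : ℂ) * sideVector top bot lam a).re := by
          rw [Complex.re_ofReal_mul]; exact mul_nonneg ht.1 hv.le
        rw [if_pos this, if_pos this, hL.rightLabel_eq h hxl, hL.rightLabel_eq h hyl]
      · rintro x p y q hxy hx rfl rfl
        have hxl : IsRightEnd top bot lam a x := ⟨ha, hxy.imp (·.1) (·.1)⟩
        have hyl : IsRightEnd top bot lam a y := ⟨ha, (hxy.imp (·.2) (·.2)).symm⟩
        refine ⟨.inr ⟨a, hyl, hL.class_of_right h hxl hx⟩, by ring, ?_⟩
        rw [add_sub_cancel_left, add_sub_cancel_left]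
        rcases ht.2.eq_or_lt with rfl | ht1
        · simp [sectorRoot_zero hk]
        · rw [sectorRoot, sectorRoot]
          have : ¬ 0 ≤ (((t : ℂ) - 1) * sideVector top bot lam a).re := by
            rw [← Complex.ofReal_one, ← Complex.ofReal_sub, Complex.re_ofReal_mul, not_le]
            exact mul_neg_of_neg_of_pos (sub_neg.2 ht1) hv
          rw [if_neg this, if_neg this, hL.leftLabel_eq h hxl, hL.leftLabel_eq h hyl]
    rintro x hx p hp q (hpq | hpq)
    · obtain ⟨a, ha, t, ht, e1, e2⟩ := hpq
      change (p : ℂ) = topLeft top bot lam a + _ at e1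
      change (q : ℂ) = botLeft top bot lam a + _ at e2
      have hxe : (x : ℂ) = topLeft top bot lam a ∨ (x : ℂ) = topRight top bot lam a := by
        by_contra hn
        push Not at hn
        have := hs.top_side x (hvert x hx) a ha hn.1 hn.2 t ht
        rw [← e1, ← Subtype.dist_eq] at this
        exact absurd hp (not_lt.2 this)
      rw [hball] at hp
      rcases hxe with hxe | hxe
      · obtain ⟨k1, k2, k3⟩ := (key a ha t ht).1 x p _ q (.inl ⟨hxe, rfl⟩) hx (by rw [e1, hxe]) e2
        exact ⟨⟨_, h.botLeft_mem ha⟩, k1, (hball _ _).2 (by rw [k2]; exact hp), k3⟩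
      · obtain ⟨k1, k2, k3⟩ := (key a ha t ht).2 x p _ q (.inl ⟨hxe, rfl⟩) hx
          (by rw [e1, hxe, topRight]; ring) (by rw [e2, botRight]; ring)
        exact ⟨⟨_, h.botRight_mem ha⟩, k1, (hball _ _).2 (by rw [k2]; exact hp), k3⟩
    · obtain ⟨a, ha, t, ht, e1, e2⟩ := hpq
      change (q : ℂ) = topLeft top bot lam a + _ at e1
      change (p : ℂ) = botLeft top bot lam a + _ at e2
      have hxe : (x : ℂ) = botLeft top bot lam a ∨ (x : ℂ) = botRight top bot lam a := by
        by_contra hn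
        push Not at hn
        have := hs.bot_side x (hvert x hx) a ha hn.1 hn.2 t ht
        rw [← e2, ← Subtype.dist_eq] at this
        exact absurd hp (not_lt.2 this)
      rw [hball] at hp
      rcases hxe with hxe | hxe
      · obtain ⟨k1, k2, k3⟩ := (key a ha t ht).1 x p _ q (.inr ⟨hxe, rfl⟩) hx (by rw [e2, hxe]) e1
        exact ⟨⟨_, h.topLeft_mem ha⟩, k1, (hball _ _).2 (by rw [k2]; exact hp), k3⟩
      · obtain ⟨k1, k2, k3⟩ := (key a ha t ht).2 x p _ q (.inr ⟨hxe, rfl⟩) hx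
          (by rw [e2, hxe, botRight]; ring) (by rw [e1, topRight]; ring)
        exact ⟨⟨_, h.topRight_mem ha⟩, k1, (hball _ _).2 (by rw [k2]; exact hp), k3⟩
  · intro x hx y hy p hp q hq e
    rw [hball] at hp hq
    have hw : (p : ℂ) - x = q - y := by
      have := congrArg (· ^ k i) e
      simpa only [hL.sectorRoot_pow h hx p.2, hL.sectorRoot_pow h hy q.2] using this
    by_cases hne : (p : ℂ) = x
    · have hne' : (q : ℂ) = y := by rw [hne, sub_self] at hw; exact sub_eq_zero.1 hw.symm
      rw [Subtype.ext hne, Subtype.ext hne']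
      exact (hL.mk_eq_of_inClass h hx ha₀ hi₀).trans (hL.mk_eq_of_inClass h hy ha₀ hi₀).symm
    have hw0 : (p : ℂ) - x ≠ 0 := sub_ne_zero.2 hne
    have hne' : (q : ℂ) ≠ y := by rw [hw] at hw0; exact sub_ne_zero.1 hw0
    have ep : (p : ℂ) = x + (p - x) := by ring
    have eq : (q : ℂ) = y + (p - x) := by rw [hw]; ring
    simp only [sectorRoot] at e
    rw [← hw] at e
    split_ifs at e with hre
    · obtain ⟨a, ha, hai⟩ := hL.isLeftEnd_of_re_nonneg h hx p.2 hre hne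
      obtain ⟨b, hb, hbi⟩ := hL.isLeftEnd_of_re_nonneg h hy q.2 (hw ▸ hre) hne'
      have hc : ((p : ℂ) - x) ^ (k i : ℂ)⁻¹ ≠ 0 := by simp [Complex.cpow_eq_zero_iff, hw0]
      rw [hL.rightLabel_eq h ha, hL.rightLabel_eq h hb] at e
      have hRR := mul_right_cancel₀ hc e
      obtain ⟨s, -, hs'⟩ := hL.right_halfPlane h hr (hai ▸ hL.pow_R a ha.1 : R a ^ k i = 1)
        hp hre hw0
      refine (hs' a ha.1 hai rfl p ?_).trans (hs' b hb.1 hbi hRR.symm q ?_).symm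
      · exact ha.2.imp (fun e => by rw [← e, ← ep]) fun e => by rw [← e, ← ep]
      · exact hb.2.imp (fun e => by rw [← e, ← eq]) fun e => by rw [← e, ← eq]
    · have hre' : ((p : ℂ) - x).re ≤ 0 := (not_le.1 hre).le
      obtain ⟨a, ha, hai⟩ := hL.isRightEnd_of_re_nonpos h hx p.2 hre' hne
      obtain ⟨b, hb, hbi⟩ := hL.isRightEnd_of_re_nonpos h hy q.2 (hw ▸ hre') hne'
      have hc : (-((p : ℂ) - x)) ^ (k i : ℂ)⁻¹ ≠ 0 := by
        rw [Ne, Complex.cpow_eq_zero_iff, neg_eq_zero]; exact fun e => hw0 e.1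
      rw [hL.leftLabel_eq h ha, hL.leftLabel_eq h hb] at e
      have hQQ := mul_right_cancel₀ (mul_ne_zero hexp hc) e
      obtain ⟨s, -, hs'⟩ := hL.left_halfPlane h hr (hai ▸ hL.pow_Q h ha.1 : Q a ^ k i = 1)
        hp hre' hw0
      refine (hs' a ha.1 hai rfl p ?_).trans (hs' b hb.1 hbi hQQ.symm q ?_).symm
      · exact ha.2.imp (fun e => by rw [← e, ← ep]) fun e => by rw [← e, ← ep]
      · exact hb.2.imp (fun e => by rw [← e, ← eq]) fun e => by rw [← e, ← eq]
  · intro ζ hζ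
    by_cases hζ0 : ζ = 0
    · refine ⟨⟨_, h.topLeft_mem ha₀⟩, .inl ⟨a₀, ⟨ha₀, .inl rfl⟩, hi₀⟩, ⟨_, h.topLeft_mem ha₀⟩,
        mem_ball_self hr0, ?_⟩
      simp [hζ0, sectorRoot_zero hk]
    set w := ζ ^ k i with hwdef
    have hw0 : w ≠ 0 := pow_ne_zero _ hζ0
    have hw : ‖w‖ < r := by rwa [hwdef, norm_pow]
    by_cases hre : 0 ≤ w.re
    · have hc : w ^ (k i : ℂ)⁻¹ ≠ 0 := by rw [Ne, Complex.cpow_eq_zero_iff]; exact fun e => hw0 e.1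
      have hη : (ζ / w ^ (k i : ℂ)⁻¹) ^ k i = 1 := by
        rw [div_pow, Complex.cpow_nat_inv_pow _ hk.ne', ← hwdef, div_self hw0]
      obtain ⟨s, ⟨a, ha, hai, hR, p, hp, -⟩, -⟩ := hL.right_halfPlane h hr hη hw hre hw0
      have main : ∀ x : ℂ, x ∈ suspensionPolygon top bot lam → IsLeftEnd top bot lam a x →
          (p : ℂ) = x + w → ∃ x ∈ {x : suspensionPolygon top bot lam |
            InClass top bot lam c c' i x}, ∃ p ∈ ball x r,
            sectorRoot top bot lam R Q (k i) x (p - x) = ζ := by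
        intro x hx hxl hpx
        have e : (p : ℂ) - x = w := by rw [hpx]; ring
        refine ⟨⟨x, hx⟩, .inl ⟨a, hxl, hai⟩, p, (hball _ _).2 ?_, ?_⟩
        · change ‖(p : ℂ) - x‖ < r
          rwa [e]
        · change sectorRoot top bot lam R Q (k i) x (p - x) = ζ
          rw [e, sectorRoot, if_pos hre, hL.rightLabel_eq h hxl, hR, div_mul_cancel₀ _ hc]
      rcases hp with hp | hp
      · exact main _ (h.topLeft_mem ha) ⟨ha, .inl rfl⟩ hp
      · exact main _ (h.botLeft_mem ha) ⟨ha, .inr rfl⟩ hp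
    · have hc : Complex.exp (Real.pi * Complex.I * (k i : ℂ)⁻¹) * (-w) ^ (k i : ℂ)⁻¹ ≠ 0 := by
        refine mul_ne_zero hexp ?_
        rw [Ne, Complex.cpow_eq_zero_iff, neg_eq_zero]; exact fun e => hw0 e.1
      have hη : (ζ / (Complex.exp (Real.pi * Complex.I * (k i : ℂ)⁻¹) *
          (-w) ^ (k i : ℂ)⁻¹)) ^ k i = 1 := by
        rw [div_pow, mul_pow, exp_pi_mul_inv_pow hk, Complex.cpow_nat_inv_pow _ hk.ne', ← hwdef,
          neg_one_mul, neg_neg, div_self hw0]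
      obtain ⟨s, ⟨a, ha, hai, hQ, p, hp, -⟩, -⟩ :=
        hL.left_halfPlane h hr hη hw (not_le.1 hre).le hw0
      have main : ∀ x : ℂ, x ∈ suspensionPolygon top bot lam → IsRightEnd top bot lam a x →
          (p : ℂ) = x + w → ∃ x ∈ {x : suspensionPolygon top bot lam |
            InClass top bot lam c c' i x}, ∃ p ∈ ball x r,
            sectorRoot top bot lam R Q (k i) x (p - x) = ζ := by
        intro x hx hxl hpx
        have e : (p : ℂ) - x = w := by rw [hpx]; ring
        refine ⟨⟨x, hx⟩, .inr ⟨a, hxl, hai⟩, p, (hball _ _).2 ?_, ?_⟩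
        · change ‖(p : ℂ) - x‖ < r
          rwa [e]
        · change sectorRoot top bot lam R Q (k i) x (p - x) = ζ
          rw [e, sectorRoot, if_neg hre, hL.leftLabel_eq h hxl, hQ, div_mul_cancel₀ _ hc]
      rcases hp with hp | hp
      · exact main _ (h.topRight_mem ha) ⟨ha, .inl rfl⟩ hp
      · exact main _ (h.botRight_mem ha) ⟨ha, .inr rfl⟩ hp

theorem mk_topLeft_eq_iff (hL : CornerLabels top bot k c c' R Q) (h : Admissible top bot lam)
    {a b : ℕ} (ha : a ∈ top) (hb : b ∈ top) :
    Suspension.mk top bot lam ⟨_, h.topLeft_mem ha⟩ =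
      Suspension.mk top bot lam ⟨_, h.topLeft_mem hb⟩ ↔ c a = c b := by
  refine ⟨fun e => ?_, hL.mk_topLeft_eq h ha hb⟩
  obtain ⟨r, hs⟩ := hL.exists_isStar h (c a)
  obtain ⟨y, hy, hq, e'⟩ := hs.exists_of_mk_eq e
    (x := ⟨_, h.topLeft_mem ha⟩) (.inl ⟨a, ⟨ha, .inl rfl⟩, rfl⟩) (mem_ball_self hs.r_pos)
  have hp := hs.pow_eq y hy _ hq
  rw [e', sub_self, sectorRoot_zero hs.k_pos, zero_pow hs.k_pos.ne'] at hp
  have hyb := sub_eq_zero.1 hp.symm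
  change InClass top bot lam c c' (c a) y at hy
  rw [← hyb] at hy
  exact (hL.class_of_left h ⟨hb, .inl rfl⟩ hy).symm

theorem hasStar_vertex (hL : CornerLabels top bot k c c' R Q) (h : Admissible top bot lam) {a : ℕ}
    (ha : a ∈ top) : HasStar (sideGluing top bot lam)
      (Suspension.mk top bot lam ⟨_, h.topLeft_mem ha⟩) (k (c a)) := by
  obtain ⟨r, hs⟩ := hL.exists_isStar h (c a)
  exact ⟨_, _, r, hs, fun x hx => hL.mk_eq_of_inClass h hx ha rfl⟩

theorem eq_vertex_or_hasStar (hL : CornerLabels top bot k c c' R Q) (h : Admissible top bot lam)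
    (s : Suspension top bot lam) :
    (∃ a, ∃ ha : a ∈ top, s = Suspension.mk top bot lam ⟨_, h.topLeft_mem ha⟩) ∨
      HasStar (sideGluing top bot lam) s 1 := by
  have hside : ∀ a, ∀ ha : a ∈ top, ∀ t, ∀ ht : t ∈ Icc (0 : ℝ) 1,
      (∃ b, ∃ hb : b ∈ top, Suspension.mk top bot lam ⟨_, h.top_side_mem ha ht⟩ =
        Suspension.mk top bot lam ⟨_, h.topLeft_mem hb⟩) ∨
      HasStar (sideGluing top bot lam)
        (Suspension.mk top bot lam ⟨_, h.top_side_mem ha ht⟩) 1 := by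
    intro a ha t ht
    rcases ht.1.eq_or_lt with rfl | h0
    · exact .inl ⟨a, ha, mk_congr _ _ (by simp)⟩
    rcases ht.2.eq_or_lt with rfl | h1
    · obtain ⟨y, hy, -, -, e⟩ := hL.mk_right_eq_mk_left h ha
      exact .inl ⟨y, hy, (mk_congr _ _ (by simp [topRight])).trans e⟩
    · exact .inr (h.hasStar_side ha h0 h1)
  obtain ⟨p, rfl⟩ := Quot.exists_rep s
  by_cases ht : (p : ℂ) ∈ brokenLine top (sideVector top bot lam)
  · obtain ⟨a, ha, t, ht, e⟩ := h.mem_top_line.1 ht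
    have := hside a ha t ht
    rwa [← mk_congr p.2 (h.top_side_mem ha ht) e] at this
  by_cases hb : (p : ℂ) ∈ brokenLine bot (sideVector top bot lam)
  · obtain ⟨a, ha, t, ht, e⟩ := h.mem_bot_line.1 hb
    have := hside a ha t ht
    have e' : Suspension.mk top bot lam ⟨_, h.top_side_mem ha ht⟩ = Suspension.mk top bot lam p :=
      Quot.sound ⟨a, ha, t, ht, rfl, e⟩
    rwa [e'] at this
  · exact .inr (h.hasStar_interior ht hb)

end CornerLabels

/-- A permutation with a labelling of the corners represents a stratum. -/
theorem representsStratum_of_cornerLabels {m : ℕ} {d : Fin (m + 1) → ℕ}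
    {c c' : ℕ → Fin (m + 1)} (hp : IsTruePermutation top bot)
    (hi : IsIrreduciblePermutation top bot) (h2 : 2 ≤ top.length)
    (hL : CornerLabels top bot (fun i => d i + 1) c c' R Q)
    (hfirst : ∀ a ∈ top, top.idxOf a = 0 → c a = 0)
    (hlast : ∀ a ∈ top, top.idxOf a + 1 = top.length → c' a = Fin.last m) :
    RepresentsStratum top bot d := by
  classical
  refine ⟨hp, hi, fun lam hpos => ?_⟩
  have h : Admissible top bot lam := ⟨hp, hi, h2, hpos⟩
  let kk : Suspension top bot lam → ℕ := fun s =>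
    if hs : ∃ a, ∃ ha : a ∈ top, s = Suspension.mk top bot lam ⟨_, h.topLeft_mem ha⟩ then
      d (c hs.choose) + 1 else 1
  have hkk : ∀ a, ∀ ha : a ∈ top,
      kk (Suspension.mk top bot lam ⟨_, h.topLeft_mem ha⟩) = d (c a) + 1 := by
    intro a ha
    have hs : ∃ b, ∃ hb : b ∈ top, Suspension.mk top bot lam ⟨_, h.topLeft_mem ha⟩ =
        Suspension.mk top bot lam ⟨_, h.topLeft_mem hb⟩ := ⟨a, ha, rfl⟩
    simp only [kk]
    rw [dif_pos hs]
    obtain ⟨hb, e⟩ := hs.choose_spec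
    rw [(hL.mk_topLeft_eq_iff h ha hb).1 e]
  have hstar : ∀ s, HasStar (sideGluing top bot lam) s (kk s) := by
    intro s
    by_cases hs : ∃ a, ∃ ha : a ∈ top, s = Suspension.mk top bot lam ⟨_, h.topLeft_mem ha⟩
    · obtain ⟨a, ha, rfl⟩ := hs
      rw [hkk a ha]
      exact hL.hasStar_vertex h ha
    · simp only [kk]
      rw [dif_neg hs]
      exact (hL.eq_vertex_or_hasStar h s).resolve_left hs
  have : CompactSpace (suspensionPolygon top bot lam) :=
    isCompact_iff_compactSpace.1 h.isCompact_polygon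
  have : ConnectedSpace (suspensionPolygon top bot lam) :=
    isConnected_iff_connectedSpace.1 h.isConnected_polygon
  obtain ⟨cs, im, η, hη, hord⟩ := exists_structure hstar
  choose a ha hai _ using fun i => hL.exists_R i 1 (one_pow _)
  have hz : ∀ i, ∀ b, ∀ hb : b ∈ top, c b = i →
      Suspension.mk top bot lam ⟨_, h.topLeft_mem hb⟩ =
        Suspension.mk top bot lam ⟨_, h.topLeft_mem (ha i)⟩ := fun i b hb e =>
    hL.mk_topLeft_eq h hb (ha i) (e.trans (hai i).symm)
  refine ⟨cs, im, η, hη, fun i => Suspension.mk top bot lam ⟨_, h.topLeft_mem (ha i)⟩,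
    ⟨inferInstance, ?_, t2Space_of_hasStar hstar, ?_, ?_, ?_⟩, ?_, ?_⟩
  · exact Quot.mk_surjective.connectedSpace continuous_quot_mk
  · intro i j e
    have := (hL.mk_topLeft_eq_iff h (ha i) (ha j)).1 e
    rwa [hai, hai] at this
  · intro i
    rw [hord, hkk _ (ha i), hai]
    simp
  · intro s hs
    have hn : ¬ ∃ a, ∃ ha : a ∈ top, s = Suspension.mk top bot lam ⟨_, h.topLeft_mem ha⟩ := by
      rintro ⟨b, hb, rfl⟩
      exact hs ⟨c b, (hz (c b) b hb rfl).symm⟩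
    rw [hord]
    simp only [kk]
    rw [dif_neg hn]
    simp
  · obtain ⟨b, hb, hb0⟩ := h.exists_top (j := 0) (by omega)
    have e := h.topLeft_first hb0
    have h0 := h.topLeft_mem hb
    rw [e] at h0
    exact ⟨h0, (CornerLabels.mk_congr h0 (h.topLeft_mem hb) e.symm).trans
      (hz 0 b hb (hfirst b hb hb0))⟩
  · obtain ⟨b, hb, hb0⟩ := h.exists_top (j := top.length - 1) (by omega)
    have hb1 : top.idxOf b + 1 = top.length := by omega
    have e := h.topRight_last hb hb1
    have h0 := h.topRight_mem hb
    rw [e] at h0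
    obtain ⟨y, hy, e1, -, e3⟩ := hL.mk_right_eq_mk_left h hb
    exact ⟨h0, (CornerLabels.mk_congr h0 (h.topRight_mem hb) e.symm).trans
      (e3.trans (hz _ y hy (e1.trans (hlast b hb hb1))))⟩

end Polygon

/-! ### The explicit permutation -/

namespace PrincipalPermutation

/-! #### Words sorted by a key -/

section Key

variable {l : List ℕ} {f : ℕ → ℕ}

theorem idxOf_lt_idxOf_iff (hl : l.Pairwise fun a b => f a < f b) {a b : ℕ} (ha : a ∈ l)
    (hb : b ∈ l) : l.idxOf a < l.idxOf b ↔ f a < f b := by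
  have key : ∀ a ∈ l, ∀ b ∈ l, l.idxOf a < l.idxOf b → f a < f b := by
    intro a ha b hb h
    have := List.pairwise_iff_getElem.1 hl _ _ (List.idxOf_lt_length_of_mem ha)
      (List.idxOf_lt_length_of_mem hb) h
    simpa using this
  refine ⟨key a ha b hb, fun h => ?_⟩
  rcases lt_trichotomy (l.idxOf a) (l.idxOf b) with h1 | h1 | h1
  · exact h1
  · rw [(List.idxOf_inj ha).1 h1] at h
    exact absurd h (lt_irrefl _)
  · exact absurd h (key b hb a ha h1).not_gt

theorem key_of_idxOf_succ (hl : l.Pairwise fun a b => f a < f b) {a b : ℕ} (ha : a ∈ l)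
    (hb : b ∈ l) (h : l.idxOf b = l.idxOf a + 1) :
    f a < f b ∧ ∀ z ∈ l, f a < f z → f b ≤ f z := by
  refine ⟨(idxOf_lt_idxOf_iff hl ha hb).1 (by omega), fun z hz h1 => ?_⟩
  by_contra h2
  have h3 := (idxOf_lt_idxOf_iff hl ha hz).2 h1
  have h4 := (idxOf_lt_idxOf_iff hl hz hb).2 (not_le.1 h2)
  omega

theorem key_of_idxOf_zero (hl : l.Pairwise fun a b => f a < f b) {a : ℕ} (ha : a ∈ l)
    (h : l.idxOf a = 0) : ∀ z ∈ l, f a ≤ f z := by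
  intro z hz
  by_contra h2
  have := (idxOf_lt_idxOf_iff hl hz ha).2 (not_le.1 h2)
  omega

theorem key_of_idxOf_last (hl : l.Pairwise fun a b => f a < f b) {a : ℕ} (ha : a ∈ l)
    (h : l.idxOf a + 1 = l.length) : ∀ z ∈ l, f z ≤ f a := by
  intro z hz
  by_contra h2
  have := (idxOf_lt_idxOf_iff hl ha hz).2 (not_le.1 h2)
  have := List.idxOf_lt_length_of_mem hz
  omega

theorem nodup_of_key (hl : l.Pairwise fun a b => f a < f b) : l.Nodup :=
  hl.imp fun h e => by rw [e] at h; exact lt_irrefl _ h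

end Key

/-! #### The order of the bottom line -/

/-- The position of a symbol in the bottom line, up to a shift. -/
def botKey (g a : ℕ) : ℕ :=
  if a = 0 then 4 * g - 2 else if a = 1 then 4 * g - 3 else if a % 4 = 0 then a - 2
  else if a % 4 = 2 then a + 2 else a

theorem mem_principalBot {g a : ℕ} (hg : 2 ≤ g) : a ∈ principalBot g ↔ a < 4 * g - 3 := by
  simp only [principalBot, List.mem_append, List.mem_cons, List.not_mem_nil, or_false,
    List.mem_flatMap, List.mem_range]
  constructor
  · rintro ((h | ⟨j, hj, h⟩) | h) <;> omega
  · intro h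
    by_cases h1 : a < 5
    · omega
    · refine .inl (.inr ⟨(a - 5) / 4, by omega, by omega⟩)

theorem pairwise_principalBot {g : ℕ} (hg : 2 ≤ g) :
    (principalBot g).Pairwise fun a b => botKey g a < botKey g b := by
  have hk : ∀ j, j < g - 2 → botKey g (4 * j + 5) = 4 * j + 5 ∧ botKey g (4 * j + 8) = 4 * j + 6 ∧
      botKey g (4 * j + 7) = 4 * j + 7 ∧ botKey g (4 * j + 6) = 4 * j + 8 := by
    intro j hj
    refine ⟨?_, ?_, ?_, ?_⟩ <;> unfold botKey <;> split_ifs <;> first | contradiction | omega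
  have k4 : botKey g 4 = 2 := by simp [botKey]
  have k3 : botKey g 3 = 3 := by simp [botKey]
  have k2 : botKey g 2 = 4 := by simp [botKey]
  have k1 : botKey g 1 = 4 * g - 3 := by simp [botKey]
  have k0 : botKey g 0 = 4 * g - 2 := by simp [botKey]
  have hmem : ∀ x ∈ (List.range (g - 2)).flatMap
      (fun j => [4 * j + 5, 4 * j + 8, 4 * j + 7, 4 * j + 6]),
      5 ≤ botKey g x ∧ botKey g x < 4 * g - 3 := by
    intro x hx
    obtain ⟨j, hj, hx⟩ := List.mem_flatMap.1 hx
    rw [List.mem_range] at hj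
    have := hk j hj
    simp only [List.mem_cons, List.not_mem_nil, or_false] at hx
    rcases hx with rfl | rfl | rfl | rfl <;> omega
  rw [principalBot, List.pairwise_append, List.pairwise_append, List.pairwise_flatMap]
  refine ⟨⟨by simp [k4, k3, k2], ⟨?_, ?_⟩, ?_⟩, ?_, ?_⟩
  · intro j hj
    rw [List.mem_range] at hj
    have := hk j hj
    simp only [List.pairwise_cons, List.mem_cons, List.not_mem_nil, or_false]
    refine ⟨?_, ?_, ?_, by simp⟩
    · rintro x (rfl | rfl | rfl) <;> omega
    · rintro x (rfl | rfl) <;> omega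
    · rintro x rfl; omega
  · refine (List.pairwise_lt_range (n := g - 2)).imp_of_mem fun {i j} hi hj hij x hx y hy => ?_
    rw [List.mem_range] at hi hj
    have h1 := hk i hi
    have h2 := hk j hj
    simp only [List.mem_cons, List.not_mem_nil, or_false] at hx hy
    rcases hx with rfl | rfl | rfl | rfl <;> rcases hy with rfl | rfl | rfl | rfl <;> omega
  · intro x hx y hy
    have := hmem y hy
    simp only [List.mem_cons, List.not_mem_nil, or_false] at hx
    rcases hx with rfl | rfl | rfl <;> omega
  · simp only [List.pairwise_cons, List.mem_cons, List.not_mem_nil, or_false]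
    exact ⟨by rintro x rfl; omega, by simp⟩
  · intro x hx y hy
    simp only [List.mem_cons, List.not_mem_nil, or_false] at hy
    rw [List.mem_append] at hx
    have : botKey g x < 4 * g - 3 := by
      rcases hx with hx | hx
      · simp only [List.mem_cons, List.not_mem_nil, or_false] at hx
        rcases hx with rfl | rfl | rfl <;> omega
      · exact (hmem x hx).2
    rcases hy with rfl | rfl <;> omega

/-! #### Blocks -/

/-- The decomposition of `1, …, n` into consecutive blocks of lengths `d i`, the `i`-th one following
`D i`; the number `e` belongs to the block `blk e`. -/
structure Blocks {m : ℕ} (d D : Fin (m + 1) → ℕ) (blk : ℕ → Fin (m + 1)) (n : ℕ) : Prop where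
  lt : ∀ e, 1 ≤ e → e ≤ n → D (blk e) < e
  le : ∀ e, 1 ≤ e → e ≤ n → e ≤ D (blk e) + d (blk e)
  uniq : ∀ i e, D i < e → e ≤ D i + d i → blk e = i
  succ : ∀ i, D i + d i < n → D (blk (D i + d i + 1)) = D i + d i
  pred : ∀ i, 0 < D i → ∃ j, D j + d j = D i
  le_n : ∀ i, D i + d i ≤ n
  first : blk 1 = 0
  last : blk n = Fin.last m
  last_add : D (Fin.last m) + d (Fin.last m) = n

theorem exists_blocks {m : ℕ} {d : Fin (m + 1) → ℕ} (hd : ∀ i, 0 < d i) :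
    ∃ blk, Blocks d (fun i => ∑ j ∈ Finset.Iio i, d j) blk (∑ i, d i) := by
  classical
  set D : Fin (m + 1) → ℕ := fun i => ∑ j ∈ Finset.Iio i, d j with hD
  have hsucc : ∀ i j : Fin (m + 1), j.val = i.val + 1 → D j = D i + d i := by
    intro i j hij
    have : Finset.Iio j = insert i (Finset.Iio i) := by
      ext x
      simp only [Finset.mem_Iio, Finset.mem_insert, Fin.lt_def, Fin.ext_iff]
      omega
    simp only [hD]
    rw [this, Finset.sum_insert (by simp), add_comm]
  have hlast : D (Fin.last m) + d (Fin.last m) = ∑ i, d i := by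
    have : (Finset.univ : Finset (Fin (m + 1))) = insert (Fin.last m) (Finset.Iio (Fin.last m)) := by
      ext x
      simp only [Finset.mem_Iio, Finset.mem_insert, Finset.mem_univ, true_iff]
      exact (Fin.le_last x).eq_or_lt
    rw [this, Finset.sum_insert (by simp), add_comm]
  have h0 : D 0 = 0 := by
    simp only [hD]
    rw [show Finset.Iio (0 : Fin (m + 1)) = ∅ from by ext x; simp]
    simp
  have hmono : ∀ i j : Fin (m + 1), i < j → D i + d i ≤ D j := by
    intro i j hij
    simp only [hD]
    rw [add_comm, ← Finset.sum_insert (by simp)]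
    refine Finset.sum_le_sum_of_subset fun x hx => ?_
    rcases Finset.mem_insert.1 hx with rfl | hx
    · exact Finset.mem_Iio.2 hij
    · exact Finset.mem_Iio.2 ((Finset.mem_Iio.1 hx).trans hij)
  have hle : ∀ i, D i + d i ≤ ∑ i, d i := by
    intro i
    rcases (Fin.le_last i).eq_or_lt with rfl | h
    · exact hlast.le
    · have := hmono i _ h
      omega
  have hpred : ∀ i, 0 < D i → ∃ j, j < i ∧ D j + d j = D i := by
    intro i hi
    have hi0 : i.val ≠ 0 := by
      intro e
      have : i = 0 := Fin.ext (by simpa using e)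
      rw [this, h0] at hi
      exact lt_irrefl _ hi
    refine ⟨⟨i.val - 1, by omega⟩, Fin.lt_def.2 (by dsimp only; omega), ?_⟩
    exact (hsucc _ _ (by dsimp only; omega)).symm
  have hex : ∀ i e, 1 ≤ e → e ≤ D i + d i → ∃ j, D j < e ∧ e ≤ D j + d j := by
    intro i
    induction i using WellFoundedLT.induction with
    | ind i ih =>
      intro e he hei
      by_cases h : D i < e
      · exact ⟨i, h, hei⟩
      · obtain ⟨j, hj, hji⟩ := hpred i (by omega)
        exact ih j hj e he (by omega)
  have huniq : ∀ i j e, D i < e → e ≤ D i + d i → D j < e → e ≤ D j + d j → i = j := by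
    intro i j e h1 h2 h3 h4
    rcases lt_trichotomy i j with h | h | h
    · have := hmono i j h; omega
    · exact h
    · have := hmono j i h; omega
  let blk : ℕ → Fin (m + 1) := fun e =>
    if h : ∃ j, D j < e ∧ e ≤ D j + d j then h.choose else 0
  have hblk : ∀ i e, D i < e → e ≤ D i + d i → blk e = i := by
    intro i e h1 h2
    have h : ∃ j, D j < e ∧ e ≤ D j + d j := ⟨i, h1, h2⟩
    simp only [blk]
    rw [dif_pos h]
    exact huniq _ _ e h.choose_spec.1 h.choose_spec.2 h1 h2
  have hspec : ∀ e, 1 ≤ e → e ≤ ∑ i, d i → D (blk e) < e ∧ e ≤ D (blk e) + d (blk e) := by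
    intro e h1 h2
    obtain ⟨j, hj⟩ := hex (Fin.last m) e h1 (by omega)
    rw [hblk j e hj.1 hj.2]
    exact hj
  refine ⟨blk, fun e h1 h2 => (hspec e h1 h2).1, fun e h1 h2 => (hspec e h1 h2).2, hblk, ?_, ?_, hle,
    ?_, ?_, hlast⟩
  · intro i hi
    have hne : i.val ≠ m := by
      intro e
      have : i = Fin.last m := Fin.ext e
      rw [this] at hi; omega
    have hs := hsucc i ⟨i.val + 1, by omega⟩ rfl
    have := hd ⟨i.val + 1, by omega⟩
    rw [hblk ⟨i.val + 1, by omega⟩ (D i + d i + 1) (by omega) (by omega), hs]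
  · intro i hi
    obtain ⟨j, -, hj⟩ := hpred i hi
    exact ⟨j, hj⟩
  · have := hd 0
    exact hblk 0 1 (by omega) (by omega)
  · have := hd (Fin.last m)
    exact hblk _ _ (by omega) (by omega)

theorem mem_erasedSymbols {k : ℕ} {d : Fin k → ℕ} {a : ℕ} : a ∈ erasedSymbols d ↔
    ∃ i, ∃ r, 1 ≤ r ∧ r < d i ∧ a = 2 * (∑ j ∈ Finset.Iio i, d j) + 2 * r + 1 := by
  simp only [erasedSymbols, Finset.mem_biUnion, Finset.mem_univ, true_and, Finset.mem_image,
    Finset.mem_Ico]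
  constructor
  · rintro ⟨i, r, ⟨h1, h2⟩, rfl⟩; exact ⟨i, r, h1, h2, rfl⟩
  · rintro ⟨i, r, h1, h2, rfl⟩; exact ⟨i, r, ⟨h1, h2⟩, rfl⟩

theorem even_notMem_erasedSymbols {k : ℕ} {d : Fin k → ℕ} (e : ℕ) : 2 * e ∉ erasedSymbols d := by
  rw [mem_erasedSymbols]
  rintro ⟨i, r, -, -, h⟩
  omega

theorem one_notMem_erasedSymbols {k : ℕ} {d : Fin k → ℕ} : 1 ∉ erasedSymbols d := by
  rw [mem_erasedSymbols]
  rintro ⟨i, r, h1, -, h⟩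
  omega

theorem odd_notMem_erasedSymbols {m n : ℕ} {d : Fin (m + 1) → ℕ} {blk : ℕ → Fin (m + 1)}
    (hB : Blocks d (fun i => ∑ j ∈ Finset.Iio i, d j) blk n) {e : ℕ} (h1 : 1 ≤ e) (hn : e ≤ n) :
    2 * e + 1 ∉ erasedSymbols d ↔ e = (∑ j ∈ Finset.Iio (blk e), d j) + d (blk e) := by
  have hlt := hB.lt e h1 hn
  have hle := hB.le e h1 hn
  beta_reduce at hlt hle
  rw [mem_erasedSymbols]
  constructor
  · intro h
    by_contra hne
    exact h ⟨blk e, e - ∑ j ∈ Finset.Iio (blk e), d j, by omega, by omega, by omega⟩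
  · rintro h ⟨i, r, hr1, hr2, he⟩
    have : blk e = i := hB.uniq i e (by omega) (by omega)
    rw [this] at h
    omega

/-! #### Labels -/

/-- The number whose block is the class of the left end of the side `a`. -/
def leftIdx (g a : ℕ) : ℕ :=
  if a = 0 then 1 else if a = 1 then 2 * g - 2 else if a % 4 = 0 then a / 2 - 1
  else if a % 4 = 1 then a / 2 else if a % 4 = 2 then a / 2 else a / 2 + 1

/-- The position in its class of the right half-plane at the left end of the side `a`. -/
def leftLev (g D a : ℕ) : ℤ :=
  if a = 0 then D else if a = 1 then D - (g - 1) else if a % 4 = 0 then D + 1 - (a / 4 : ℕ)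
  else if a % 4 = 1 then D - (a / 4 : ℕ) else (a / 4 : ℕ) + 1

/-- The number whose block is the class of the right end of the side `a`. -/
def rightIdx (g a : ℕ) : ℕ :=
  if a = 0 then 2 * g - 2 else if a % 4 = 0 then a / 2 else if a % 4 = 3 then a / 2 else a / 2 + 1

/-- The position in its class of the left half-plane at the right end of the side `a`. -/
def rightLev (g D a : ℕ) : ℤ :=
  if a = 0 then g - 1 else if a % 4 = 0 then (a / 4 : ℕ) else if a % 4 = 1 then D - (a / 4 : ℕ)
  else if a % 4 = 2 then D - ((a / 4 : ℕ) + 1) else (a / 4 : ℕ) + 1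

section Values

variable (g D k : ℕ)

theorem left_zero : leftIdx g 0 = 1 ∧ leftLev g D 0 = D := by simp [leftIdx, leftLev]

theorem left_one : leftIdx g 1 = 2 * g - 2 ∧ leftLev g D 1 = D - (g - 1) := by
  simp [leftIdx, leftLev]

theorem left_four : leftIdx g (4 * k + 4) = 2 * k + 1 ∧ leftLev g D (4 * k + 4) = D - k := by
  unfold leftIdx leftLev
  constructor <;> split_ifs <;> first | contradiction | omega

theorem left_five : leftIdx g (4 * k + 5) = 2 * k + 2 ∧ leftLev g D (4 * k + 5) = D - (k + 1) := by
  unfold leftIdx leftLev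
  constructor <;> split_ifs <;> first | contradiction | omega

theorem left_two : leftIdx g (4 * k + 2) = 2 * k + 1 ∧ leftLev g D (4 * k + 2) = k + 1 := by
  unfold leftIdx leftLev
  constructor <;> split_ifs <;> first | contradiction | omega

theorem left_three : leftIdx g (4 * k + 3) = 2 * k + 2 ∧ leftLev g D (4 * k + 3) = k + 1 := by
  unfold leftIdx leftLev
  constructor <;> split_ifs <;> first | contradiction | omega

theorem right_zero : rightIdx g 0 = 2 * g - 2 ∧ rightLev g D 0 = g - 1 := by
  simp [rightIdx, rightLev]

theorem right_four : rightIdx g (4 * k + 4) = 2 * k + 2 ∧ rightLev g D (4 * k + 4) = k + 1 := by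
  unfold rightIdx rightLev
  constructor <;> split_ifs <;> first | contradiction | omega

theorem right_one : rightIdx g (4 * k + 1) = 2 * k + 1 ∧ rightLev g D (4 * k + 1) = D - k := by
  unfold rightIdx rightLev
  constructor <;> split_ifs <;> first | contradiction | omega

theorem right_two : rightIdx g (4 * k + 2) = 2 * k + 2 ∧
    rightLev g D (4 * k + 2) = D - (k + 1) := by
  unfold rightIdx rightLev
  constructor <;> split_ifs <;> first | contradiction | omega

theorem right_three : rightIdx g (4 * k + 3) = 2 * k + 1 ∧ rightLev g D (4 * k + 3) = k + 1 := by
  unfold rightIdx rightLev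
  constructor <;> split_ifs <;> first | contradiction | omega

end Values

end PrincipalPermutation

namespace PrincipalPermutation

/-! #### Labels by levels -/

theorem cornerLabels_of_levels {ι : Type*} {top bot : List ℕ} {d : ι → ℕ} {c c' : ℕ → ι}
    {lev lev' : ℕ → ℤ}
    (first : ∀ a ∈ top, ∀ b ∈ top, top.idxOf a = 0 → bot.idxOf b = 0 →
      c a = c b ∧ lev a = lev b)
    (last : ∀ a ∈ top, ∀ b ∈ top, top.idxOf a + 1 = top.length → bot.idxOf b + 1 = top.length →
      c' a = c' b ∧ lev' a = lev' b)
    (top_next : ∀ x ∈ top, ∀ y ∈ top, top.idxOf y = top.idxOf x + 1 →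
      c y = c' x ∧ ((d (c' x) + 1 : ℕ) : ℤ) ∣ lev y - (lev' x + 1))
    (bot_next : ∀ x ∈ top, ∀ y ∈ top, bot.idxOf y = bot.idxOf x + 1 →
      c y = c' x ∧ lev y = lev' x)
    (exists_lev : ∀ i, ∀ n : ℤ, ∃ a ∈ top, c a = i ∧ ((d i + 1 : ℕ) : ℤ) ∣ lev a - n)
    (inj_lev : ∀ a ∈ top, ∀ b ∈ top, top.idxOf a ≠ 0 → top.idxOf b ≠ 0 → c a = c b →
      ((d (c a) + 1 : ℕ) : ℤ) ∣ lev a - lev b → a = b) :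
    ∃ R Q, Polygon.CornerLabels top bot (fun i => d i + 1) c c' R Q := by
  set ζ : ι → ℂ := fun i => Complex.exp (2 * Real.pi * Complex.I / ((d i + 1 : ℕ) : ℂ)) with hζ
  have hprim : ∀ i, IsPrimitiveRoot (ζ i) (d i + 1) := fun i =>
    Complex.isPrimitiveRoot_exp (d i + 1) (Nat.succ_ne_zero _)
  have h0 : ∀ i, ζ i ≠ 0 := fun i => Complex.exp_ne_zero _
  have hdvd : ∀ i, ∀ p q : ℤ, ζ i ^ p = ζ i ^ q ↔ ((d i + 1 : ℕ) : ℤ) ∣ p - q := by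
    intro i p q
    rw [← (hprim i).zpow_eq_one_iff_dvd, zpow_sub₀ (h0 i), div_eq_one_iff_eq (zpow_ne_zero _ (h0 i))]
  refine ⟨fun a => ζ (c a) ^ lev a, fun a => ζ (c' a) ^ lev' a, fun i => Nat.succ_pos _, ?_, ?_, ?_,
    ?_, ?_, ?_, ?_⟩
  · intro a _
    rw [← zpow_natCast, ← zpow_mul, mul_comm, zpow_mul, zpow_natCast, (hprim _).pow_eq_one,
      one_zpow]
  · intro a ha b hb h1 h2
    obtain ⟨e1, e2⟩ := first a ha b hb h1 h2
    exact ⟨e1, by simp only [e1, e2]⟩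
  · intro a ha b hb h1 h2
    obtain ⟨e1, e2⟩ := last a ha b hb h1 h2
    exact ⟨e1, by simp only [e1, e2]⟩
  · intro x hx y hy h
    obtain ⟨e1, e2⟩ := top_next x hx y hy h
    refine ⟨e1, ?_⟩
    simp only [e1]
    rw [(hdvd _ _ _).2 e2, zpow_add₀ (h0 _), zpow_one, mul_comm]
  · intro x hx y hy h
    obtain ⟨e1, e2⟩ := bot_next x hx y hy h
    exact ⟨e1, by simp only [e1, e2]⟩
  · intro i η hη
    obtain ⟨n, -, rfl⟩ := (hprim i).eq_pow_of_pow_eq_one hη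
    obtain ⟨a, ha, e1, e2⟩ := exists_lev i n
    refine ⟨a, ha, e1, ?_⟩
    simp only [e1]
    rw [(hdvd _ _ _).2 e2, zpow_natCast]
  · intro a ha b hb h1 h2 e h
    simp only [← e] at h
    exact inj_lev a ha b hb h1 h2 e ((hdvd _ _ _).1 h)

/-! #### The kept symbols -/

/-- The symbol `a` occurs in the permutation after the odd symbols which do not end a block have
been erased. -/
def IsKept {m : ℕ} (g : ℕ) (d D : Fin (m + 1) → ℕ) (blk : ℕ → Fin (m + 1)) (a : ℕ) : Prop :=
  a < 4 * g - 3 ∧ (a % 2 = 0 ∨ a = 1 ∨ D (blk (a / 2)) + d (blk (a / 2)) = a / 2)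

section Kept

variable {g m : ℕ} {d D : Fin (m + 1) → ℕ} {blk : ℕ → Fin (m + 1)}

theorem isKept_even {e : ℕ} : IsKept g d D blk (2 * e) ↔ 2 * e < 4 * g - 3 :=
  ⟨fun h => h.1, fun h => ⟨h, .inl (by omega)⟩⟩

theorem isKept_odd {e : ℕ} (he : 1 ≤ e) : IsKept g d D blk (2 * e + 1) ↔
    2 * e + 1 < 4 * g - 3 ∧ D (blk e) + d (blk e) = e := by
  rw [IsKept, show (2 * e + 1) / 2 = e by omega]
  constructor
  · rintro ⟨h1, h2 | h2 | h2⟩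
    · omega
    · omega
    · exact ⟨h1, h2⟩
  · exact fun h => ⟨h.1, .inr (.inr h.2)⟩

theorem isKept_zero (hg : 2 ≤ g) : IsKept g d D blk 0 := ⟨by omega, .inl rfl⟩

theorem isKept_one (hg : 2 ≤ g) : IsKept g d D blk 1 := ⟨by omega, .inr (.inl rfl)⟩

/-- A symbol other than `0` and `1` is one of `4 * k + 2`, …, `4 * k + 5`. -/
theorem IsKept.cases {a : ℕ} (ha : IsKept g d D blk a) :
    a = 0 ∨ a = 1 ∨ ∃ k, k + 2 ≤ g ∧ (a = 4 * k + 4 ∨ a = 4 * k + 2 ∨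
      (a = 4 * k + 3 ∧ D (blk (2 * k + 1)) + d (blk (2 * k + 1)) = 2 * k + 1) ∨
      (a = 4 * k + 5 ∧ k + 3 ≤ g ∧ D (blk (2 * k + 2)) + d (blk (2 * k + 2)) = 2 * k + 2)) := by
  obtain ⟨h1, h2⟩ := ha
  by_cases h0 : a = 0
  · exact .inl h0
  by_cases h1 : a = 1
  · exact .inr (.inl h1)
  have h3 : a % 2 = 1 → D (blk (a / 2)) + d (blk (a / 2)) = a / 2 := by omega
  refine .inr (.inr ⟨(a - 2) / 4, by omega, ?_⟩)
  have h4 : a % 4 = 0 ∨ a % 4 = 1 ∨ a % 4 = 2 ∨ a % 4 = 3 := by omega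
  rcases h4 with h4 | h4 | h4 | h4
  · exact .inl (by omega)
  · have := h3 (by omega)
    rw [show a / 2 = 2 * ((a - 2) / 4) + 2 by omega] at this
    exact .inr (.inr (.inr ⟨by omega, by omega, this⟩))
  · exact .inr (.inl (by omega))
  · have := h3 (by omega)
    rw [show a / 2 = 2 * ((a - 2) / 4) + 1 by omega] at this
    exact .inr (.inr (.inl ⟨by omega, this⟩))

theorem isKept_four {k : ℕ} (hk : k + 2 ≤ g) : IsKept g d D blk (4 * k + 4) := by
  rw [show 4 * k + 4 = 2 * (2 * k + 2) by ring, isKept_even]; omega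

theorem isKept_two {k : ℕ} (hk : k + 2 ≤ g) : IsKept g d D blk (4 * k + 2) := by
  rw [show 4 * k + 2 = 2 * (2 * k + 1) by ring, isKept_even]; omega

theorem isKept_three {k : ℕ} (hk : k + 2 ≤ g)
    (h : D (blk (2 * k + 1)) + d (blk (2 * k + 1)) = 2 * k + 1) :
    IsKept g d D blk (4 * k + 3) := by
  rw [show 4 * k + 3 = 2 * (2 * k + 1) + 1 by ring, isKept_odd (by omega)]
  exact ⟨by omega, h⟩

theorem isKept_five {k : ℕ} (hk : k + 3 ≤ g)
    (h : D (blk (2 * k + 2)) + d (blk (2 * k + 2)) = 2 * k + 2) :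
    IsKept g d D blk (4 * k + 5) := by
  rw [show 4 * k + 5 = 2 * (2 * k + 2) + 1 by ring, isKept_odd (by omega)]
  exact ⟨by omega, h⟩

theorem Blocks.blk_succ {n : ℕ} (hB : Blocks d D blk n) {e : ℕ} (h1 : 1 ≤ e) (hn : e ≤ n)
    (h : D (blk e) + d (blk e) ≠ e) : blk (e + 1) = blk e := by
  have := hB.lt e h1 hn
  have := hB.le e h1 hn
  exact hB.uniq _ _ (by omega) (by omega)

theorem Blocks.start_blk_succ {n : ℕ} (hB : Blocks d D blk n) {e : ℕ} (hn : e < n)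
    (h : D (blk e) + d (blk e) = e) : D (blk (e + 1)) = e := by
  have := hB.succ (blk e) (by omega)
  rwa [h] at this

theorem top_next (hB : Blocks d D blk (2 * g - 2)) (hg : 2 ≤ g) {x y : ℕ}
    (hx : IsKept g d D blk x) (hy : IsKept g d D blk y) (hxy : x < y)
    (hn : ∀ z, IsKept g d D blk z → x < z → y ≤ z) :
    blk (leftIdx g y) = blk (rightIdx g x) ∧
    ((d (blk (rightIdx g x)) + 1 : ℕ) : ℤ) ∣ leftLev g (D (blk (leftIdx g y))) y -
      (rightLev g (D (blk (rightIdx g x))) x + 1) := by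
  have hlast := hB.last_add
  have hbl := hB.last
  rcases hx.cases with rfl | rfl | ⟨k, hk, rfl | rfl | ⟨rfl, hb⟩ | ⟨rfl, hk', hb⟩⟩
  · obtain rfl : y = 1 := le_antisymm (hn 1 (isKept_one hg) one_pos) hxy
    rw [(left_one g 0).1, (right_zero g 0).1, (left_one g _).2, (right_zero g _).2, hbl]
    exact ⟨rfl, -1, by omega⟩
  · obtain rfl : y = 2 := le_antisymm (hn 2 (isKept_two (k := 0) hg) (by omega)) (by omega)
    have h0 : D (blk 1) = 0 := by
      have := hB.lt 1 le_rfl (by omega)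
      omega
    rw [(left_two g 0 0).1, (right_one g 0 0).1, (left_two g _ 0).2, (right_one g _ 0).2]
    exact ⟨rfl, 0, by simp [h0]⟩
  · by_cases hb : D (blk (2 * k + 2)) + d (blk (2 * k + 2)) = 2 * k + 2
    · have hk' : k + 3 ≤ g := by
        by_contra h
        have := hy.1
        omega
      obtain rfl : y = 4 * k + 5 := le_antisymm (hn _ (isKept_five hk' hb) (by omega)) (by omega)
      rw [(left_five g 0 k).1, (right_four g 0 k).1, (left_five g _ k).2, (right_four g _ k).2]
      exact ⟨rfl, -1, by omega⟩
    · have hk' : k + 3 ≤ g := by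
        by_contra h
        have := hy.1
        omega
      have hle := hn _ (isKept_two (k := k + 1) hk') (by omega)
      have h5 : y ≠ 4 * k + 5 := by
        rintro rfl
        rw [show 4 * k + 5 = 2 * (2 * k + 2) + 1 by ring, isKept_odd (by omega)] at hy
        exact hb hy.2
      obtain rfl : y = 4 * (k + 1) + 2 := by omega
      have := hB.blk_succ (e := 2 * k + 2) (by omega) (by omega) hb
      rw [(left_two g 0 (k + 1)).1, (right_four g 0 k).1, (left_two g _ (k + 1)).2,
        (right_four g _ k).2]
      exact ⟨this, 0, by omega⟩
  · by_cases hb : D (blk (2 * k + 1)) + d (blk (2 * k + 1)) = 2 * k + 1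
    · obtain rfl : y = 4 * k + 3 := le_antisymm (hn _ (isKept_three hk hb) (by omega)) (by omega)
      have : D (blk (2 * k + 2)) = 2 * k + 1 := hB.start_blk_succ (by omega) hb
      rw [(left_three g 0 k).1, (right_two g 0 k).1, (left_three g _ k).2, (right_two g _ k).2]
      exact ⟨rfl, 0, by omega⟩
    · have hle := hn _ (isKept_four hk) (by omega)
      have h5 : y ≠ 4 * k + 3 := by
        rintro rfl
        rw [show 4 * k + 3 = 2 * (2 * k + 1) + 1 by ring, isKept_odd (by omega)] at hy
        exact hb hy.2
      obtain rfl : y = 4 * k + 4 := by omega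
      have := hB.blk_succ (e := 2 * k + 1) (by omega) (by omega) hb
      rw [(left_four g 0 k).1, (right_two g 0 k).1, (left_four g _ k).2, (right_two g _ k).2, this]
      exact ⟨rfl, 0, by omega⟩
  · obtain rfl : y = 4 * k + 4 := le_antisymm (hn _ (isKept_four hk) (by omega)) (by omega)
    rw [(left_four g 0 k).1, (right_three g 0 k).1, (left_four g _ k).2, (right_three g _ k).2]
    exact ⟨rfl, -1, by omega⟩
  · obtain rfl : y = 4 * (k + 1) + 2 :=
      le_antisymm (hn _ (isKept_two (by omega)) (by omega)) (by omega)
    have := hB.start_blk_succ (by omega) hb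
    rw [show 4 * k + 5 = 4 * (k + 1) + 1 by ring, (left_two g 0 (k + 1)).1,
      (right_one g 0 (k + 1)).1, (left_two g _ (k + 1)).2, (right_one g _ (k + 1)).2]
    rw [show 2 * k + 2 + 1 = 2 * (k + 1) + 1 by ring] at this
    exact ⟨rfl, 0, by omega⟩

theorem botKey_values (g k : ℕ) : botKey g 0 = 4 * g - 2 ∧ botKey g 1 = 4 * g - 3 ∧
    botKey g (4 * k + 4) = 4 * k + 2 ∧ botKey g (4 * k + 3) = 4 * k + 3 ∧
    botKey g (4 * k + 2) = 4 * k + 4 ∧ botKey g (4 * k + 5) = 4 * k + 5 := by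
  refine ⟨?_, ?_, ?_, ?_, ?_, ?_⟩ <;> unfold botKey <;> split_ifs <;>
    first | contradiction | omega

theorem IsKept.eq_of_botKey {a k : ℕ} (ha : IsKept g d D blk a) :
    (k + 2 ≤ g → botKey g a = 4 * k + 2 → a = 4 * k + 4) ∧
    (k + 2 ≤ g → botKey g a = 4 * k + 3 → a = 4 * k + 3 ∧
      D (blk (2 * k + 1)) + d (blk (2 * k + 1)) = 2 * k + 1) ∧
    (k + 2 ≤ g → botKey g a = 4 * k + 4 → a = 4 * k + 2) ∧
    (k + 3 ≤ g → botKey g a = 4 * k + 5 → a = 4 * k + 5 ∧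
      D (blk (2 * k + 2)) + d (blk (2 * k + 2)) = 2 * k + 2) ∧
    (botKey g a = 4 * g - 3 → a = 1) ∧ (botKey g a = 4 * g - 2 → a = 0) := by
  have hg := ha.1
  rcases ha.cases with rfl | rfl | ⟨j, hj, rfl | rfl | ⟨rfl, hb⟩ | ⟨rfl, hj', hb⟩⟩
  · have := botKey_values g 0; omega
  · have := botKey_values g 0; omega
  · have := botKey_values g j; omega
  · have := botKey_values g j; omega
  · have := botKey_values g j
    by_cases h : j = k
    · subst h; omega
    · omega
  · have := botKey_values g j
    by_cases h : j = k
    · subst h; omega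
    · omega

theorem bot_next (hB : Blocks d D blk (2 * g - 2)) (hg : 2 ≤ g) {x y : ℕ}
    (hx : IsKept g d D blk x) (hy : IsKept g d D blk y) (hxy : botKey g x < botKey g y)
    (hn : ∀ z, IsKept g d D blk z → botKey g x < botKey g z → botKey g y ≤ botKey g z) :
    blk (leftIdx g y) = blk (rightIdx g x) ∧
    leftLev g (D (blk (leftIdx g y))) y = rightLev g (D (blk (rightIdx g x))) x := by
  rcases hx.cases with rfl | rfl | ⟨k, hk, rfl | rfl | ⟨rfl, hb⟩ | ⟨rfl, hk', hb⟩⟩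
  · exfalso
    have := botKey_values g 0
    rcases hy.cases with rfl | rfl | ⟨j, hj, rfl | rfl | ⟨rfl, hb⟩ | ⟨rfl, hj', hb⟩⟩ <;>
    first | omega | (have := botKey_values g j; omega)
  · have h := botKey_values g 0
    have h1 := hn 0 (isKept_zero hg) (by omega)
    obtain rfl : y = 0 := (hy.eq_of_botKey (k := 0)).2.2.2.2.2 (by omega)
    rw [(left_zero g 0).1, (right_one g 0 0).1, (left_zero g _).2, (right_one g _ 0).2]
    exact ⟨rfl, by simp⟩
  · have h := botKey_values g k
    by_cases hb : D (blk (2 * k + 1)) + d (blk (2 * k + 1)) = 2 * k + 1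
    · have h1 := hn _ (isKept_three hk hb) (by omega)
      obtain rfl : y = 4 * k + 3 := ((hy.eq_of_botKey (k := k)).2.1 hk (by omega)).1
      rw [(left_three g 0 k).1, (right_four g 0 k).1, (left_three g _ k).2, (right_four g _ k).2]
      exact ⟨rfl, rfl⟩
    · have h1 := hn _ (isKept_two hk) (by omega)
      have h5 : botKey g y ≠ 4 * k + 3 := fun e => hb ((hy.eq_of_botKey (k := k)).2.1 hk e).2
      obtain rfl : y = 4 * k + 2 := (hy.eq_of_botKey (k := k)).2.2.1 hk (by omega)
      have := hB.blk_succ (e := 2 * k + 1) (by omega) (by omega) hb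
      rw [(left_two g 0 k).1, (right_four g 0 k).1, (left_two g _ k).2, (right_four g _ k).2, this]
      exact ⟨rfl, rfl⟩
  · have h := botKey_values g k
    by_cases hk' : k + 3 ≤ g
    · by_cases hb : D (blk (2 * k + 2)) + d (blk (2 * k + 2)) = 2 * k + 2
      · have h1 := hn _ (isKept_five hk' hb) (by omega)
        obtain rfl : y = 4 * k + 5 := ((hy.eq_of_botKey (k := k)).2.2.2.1 hk' (by omega)).1
        rw [(left_five g 0 k).1, (right_two g 0 k).1, (left_five g _ k).2, (right_two g _ k).2]
        exact ⟨rfl, rfl⟩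
      · have h' := botKey_values g (k + 1)
        have h1 := hn _ (isKept_four (k := k + 1) hk') (by omega)
        have h5 : botKey g y ≠ 4 * k + 5 :=
          fun e => hb ((hy.eq_of_botKey (k := k)).2.2.2.1 hk' e).2
        obtain rfl : y = 4 * (k + 1) + 4 := (hy.eq_of_botKey (k := k + 1)).1 hk' (by omega)
        have := hB.blk_succ (e := 2 * k + 2) (by omega) (by omega) hb
        rw [(left_four g 0 (k + 1)).1, (right_two g 0 k).1, (left_four g _ (k + 1)).2,
          (right_two g _ k).2]
        rw [show 2 * k + 2 + 1 = 2 * (k + 1) + 1 by ring] at this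
        rw [this]
        exact ⟨rfl, by push_cast; ring⟩
    · obtain rfl : g = k + 2 := by omega
      have h1 := hn _ (isKept_one hg) (by omega)
      obtain rfl : y = 1 := (hy.eq_of_botKey (k := 0)).2.2.2.2.1 (by omega)
      rw [(left_one _ 0).1, (right_two _ 0 k).1, (left_one _ _).2, (right_two _ _ k).2,
        show 2 * (k + 2) - 2 = 2 * k + 2 by omega]
      exact ⟨rfl, by push_cast; ring⟩
  · have h := botKey_values g k
    have h1 := hn _ (isKept_two hk) (by omega)
    obtain rfl : y = 4 * k + 2 := (hy.eq_of_botKey (k := k)).2.2.1 hk (by omega)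
    rw [(left_two g 0 k).1, (right_three g 0 k).1, (left_two g _ k).2, (right_three g _ k).2]
    exact ⟨rfl, rfl⟩
  · have h := botKey_values g k
    have h' := botKey_values g (k + 1)
    have h1 := hn _ (isKept_four (k := k + 1) hk') (by omega)
    obtain rfl : y = 4 * (k + 1) + 4 := (hy.eq_of_botKey (k := k + 1)).1 hk' (by omega)
    rw [show 4 * k + 5 = 4 * (k + 1) + 1 by ring, (left_four g 0 (k + 1)).1,
      (right_one g 0 (k + 1)).1, (left_four g _ (k + 1)).2, (right_one g _ (k + 1)).2]
    exact ⟨rfl, rfl⟩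

theorem exists_leftLev (hB : Blocks d D blk (2 * g - 2)) (hd : ∀ i, 0 < d i)
    (i : Fin (m + 1)) (n : ℤ) : ∃ a, IsKept g d D blk a ∧ blk (leftIdx g a) = i ∧
      ((d i + 1 : ℕ) : ℤ) ∣ leftLev g (D (blk (leftIdx g a))) a - n := by
  have hdi := hd i
  have hle := hB.le_n i
  have hpred : 0 < D i → D (blk (D i)) + d (blk (D i)) = D i := by
    intro h
    obtain ⟨j, hj⟩ := hB.pred i h
    have := hd j
    rw [hB.uniq j (D i) (by omega) (by omega), hj]
  have hend : blk (D i + d i) = i := hB.uniq i _ (by omega) le_rfl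
  obtain ⟨N, hN1, hN2, q, hq⟩ : ∃ N : ℕ, D i / 2 + 1 ≤ N ∧ N ≤ D i / 2 + 1 + d i ∧
      ((d i + 1 : ℕ) : ℤ) ∣ (N : ℤ) - n := by
    have h1 := Int.emod_nonneg (n - (D i / 2 + 1 : ℕ)) (b := ((d i + 1 : ℕ) : ℤ)) (by omega)
    have h2 := Int.emod_lt_of_pos (n - (D i / 2 + 1 : ℕ)) (b := ((d i + 1 : ℕ) : ℤ)) (by omega)
    have h3 := Int.emod_add_mul_ediv (n - (D i / 2 + 1 : ℕ)) ((d i + 1 : ℕ) : ℤ)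
    set r := (n - (D i / 2 + 1 : ℕ)) % ((d i + 1 : ℕ) : ℤ)
    set q := (n - (D i / 2 + 1 : ℕ)) / ((d i + 1 : ℕ) : ℤ)
    refine ⟨D i / 2 + 1 + r.toNat, by omega, by omega, -q, ?_⟩
    rw [mul_neg]
    omega
  by_cases hb : 2 * N ≤ D i + d i + 1
  · obtain ⟨k, rfl⟩ : ∃ k, N = k + 1 := ⟨N - 1, by omega⟩
    by_cases hD : D i = 2 * k + 1
    · refine ⟨4 * k + 3, isKept_three (by omega) (by rw [← hD]; exact hpred (by omega)), ?_⟩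
      have hi : blk (2 * k + 2) = i := hB.uniq i _ (by omega) (by omega)
      rw [(left_three g 0 k).1, hi, (left_three g _ k).2]
      exact ⟨rfl, q, by push_cast at hq ⊢; exact hq⟩
    · refine ⟨4 * k + 2, isKept_two (by omega), ?_⟩
      have hi : blk (2 * k + 1) = i := hB.uniq i _ (by omega) (by omega)
      rw [(left_two g 0 k).1, hi, (left_two g _ k).2]
      exact ⟨rfl, q, by push_cast at hq ⊢; exact hq⟩
  · obtain ⟨p, hp⟩ : ∃ p, p + N = D i + d i + 1 := ⟨D i + d i + 1 - N, by omega⟩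
    have hlev : (D i : ℤ) - p - n = ((d i + 1 : ℕ) : ℤ) * (q - 1) := by
      rw [mul_sub, ← hq]; omega
    by_cases hE : 2 * p = D i + d i
    · obtain ⟨k, rfl⟩ : ∃ k, p = k + 1 := ⟨p - 1, by omega⟩
      rw [← hE, show 2 * (k + 1) = 2 * k + 2 by ring] at hend
      by_cases hk : k + 3 ≤ g
      · refine ⟨4 * k + 5, isKept_five hk (by rw [hend]; omega), ?_⟩
        rw [(left_five g 0 k).1, hend, (left_five g _ k).2]
        exact ⟨rfl, q - 1, by push_cast at hlev ⊢; exact hlev⟩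
      · obtain rfl : g = k + 2 := by omega
        refine ⟨1, isKept_one (by omega), ?_⟩
        rw [(left_one _ 0).1, show 2 * (k + 2) - 2 = 2 * k + 2 by omega, hend, (left_one _ _).2]
        exact ⟨rfl, q - 1, by rw [← hlev]; push_cast; ring⟩
    · refine ⟨4 * p + 4, isKept_four (by omega), ?_⟩
      have hi : blk (2 * p + 1) = i := hB.uniq i _ (by omega) (by omega)
      rw [(left_four g 0 p).1, hi, (left_four g _ p).2]
      exact ⟨rfl, q - 1, hlev⟩

/-- The sides starting at a given class whose left half-planes come in the ascending and in the
descending part of the class. -/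
theorem IsKept.leftLev_cases (hB : Blocks d D blk (2 * g - 2)) (hg : 2 ≤ g) {a : ℕ}
    {i : Fin (m + 1)} (ha : IsKept g d D blk a) (h0 : a ≠ 0) (hi : blk (leftIdx g a) = i) :
    (∃ k, D i ≤ 2 * k + 1 ∧ 2 * k + 1 ≤ D i + d i ∧ leftLev g (D i) a = k + 1 ∧
      a = if D i = 2 * k + 1 then 4 * k + 3 else 4 * k + 2) ∨
    (∃ p : ℕ, D i ≤ 2 * p ∧ 2 * p ≤ D i + d i ∧ leftLev g (D i) a = D i - p ∧
      a = if D i + d i = 2 * p then (if p + 1 = g then 1 else 4 * p + 1) else 4 * p + 4) := by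
  have hlast := hB.last_add
  rcases ha.cases with rfl | rfl | ⟨k, hk, rfl | rfl | ⟨rfl, hb⟩ | ⟨rfl, hk', hb⟩⟩
  · exact absurd rfl h0
  · rw [(left_one g 0).1, hB.last] at hi
    subst hi
    right
    have := hB.lt (2 * g - 2) (by omega) le_rfl
    rw [hB.last] at this
    refine ⟨g - 1, by omega, by omega, ?_, ?_⟩
    · rw [(left_one g _).2]; omega
    · rw [if_pos (by omega), if_pos (by omega)]
  · rw [(left_four g 0 k).1] at hi
    have h1 := hB.lt (2 * k + 1) (by omega) (by omega)
    have h2 := hB.le (2 * k + 1) (by omega) (by omega)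
    rw [hi] at h1 h2
    exact .inr ⟨k, by omega, by omega, (left_four g _ k).2, by rw [if_neg (by omega)]⟩
  · rw [(left_two g 0 k).1] at hi
    have h1 := hB.lt (2 * k + 1) (by omega) (by omega)
    have h2 := hB.le (2 * k + 1) (by omega) (by omega)
    rw [hi] at h1 h2
    exact .inl ⟨k, by omega, by omega, (left_two g _ k).2, by rw [if_neg (by omega)]⟩
  · rw [(left_three g 0 k).1] at hi
    have h1 := hB.start_blk_succ (by omega) hb
    have h2 := hB.le (2 * k + 2) (by omega) (by omega)
    rw [show 2 * k + 1 + 1 = 2 * k + 2 by ring, hi] at h1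
    rw [hi] at h2
    exact .inl ⟨k, by omega, by omega, (left_three g _ k).2, by rw [if_pos (by omega)]⟩
  · rw [(left_five g 0 k).1] at hi
    have h1 := hB.lt (2 * k + 2) (by omega) (by omega)
    rw [hi] at h1 hb
    refine .inr ⟨k + 1, by omega, by omega, by rw [(left_five g _ k).2]; push_cast; ring, ?_⟩
    rw [if_pos (by omega), if_neg (by omega)]
    ring

theorem eq_of_dvd_sub {k : ℕ} {p q : ℤ} (h : (k : ℤ) ∣ p - q) (h1 : p - q < k) (h2 : q - p < k) :
    p = q := by
  have := Int.eq_zero_of_abs_lt_dvd h (abs_lt.2 ⟨by omega, h1⟩)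
  omega

theorem eq_of_leftLev (hB : Blocks d D blk (2 * g - 2)) (hg : 2 ≤ g) {a b : ℕ}
    (ha : IsKept g d D blk a) (hb : IsKept g d D blk b) (ha0 : a ≠ 0) (hb0 : b ≠ 0)
    (hab : blk (leftIdx g a) = blk (leftIdx g b))
    (h : ((d (blk (leftIdx g a)) + 1 : ℕ) : ℤ) ∣ leftLev g (D (blk (leftIdx g a))) a -
      leftLev g (D (blk (leftIdx g b))) b) : a = b := by
  rw [← hab] at h
  obtain ⟨i, hi⟩ : ∃ i, blk (leftIdx g a) = i := ⟨_, rfl⟩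
  have hi' := hab ▸ hi
  rw [hi] at h
  rcases ha.leftLev_cases hB hg ha0 hi with ⟨k, h1, h2, h3, h4⟩ | ⟨k, h1, h2, h3, h4⟩ <;>
  rcases hb.leftLev_cases hB hg hb0 hi' with ⟨l, h5, h6, h7, h8⟩ | ⟨l, h5, h6, h7, h8⟩ <;>
  rw [h3, h7] at h
  · have := eq_of_dvd_sub h (by omega) (by omega)
    obtain rfl : k = l := by omega
    rw [h4, h8]
  · have := eq_of_dvd_sub h (by omega) (by omega)
    omega
  · have := eq_of_dvd_sub h (by omega) (by omega)
    omega
  · have := eq_of_dvd_sub h (by omega) (by omega)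
    obtain rfl : k = l := by omega
    rw [h4, h8]

end Kept

end PrincipalPermutation

namespace PrincipalPermutation

theorem isIrreduciblePermutation_of_head_eq_getLast {top bot : List ℕ} {a : ℕ} (hp : bot.Perm top)
    (ht : top.Nodup) (ha : top.head? = some a) (hb : bot.getLast? = some a) :
    IsIrreduciblePermutation top bot := by
  intro k hk hk' h
  have hbn : bot.Nodup := hp.nodup_iff.2 ht
  have h1 : a ∈ (top.take k).toFinset := by
    obtain ⟨t, rfl⟩ := List.head?_eq_some_iff.1 ha
    obtain ⟨j, rfl⟩ : ∃ j, k = j + 1 := ⟨k - 1, by omega⟩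
    simp
  rw [h, List.mem_toFinset] at h1
  obtain ⟨t, rfl⟩ := List.getLast?_eq_some_iff.1 hb
  have hlen := hp.length_eq
  rw [List.length_append, List.length_singleton] at hlen
  rw [List.take_append_of_le_length (by omega)] at h1
  have := List.mem_of_mem_take h1
  rw [List.nodup_append] at hbn
  exact hbn.2.2 a this a (by simp) rfl

theorem head?_of_forall_le {l : List ℕ} {f : ℕ → ℕ} (hl : l.Pairwise fun a b => f a < f b) {a : ℕ}
    (ha : a ∈ l) (h : ∀ z ∈ l, f a ≤ f z) : l.head? = some a := by
  obtain _ | ⟨b, t⟩ := l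
  · simp at ha
  · rcases List.mem_cons.1 ha with rfl | h1
    · rfl
    · exact absurd ((List.pairwise_cons.1 hl).1 a h1) (h b (by simp)).not_gt

theorem getLast?_of_forall_le {l : List ℕ} {f : ℕ → ℕ} (hl : l.Pairwise fun a b => f a < f b)
    {a : ℕ} (ha : a ∈ l) (h : ∀ z ∈ l, f z ≤ f a) : l.getLast? = some a := by
  rcases List.eq_nil_or_concat l with rfl | ⟨t, b, rfl⟩
  · simp at ha
  · rw [List.concat_eq_append] at *
    rcases List.mem_append.1 ha with h1 | h1
    · exact absurd ((List.pairwise_append.1 hl).2.2 a h1 b (by simp)) (h b (by simp)).not_gt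
    · rw [List.mem_singleton.1 h1]
      simp

theorem botKey_le {g a : ℕ} (ha : a < 4 * g - 3) : botKey g a ≤ botKey g 0 := by
  rw [(botKey_values g 0).1]
  unfold botKey
  split_ifs <;> omega

theorem eq_four_of_botKey_le {g a : ℕ} (hg : 2 ≤ g) (h : botKey g a ≤ 2) : a = 4 := by
  unfold botKey at h
  split_ifs at h <;> omega

end PrincipalPermutation

open PrincipalPermutation in
theorem proposition2p1 (g m : ℕ) (d : Fin (m + 1) → ℕ) (hd : ∀ i, 0 < d i)
    (hsum : (∑ i, d i) + 2 = 2 * g) :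
    IsCylindrical (eraseSymbols (erasedSymbols d) (principalTop g))
      (eraseSymbols (erasedSymbols d) (principalBot g)) ∧
    RepresentsStratum (eraseSymbols (erasedSymbols d) (principalTop g))
      (eraseSymbols (erasedSymbols d) (principalBot g)) d := by
  have hg : 2 ≤ g := by
    have := hd 0
    have := Finset.single_le_sum (f := d) (fun i _ => Nat.zero_le _) (Finset.mem_univ 0)
    omega
  set D : Fin (m + 1) → ℕ := fun i => ∑ j ∈ Finset.Iio i, d j
  obtain ⟨blk, hB⟩ := exists_blocks hd
  rw [show ∑ i, d i = 2 * g - 2 by omega] at hB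
  set top := eraseSymbols (erasedSymbols d) (principalTop g) with htop
  set bot := eraseSymbols (erasedSymbols d) (principalBot g) with hbot
  have hkept : ∀ a, (a < 4 * g - 3 ∧ a ∉ erasedSymbols d) ↔ IsKept g d D blk a := by
    intro a
    refine and_congr_right fun ha => ?_
    obtain ⟨e, rfl | rfl⟩ := Nat.even_or_odd' a
    · exact ⟨fun _ => .inl (by omega), fun _ => even_notMem_erasedSymbols e⟩
    · rcases Nat.eq_zero_or_pos e with rfl | he
      · exact ⟨fun _ => .inr (.inl rfl), fun _ => one_notMem_erasedSymbols⟩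
      · rw [odd_notMem_erasedSymbols hB he (by omega), show (2 * e + 1) / 2 = e by omega]
        constructor
        · exact fun h => .inr (.inr h.symm)
        · rintro (h | h | h)
          · omega
          · omega
          · exact h.symm
  have hmt : ∀ a, a ∈ top ↔ IsKept g d D blk a := by
    intro a
    rw [← hkept, htop]
    simp [eraseSymbols, principalTop]
  have hmb : ∀ a, a ∈ bot ↔ IsKept g d D blk a := by
    intro a
    rw [← hkept, hbot]
    simp [eraseSymbols, mem_principalBot hg]
  have hst : top.Pairwise fun a b => id a < id b := List.pairwise_lt_range.filter _
  have hsb : bot.Pairwise fun a b => botKey g a < botKey g b := (pairwise_principalBot hg).filter _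
  have hnt := nodup_of_key hst
  have hnb := nodup_of_key hsb
  have hperm : bot.Perm top :=
    (List.perm_ext_iff_of_nodup hnb hnt).2 fun a => by rw [hmt, hmb]
  have h0 := (hmt 0).2 (isKept_zero hg)
  have h0' := (hmb 0).2 (isKept_zero hg)
  have hne : top ≠ [] := List.ne_nil_of_mem h0
  have hhead : top.head? = some 0 :=
    head?_of_forall_le hst h0 fun z _ => Nat.zero_le z
  have hlast : bot.getLast? = some 0 :=
    getLast?_of_forall_le hsb h0' fun z hz => botKey_le ((hmb z).1 hz).1
  have hfin : top.toFinset = bot.toFinset := by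
    ext a
    rw [List.mem_toFinset, List.mem_toFinset, hperm.mem_iff]
  have htrue : IsTruePermutation top bot := ⟨hne, hnt, hperm⟩
  have h2 : 2 ≤ top.length := by
    have h1 := (hmt 1).2 (isKept_one hg)
    have := (idxOf_lt_idxOf_iff hst h0 h1).2 (by norm_num)
    have := List.idxOf_lt_length_of_mem h1
    omega
  refine ⟨⟨.inl ⟨0, hhead, hlast⟩, by rw [hfin]; exact ssubset_irrefl _,
    by rw [hfin]; exact ssubset_irrefl _⟩, ?_⟩
  have hlt : ∀ a ∈ top, top.idxOf a + 1 = top.length → a = 4 * g - 4 := by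
    intro a ha h
    have h4 : 4 * (g - 2) + 4 ≤ a :=
      key_of_idxOf_last hst ha h _ ((hmt _).2 (isKept_four (k := g - 2) (by omega)))
    have := ((hmt a).1 ha).1
    omega
  have hft : ∀ a ∈ top, top.idxOf a = 0 → a = 0 := fun a ha h =>
    Nat.le_zero.1 (key_of_idxOf_zero hst ha h 0 h0)
  have hr4 : blk (rightIdx g (4 * g - 4)) = Fin.last m ∧
      rightLev g (D (blk (rightIdx g (4 * g - 4)))) (4 * g - 4) = g - 1 := by
    rw [show 4 * g - 4 = 4 * (g - 2) + 4 by omega, (right_four g 0 _).1, (right_four g _ _).2,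
      show 2 * (g - 2) + 2 = 2 * g - 2 by omega]
    exact ⟨hB.last, by omega⟩
  obtain ⟨R, Q, hL⟩ := cornerLabels_of_levels (top := top) (bot := bot) (d := d)
    (c := fun a => blk (leftIdx g a)) (c' := fun a => blk (rightIdx g a))
    (lev := fun a => leftLev g (D (blk (leftIdx g a))) a)
    (lev' := fun a => rightLev g (D (blk (rightIdx g a))) a)
    (by
      intro a ha b hb h h'
      obtain rfl := hft a ha h
      obtain rfl : b = 4 := by
        have h4 := key_of_idxOf_zero hsb (hperm.mem_iff.2 hb) h' 4
          ((hmb 4).2 (isKept_four (k := 0) hg))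
        rw [(botKey_values g 0).2.2.1] at h4
        exact eq_four_of_botKey_le hg h4
      rw [(left_zero g 0).1, (left_zero g _).2, (left_four g 0 0).1, (left_four g _ 0).2]
      exact ⟨rfl, by simp⟩)
    (by
      intro a ha b hb h h'
      obtain rfl := hlt a ha h
      obtain rfl : b = 0 := by
        have h4 := key_of_idxOf_last hsb (hperm.mem_iff.2 hb) (by rw [h', hperm.length_eq]) 0 h0'
        have h5 := ((hmt b).1 hb)
        have h6 := botKey_le h5.1
        rw [(botKey_values g 0).1] at h4 h6
        exact (h5.eq_of_botKey (k := 0)).2.2.2.2.2 (by omega)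
      rw [hr4.2, hr4.1, (right_zero g 0).1, hB.last, (right_zero g _).2]
      exact ⟨rfl, rfl⟩)
    (by
      intro x hx y hy h
      obtain ⟨h1, h2⟩ := key_of_idxOf_succ hst hx hy h
      exact top_next hB hg ((hmt x).1 hx) ((hmt y).1 hy) h1 fun z hz => h2 z ((hmt z).2 hz))
    (by
      intro x hx y hy h
      obtain ⟨h1, h2⟩ := key_of_idxOf_succ hsb (hperm.mem_iff.2 hx) (hperm.mem_iff.2 hy) h
      exact bot_next hB hg ((hmt x).1 hx) ((hmt y).1 hy) h1 fun z hz => h2 z ((hmb z).2 hz))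
    (by
      intro i n
      obtain ⟨a, ha, h⟩ := exists_leftLev hB hd i n
      exact ⟨a, (hmt a).2 ha, h⟩)
    (by
      intro a ha b hb h1 h2 hab h
      have hne0 : ∀ a, top.idxOf a ≠ 0 → a ≠ 0 := by
        rintro a h rfl
        obtain ⟨t, ht⟩ := List.head?_eq_some_iff.1 hhead
        rw [ht] at h
        simp at h
      exact eq_of_leftLev hB hg ((hmt a).1 ha) ((hmt b).1 hb) (hne0 a h1) (hne0 b h2) hab h)
  refine Polygon.representsStratum_of_cornerLabels htrue
    (isIrreduciblePermutation_of_head_eq_getLast hperm hnt hhead hlast) h2 hL ?_ ?_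
  · intro a ha h
    obtain rfl := hft a ha h
    rw [(left_zero g 0).1, hB.first]
  · intro a ha h
    obtain rfl := hlt a ha h
    exact hr4.1

end
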